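/- Let $\mathcal H$ be a separable complex Hilbert space, inner products being linear in the second argument, and let $-\infty<a<b\le\infty$. Let $V:(a,b)\to\mathcal B(\mathcal H)$ be weakly measurable with $\|V(\cdot)\|\in L^1_{\rm loc}((a,b))$ and $V(x)=V(x)^*$ for a.e. $x\in(a,b)$. Put $\tau=-\frac{d^2}{dx^2}+V(\cdot)$ and let $H_{\max}f=\tau f$ in $L^2((a,b);dx;\mathcal H)$ with domain $$\operatorname{dom}(H_{\max})=\{f\in L^2((a,b);dx;\mathcal H)\,|\,f\in W^{2,1}_{\rm loc}((a,b);dx;\mathcal H),\ \tau f\in L^2((a,b);dx;\mathcal H)\}.$$ Assume that $a$ is a regular endpoint, i.e. $\int_a^c\|V(x)\|\,dx<\infty$ for some $c\in(a,b)$, and that $b$ is of limit-point type for $\tau$, i.e. $(u(x),v'(x))_{\mathcal H}-(u'(x),v(x))_{\mathcal H}\to0$ as $x\uparrow b$ for all $u,v\in\operatorname{dom}(H_{\max})$. Let $\alpha=\alpha^*\in\mathcal B(\mathcal H)$ and let $H_\alpha$ be the restriction of $H_{\max}$ to $\{u\in\operatorname{dom}(H_{\max})\,|\,\sin(\alpha)u'(a)+\cos(\alpha)u(a)=0\}$.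 For $z\in\mathbb C$ let $\theta_\alpha(z,\cdot,a),\phi_\alpha(z,\cdot,a):[a,b)\to\mathcal B(\mathcal H)$ be the solutions of $-Y''+VY=zY$ with $\theta_\alpha(z,a,a)=\phi_\alpha'(z,a,a)=\cos(\alpha)$ and $-\phi_\alpha(z,a,a)=\theta_\alpha'(z,a,a)=\sin(\alpha)$. (That $Y$ is a solution means: for every $h\in\mathcal H$, $Yh\in W^{2,1}_{\rm loc}([a,b);dx;\mathcal H)$, and $-(Yh)''+VYh=zYh$ a.e.) For $z\in\mathbb C\setminus\mathbb R$ put $\psi_\alpha(z,x)=\theta_\alpha(z,x,a)+\phi_\alpha(z,x,a)m_\alpha(z)$, where $m_\alpha(z)\in\mathcal B(\mathcal H)$ is the operator that maps $f$ to $g$ for each solution $\theta_\alpha(z,\cdot,a)f+\phi_\alpha(z,\cdot,a)g$ lying in $\mathcal D_z=\{u\in\operatorname{dom}(H_{\max})\,|\,H_{\max}u=zu\}$, each $f\in\mathcal H$ occurring in exactly one such solution. Then $\mathbb C\setminus\mathbb R\subseteq\rho(H_\alpha)$, and for every $z\in\rho(H_\alpha)$ there is a kernel $G_\alpha(z,\cdot,\cdot):[a,b)\times[a,b)\to\mathcal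 B(\mathcal H)$ (the Green's function) with $$\big((H_\alpha-zI)^{-1}u\big)(x)=\int_a^b dx'\,G_\alpha(z,x,x')u(x'),\qquad u\in L^2((a,b);dx;\mathcal H),\ x\in[a,b),$$ where the left-hand side denotes the value at $x$ of the representative that is continuous on $[a,b)$. The integral exists as a Bochner integral over $(a,c)$ for every $c\in(a,b)$, and over $(a,b)$ both as the norm limit in $\mathcal H$ of these as $c\uparrow b$ and as a weak integral. For $z\in\mathbb C\setminus\mathbb R$, $$G_\alpha(z,x,x')=\begin{cases}\phi_\alpha(z,x,a)\,\psi_\alpha(\overline z,x')^*,& a\le x\le x'<b,\\ \psi_\alpha(z,x)\,\phi_\alpha(\overline z,x',a)^*,& a\le x'\le x<b.\end{cases}$$ -/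

import Mathlib

open MeasureTheory Set Filter Topology

noncomputable section

namespace WeylTitchmarsh

/-- The open interval `(a, b) ⊆ ℝ`, where `a` is finite and `b` may be `+∞`. -/
def ioo (a : ℝ) (b : EReal) : Set ℝ := {x | a < x ∧ (x : EReal) < b}

/-- The half-open interval `[a, b) ⊆ ℝ`, where `a` is finite and `b` may be `+∞`. -/
def ico (a : ℝ) (b : EReal) : Set ℝ := {x | a ≤ x ∧ (x : EReal) < b}

/-- The filter describing real `x ↑ b`; it is `atTop` for `b = +∞`. -/
def toLeft (b : EReal) : Filter ℝ := comap (fun x : ℝ => (x : EReal)) (𝓝[<] b)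

/-- `y` is strongly locally absolutely continuous on the interval `S`, with strong derivative `g`:
`g` is locally (Bochner) integrable on `S` and `y x = y x₀ + ∫_{x₀}^x g`. -/
structure IsPrimitiveOn {E : Type*} [NormedAddCommGroup E] [NormedSpace ℝ E]
    (S : Set ℝ) (y g : ℝ → E) : Prop where
  locInt : LocallyIntegrableOn g S volume
  eq : ∀ x₀ ∈ S, ∀ x ∈ S, y x = y x₀ + ∫ t in x₀..x, g t

/-- `y ∈ W^{2,1}_loc(S; dx; E)` (continuous representative), with `y' = y₁` and `y'' = y₂`. -/
def IsW21Loc {E : Type*} [NormedAddCommGroup E] [NormedSpace ℝ E]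
    (S : Set ℝ) (y y₁ y₂ : ℝ → E) : Prop :=
  IsPrimitiveOn S y y₁ ∧ IsPrimitiveOn S y₁ y₂

section Facts

variable {E : Type*} [NormedAddCommGroup E] [NormedSpace ℝ E]

theorem IsPrimitiveOn.add {S : Set ℝ} (hS : S.OrdConnected) {y g w h : ℝ → E}
    (hy : IsPrimitiveOn S y g) (hw : IsPrimitiveOn S w h) :
    IsPrimitiveOn S (y + w) (g + h) := by
  refine ⟨hy.locInt.add hw.locInt, fun x₀ h₀ x hx => ?_⟩
  have hsub : uIcc x₀ x ⊆ S := hS.uIcc_subset h₀ hx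
  have i₁ : IntervalIntegrable g volume x₀ x :=
    (hy.locInt.integrableOn_compact_subset hsub isCompact_uIcc).intervalIntegrable
  have i₂ : IntervalIntegrable h volume x₀ x :=
    (hw.locInt.integrableOn_compact_subset hsub isCompact_uIcc).intervalIntegrable
  simp only [Pi.add_apply]
  rw [intervalIntegral.integral_add i₁ i₂, hy.eq x₀ h₀ x hx, hw.eq x₀ h₀ x hx]
  abel

theorem IsPrimitiveOn.smul {F : Type*} [NormedAddCommGroup F] [NormedSpace ℂ F]
    {S : Set ℝ} {y g : ℝ → F} (c : ℂ)
    (hy : IsPrimitiveOn S y g) : IsPrimitiveOn S (c • y) (c • g) := by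
  refine ⟨hy.locInt.smul c, fun x₀ h₀ x hx => ?_⟩
  simp only [Pi.smul_apply]
  rw [intervalIntegral.integral_smul, hy.eq x₀ h₀ x hx, smul_add]

theorem IsPrimitiveOn.zero (S : Set ℝ) : IsPrimitiveOn S (0 : ℝ → E) 0 :=
  ⟨locallyIntegrableOn_zero, fun _ _ _ _ => by simp⟩

theorem ioo_ordConnected (a : ℝ) (b : EReal) : (ioo a b).OrdConnected :=
  ⟨fun _ hx _ hy _ hz =>
    ⟨hx.1.trans_le hz.1, (EReal.coe_le_coe_iff.2 hz.2).trans_lt hy.2⟩⟩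

theorem isOpen_ioo (a : ℝ) (b : EReal) : IsOpen (ioo a b) :=
  (isOpen_lt continuous_const continuous_id).inter
    (isOpen_lt continuous_coe_real_ereal continuous_const)

theorem exists_nhds_ioo {a : ℝ} {b : EReal} {x : ℝ} (hx : x ∈ ioo a b) :
    ∃ c d, x ∈ Ioo c d ∧ Icc c d ⊆ ioo a b := by
  obtain ⟨c, d, h, hn, hs⟩ := exists_Icc_mem_subset_of_mem_nhds ((isOpen_ioo a b).mem_nhds hx)
  exact ⟨c, d, by simpa [interior_Icc] using mem_interior_iff_mem_nhds.2 hn, hs⟩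

theorem IsPrimitiveOn.continuousOn {a : ℝ} {b : EReal} {y g : ℝ → E}
    (h : IsPrimitiveOn (ioo a b) y g) : ContinuousOn y (ioo a b) := by
  intro x hx
  obtain ⟨c, d, hxc, hs⟩ := exists_nhds_ioo hx
  have hcd : c ≤ d := (hxc.1.trans hxc.2).le
  have hint : IntegrableOn g (uIcc c d) volume := by
    rw [uIcc_of_le hcd]
    exact h.locInt.integrableOn_compact_subset hs isCompact_Icc
  have h₁ : ContinuousOn (fun t => y c + ∫ s in c..t, g s) (Icc c d) := by
    rw [← uIcc_of_le hcd]
    exact continuousOn_const.add (intervalIntegral.continuousOn_primitive_interval hint)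
  have h₂ : ContinuousOn y (Icc c d) :=
    h₁.congr fun t ht => h.eq c (hs (left_mem_Icc.2 hcd)) t (hs ht)
  exact (h₂.continuousAt (Icc_mem_nhds hxc.1 hxc.2)).continuousWithinAt

theorem IsPrimitiveOn.eq_zero [CompleteSpace E] {a : ℝ} {b : EReal} {y g : ℝ → E}
    (h : IsPrimitiveOn (ioo a b) y g) (h₀ : ∀ x ∈ ioo a b, y x = 0) :
    ∀ᵐ x ∂(volume.restrict (ioo a b)), g x = 0 := by
  rw [ae_restrict_iff' (isOpen_ioo a b).measurableSet, ae_iff]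
  refine measure_null_of_locally_null _ fun x hx => ?_
  simp only [mem_ofPred_eq, Classical.not_imp] at hx
  obtain ⟨c, d, hxc, hs⟩ := exists_nhds_ioo hx.1
  have hcd : c ≤ d := (hxc.1.trans hxc.2).le
  refine ⟨_, inter_mem_nhdsWithin _ (Ioo_mem_nhds hxc.1 hxc.2), ?_⟩
  have hint : IntervalIntegrable g volume c d := by
    refine IntegrableOn.intervalIntegrable ?_
    rw [uIcc_of_le hcd]
    exact h.locInt.integrableOn_compact_subset hs isCompact_Icc
  refine measure_mono_null ?_ (ae_iff.1 hint.ae_hasDerivAt_integral)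
  rintro t ⟨ht, htc⟩ hD
  simp only [mem_ofPred_eq, Classical.not_imp] at ht
  have hD' := hD (by rw [uIcc_of_le hcd]; exact Ioo_subset_Icc_self htc) c left_mem_uIcc
  have hz : (fun x => ∫ s in c..x, g s) =ᶠ[𝓝 t] fun _ => (0 : E) := by
    filter_upwards [Ioo_mem_nhds htc.1 htc.2] with s hs'
    have hc := hs (left_mem_Icc.2 hcd)
    have hs'' := hs (Ioo_subset_Icc_self hs')
    have := h.eq c hc s hs''
    rw [h₀ c hc, h₀ s hs''] at this
    simpa using this.symm
  exact ht.2 (hD'.unique ((hasDerivAt_const t (0 : E)).congr_of_eventuallyEq hz))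

end Facts

variable {H : Type*} [NormedAddCommGroup H] [InnerProductSpace ℂ H] [CompleteSpace H]

/-- The Hilbert space `L²((a,b); dx; H)`. -/
abbrev L2 (H : Type*) [NormedAddCommGroup H] (a : ℝ) (b : EReal) : Type _ :=
  Lp H 2 (volume.restrict (ioo a b))

/-- `V : (a,b) → B(H)` is weakly measurable, `‖V(·)‖` is locally integrable on `(a,b)`, and
`V(x)` is self-adjoint for a.e. `x`. -/
structure IsPotential (a : ℝ) (b : EReal) (V : ℝ → H →L[ℂ] H) : Prop where
  weaklyMeasurable :
    ∀ f g : H, AEMeasurable (fun x => inner ℂ f (V x g)) (volume.restrict (ioo a b))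
  locInt : LocallyIntegrableOn (fun x => ‖V x‖) (ioo a b) volume
  selfAdjoint : ∀ᵐ x ∂(volume.restrict (ioo a b)), IsSelfAdjoint (V x)

/-- The (finite) endpoint `a` is regular for `-(d²/dx²) + V`. -/
def RegularLeft (a : ℝ) (b : EReal) (V : ℝ → H →L[ℂ] H) : Prop :=
  ∃ c ∈ ioo a b, IntegrableOn (fun x => ‖V x‖) (Icc a c) volume

/-- The graph of the maximal operator: pairs `(f, τ f)` where `f ∈ L²` has a representative
`y ∈ W^{2,1}_loc((a,b))` and `τ f = -y'' + V y ∈ L²`. -/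
def maxGraph (a : ℝ) (b : EReal) (V : ℝ → H →L[ℂ] H) : Submodule ℂ (L2 H a b × L2 H a b) where
  carrier := {p | ∃ y y₁ y₂ : ℝ → H, IsW21Loc (ioo a b) y y₁ y₂ ∧
    p.1 =ᵐ[volume.restrict (ioo a b)] y ∧
    p.2 =ᵐ[volume.restrict (ioo a b)] fun x => -y₂ x + V x (y x)}
  add_mem' := by
    rintro p q ⟨y, y₁, y₂, hy, hp, hp'⟩ ⟨w, w₁, w₂, hw, hq, hq'⟩
    refine ⟨y + w, y₁ + w₁, y₂ + w₂, ⟨hy.1.add (ioo_ordConnected a b) hw.1,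
      hy.2.add (ioo_ordConnected a b) hw.2⟩, (Lp.coeFn_add _ _).trans (hp.add hq), ?_⟩
    refine (Lp.coeFn_add _ _).trans ((hp'.add hq').trans (Eventually.of_forall fun x => ?_))
    simp only [Pi.add_apply, map_add]
    abel
  zero_mem' := ⟨0, 0, 0, ⟨.zero _, .zero _⟩, Lp.coeFn_zero _ _ _,
    (Lp.coeFn_zero _ _ _).trans (Eventually.of_forall fun x => by simp)⟩
  smul_mem' := by
    rintro c p ⟨y, y₁, y₂, hy, hp, hp'⟩
    refine ⟨c • y, c • y₁, c • y₂, ⟨hy.1.smul c, hy.2.smul c⟩,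
      (Lp.coeFn_smul _ _).trans (hp.const_smul c), ?_⟩
    refine (Lp.coeFn_smul _ _).trans
      ((hp'.const_smul c).trans (Eventually.of_forall fun x => ?_))
    simp [smul_add]

theorem maxGraph_functional (a : ℝ) (b : EReal) (V : ℝ → H →L[ℂ] H) :
    ∀ p ∈ maxGraph a b V, p.1 = 0 → p.2 = 0 := by
  rintro ⟨f, g⟩ ⟨y, y₁, y₂, hy, hf, hg⟩ h0
  simp only at hf hg h0
  subst h0
  have hy0 : ∀ x ∈ ioo a b, y x = 0 :=
    Measure.eqOn_open_of_ae_eq (hf.symm.trans (Lp.coeFn_zero _ _ _)) (isOpen_ioo a b)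
      hy.1.continuousOn continuousOn_const
  have hy1 : ∀ x ∈ ioo a b, y₁ x = 0 :=
    Measure.eqOn_open_of_ae_eq (hy.1.eq_zero hy0) (isOpen_ioo a b)
      hy.2.continuousOn continuousOn_const
  refine Lp.ext (hg.trans (EventuallyEq.trans ?_ (Lp.coeFn_zero _ _ _).symm))
  filter_upwards [hy.2.eq_zero hy1,
    ae_restrict_mem (isOpen_ioo a b).measurableSet] with x hx hxm
  simp [hx, hy0 x hxm]

/-- The maximal operator `H_max f = τ f` in `L²((a,b); dx; H)`. -/
def maxOp (a : ℝ) (b : EReal) (V : ℝ → H →L[ℂ] H) : L2 H a b →ₗ.[ℂ] L2 H a b :=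
  (maxGraph a b V).toLinearPMap

theorem maxOp_graph (a : ℝ) (b : EReal) (V : ℝ → H →L[ℂ] H) :
    (maxOp a b V).graph = maxGraph a b V :=
  Submodule.toLinearPMap_graph_eq _ (maxGraph_functional a b V)

/-- The endpoint `b` is of limit-point type: `W_*(u, v)(x) = (u, v') - (u', v) → 0` as `x ↑ b`, for
all `u, v ∈ dom(H_max)` (`y, y₁`, and `w, w₁`, are `u, u'`, and `v, v'`). -/
def LimitPointRight (a : ℝ) (b : EReal) (V : ℝ → H →L[ℂ] H) : Prop :=
  ∀ u ∈ (maxOp a b V).domain, ∀ v ∈ (maxOp a b V).domain,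
    ∀ y y₁ y₂ w w₁ w₂ : ℝ → H,
      IsW21Loc (ioo a b) y y₁ y₂ → u =ᵐ[volume.restrict (ioo a b)] y →
      IsW21Loc (ioo a b) w w₁ w₂ → v =ᵐ[volume.restrict (ioo a b)] w →
      Tendsto (fun x => inner ℂ (y x) (w₁ x) - inner ℂ (y₁ x) (w x)) (toLeft b) (𝓝 0)

/-- `sin(α)`, by the functional calculus of the self-adjoint operator `α`. -/
def sinOp (α : H →L[ℂ] H) : H →L[ℂ] H := cfc Real.sin α

/-- `cos(α)`, by the functional calculus of the self-adjoint operator `α`. -/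
def cosOp (α : H →L[ℂ] H) : H →L[ℂ] H := cfc Real.cos α

/-- The `f ∈ L²` with a `W^{2,1}_loc((a,b))` representative `y` such that `y` and `y'` have limits
`y(a)` and `y'(a)` at `a`, and `sin(α) y'(a) + cos(α) y(a) = 0`. -/
def boundaryCondition (a : ℝ) (b : EReal) (α : H →L[ℂ] H) : Submodule ℂ (L2 H a b) where
  carrier := {f | ∃ (y y₁ y₂ : ℝ → H) (ya y₁a : H), IsW21Loc (ioo a b) y y₁ y₂ ∧
    f =ᵐ[volume.restrict (ioo a b)] y ∧
    Tendsto y (𝓝[>] a) (𝓝 ya) ∧ Tendsto y₁ (𝓝[>] a) (𝓝 y₁a) ∧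
    sinOp α y₁a + cosOp α ya = 0}
  add_mem' := by
    rintro f g ⟨y, y₁, y₂, ya, y₁a, hy, hf, t, t', e⟩ ⟨w, w₁, w₂, wa, w₁a, hw, hg, s, s', e'⟩
    refine ⟨y + w, y₁ + w₁, y₂ + w₂, ya + wa, y₁a + w₁a,
      ⟨hy.1.add (ioo_ordConnected a b) hw.1, hy.2.add (ioo_ordConnected a b) hw.2⟩,
      (Lp.coeFn_add _ _).trans (hf.add hg), t.add s, t'.add s', ?_⟩
    rw [map_add, map_add, add_add_add_comm, e, e', add_zero]
  zero_mem' := ⟨0, 0, 0, 0, 0, ⟨.zero _, .zero _⟩, Lp.coeFn_zero _ _ _, tendsto_const_nhds,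
    tendsto_const_nhds, by simp⟩
  smul_mem' := by
    rintro c f ⟨y, y₁, y₂, ya, y₁a, hy, hf, t, t', e⟩
    refine ⟨c • y, c • y₁, c • y₂, c • ya, c • y₁a, ⟨hy.1.smul c, hy.2.smul c⟩,
      (Lp.coeFn_smul _ _).trans (hf.const_smul c), t.const_smul c, t'.const_smul c, ?_⟩
    rw [map_smul, map_smul, ← smul_add, e, smul_zero]

/-- The operator `H_α`: the restriction of `H_max` to
`{u ∈ dom(H_max) | sin(α) u'(a) + cos(α) u(a) = 0}`. -/
def schrodingerOp (a : ℝ) (b : EReal) (V : ℝ → H →L[ℂ] H) (α : H →L[ℂ] H) :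
    L2 H a b →ₗ.[ℂ] L2 H a b :=
  (maxOp a b V).domRestrict (boundaryCondition a b α)

/-- The bounded, everywhere defined operator `R` is the inverse `(T - z)⁻¹` of
`T - z : dom(T) → X`. -/
def IsResolvent {X : Type*} [NormedAddCommGroup X] [NormedSpace ℂ X]
    (T : X →ₗ.[ℂ] X) (z : ℂ) (R : X →L[ℂ] X) : Prop :=
  (∀ f : T.domain, R (T f - z • (f : X)) = f) ∧
    ∀ g : X, ∃ h : R g ∈ T.domain, T ⟨R g, h⟩ - z • R g = g

/-- The resolvent set `ρ(T)` of an operator `T` in `X`. -/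
def resolventSetOf {X : Type*} [NormedAddCommGroup X] [NormedSpace ℂ X]
    (T : X →ₗ.[ℂ] X) : Set ℂ := {z | ∃ R : X →L[ℂ] X, IsResolvent T z R}

/-- `Y`, with strong derivative `Y₁`, is a `B(H)`-valued solution on `[a,b)` of the initial value
problem `-Y'' + V Y = z Y`, `Y(a) = A`, `Y'(a) = B` at the regular endpoint `a`. -/
def IsOpSolution (a : ℝ) (b : EReal) (V : ℝ → H →L[ℂ] H) (z : ℂ) (A B : H →L[ℂ] H)
    (Y Y₁ : ℝ → H →L[ℂ] H) : Prop :=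
  Y a = A ∧ Y₁ a = B ∧ ∀ h : H, ∃ y₂ : ℝ → H,
    IsW21Loc (ico a b) (fun x => Y x h) (fun x => Y₁ x h) y₂ ∧
    ∀ᵐ x ∂(volume.restrict (ioo a b)), -y₂ x + V x (Y x h) = z • Y x h

/-- The (on `[a,b)` unique) solution of `-Y'' + V Y = z Y`, `Y(a) = A`, `Y'(a) = B`. -/
def opSolution (a : ℝ) (b : EReal) (V : ℝ → H →L[ℂ] H) (z : ℂ) (A B : H →L[ℂ] H) :
    ℝ → H →L[ℂ] H :=
  Classical.epsilon fun Y => ∃ Y₁, IsOpSolution a b V z A B Y Y₁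

/-- `θ_α(z, ·, a)`. -/
def theta (a : ℝ) (b : EReal) (V : ℝ → H →L[ℂ] H) (α : H →L[ℂ] H) (z : ℂ) : ℝ → H →L[ℂ] H :=
  opSolution a b V z (cosOp α) (sinOp α)

/-- `φ_α(z, ·, a)`. -/
def phi (a : ℝ) (b : EReal) (V : ℝ → H →L[ℂ] H) (α : H →L[ℂ] H) (z : ℂ) : ℝ → H →L[ℂ] H :=
  opSolution a b V z (-sinOp α) (cosOp α)

/-- `𝒟_z = {u ∈ dom(H_max) | H_max u = z u}`. -/
def eigenspaceMax (a : ℝ) (b : EReal) (V : ℝ → H →L[ℂ] H) (z : ℂ) : Set (L2 H a b) :=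
  {u | ∃ h : u ∈ (maxOp a b V).domain, maxOp a b V ⟨u, h⟩ = z • u}

/-- `M = 𝒞₂ 𝒞₁⁻¹`, where `𝒞₁, 𝒞₂ : 𝒟_z → H` send `u = θ_α(z,·,a) f + φ_α(z,·,a) g` to `f` and `g`,
respectively: the graph of `M : H → H` is `{(𝒞₁ u, 𝒞₂ u) | u ∈ 𝒟_z}`. (Then `𝒞₁` is bijective: it
is onto as `M` is defined on all of `H`, and one-to-one as `𝒞₁ u = f` forces
`u = θ_α f + φ_α (M f)`.) -/
def IsWeylM (a : ℝ) (b : EReal) (V : ℝ → H →L[ℂ] H) (α : H →L[ℂ] H) (z : ℂ)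
    (M : H →L[ℂ] H) : Prop :=
  ∀ f g : H, M f = g ↔ ∃ u ∈ eigenspaceMax a b V z,
    u =ᵐ[volume.restrict (ioo a b)] fun x => theta a b V α z x f + phi a b V α z x g

/-- The Weyl–Titchmarsh function `m_α(z) ∈ B(H)`. -/
def weylM (a : ℝ) (b : EReal) (V : ℝ → H →L[ℂ] H) (α : H →L[ℂ] H) (z : ℂ) : H →L[ℂ] H :=
  Classical.epsilon fun M => IsWeylM a b V α z M

/-- The Weyl–Titchmarsh solution `ψ_α(z, x) = θ_α(z, x, a) + φ_α(z, x, a) m_α(z)`. -/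
def psi (a : ℝ) (b : EReal) (V : ℝ → H →L[ℂ] H) (α : H →L[ℂ] H) (z : ℂ) (x : ℝ) : H →L[ℂ] H :=
  theta a b V α z x + phi a b V α z x ∘L weylM a b V α z

/-- `∫_a^b F(x) dx = I`: the function `F` is Bochner integrable on `(a,c)` for all `c ∈ (a,b)`, with
`∫_a^c F → I` as `c ↑ b`, and `F` is weakly integrable on `(a,b)`, with weak integral `I`. (`F` need
not be Bochner integrable up to `b`.) -/
def HasIntegral (a : ℝ) (b : EReal) (F : ℝ → H) (I : H) : Prop :=
  (∀ c ∈ ioo a b, IntegrableOn F (Ioo a c) volume) ∧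
  Tendsto (fun c => ∫ x in Ioo a c, F x) (toLeft b) (𝓝 I) ∧
  ∀ h : H, IntegrableOn (fun x => inner ℂ h (F x)) (ioo a b) volume ∧
    ∫ x in ioo a b, inner ℂ h (F x) = inner ℂ h I

end WeylTitchmarsh

end

noncomputable section

namespace WeylTitchmarsh

set_option linter.unusedSectionVars false

/-! ### Calculus of absolutely continuous functions with values in a Banach space. -/

section AbsolutelyContinuous

variable {X Y Z : Type*} [PseudoMetricSpace X] [PseudoMetricSpace Y] [PseudoMetricSpace Z]

/-! The Green's function is glued from two solutions: `phi`, which satisfies the boundary condition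
at `a`, and `psi`, which is square integrable. Fix `x` and `h`. As a function of `t`, `G(z,x,t)* h`
solves the equation with parameter `conj z` on both sides of `x`: it is `phi(conj z, t) l` on the
left, with `l = psi(z,x)* h`, and `psi(conj z, t) k` on the right, with `k = phi(z,x)* h`. At `x`
the two pieces have equal values, while the derivative of the right piece exceeds that of the left
one by `-h` (`psi_phi_symplectic`). This follows from the constancy of the Wronskian
(`propagator_symplectic`) together with `m(z)* = m(conj z)` (`adjoint_weylM`).

Let `y = (H_α - z)⁻¹ u`, and apply the Wronskian identity to `y` and `G(z,x,·)* h` on each side of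
`x`. The boundary term at `a` vanishes because both functions satisfy the same self-adjoint boundary
condition, and the one at `b` vanishes by the limit-point hypothesis (`IsWeylPotential.green`). The
jump at `x` leaves exactly `⟨h, y(x)⟩` (`integral_greenKernel`). To pass from this weak statement to
the integral, `h ↦ G(z,x,·)* h` is shown to be a bounded map `K` into `L²` by the closed graph
theorem. Then `K* u` is the weak integral, and it is the limit of the truncated Bochner integrals
because the truncations of `u` converge to `u` in `L²` (`hasIntegral_adjoint`).

The spectral input is the self-adjointness of `H_α`. Green's identity gives symmetry, and hence `|Im
z| ‖f‖ ≤ ‖(H_α - z) f‖`; that `H_α` contains its adjoint is `mem_alphaGraph_of_forall`. Together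
they place every non-real `z` in the resolvent set. At any point of the resolvent set the resolvent
corrects a compactly supported function with prescribed boundary data to a square integrable
solution (`exists_sol_memLp`), so `m` exists there, at real points too, and one kernel formula
serves all `z`.

Underneath lies a Carathéodory theory for linear equations with locally integrable coefficients:
existence and a growth bound, both obtained from an exponential weight. -/

theorem absolutelyContinuousOnInterval_of_dist_le {f : ℝ → X} {p : ℝ → Y} {q : ℝ → Z} {c d : ℝ}
    (hp : AbsolutelyContinuousOnInterval p c d) (hq : AbsolutelyContinuousOnInterval q c d)
    (C D : ℝ)
    (h : ∀ s ∈ uIcc c d, ∀ t ∈ uIcc c d,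
      dist (f s) (f t) ≤ C * dist (p s) (p t) + D * dist (q s) (q t)) :
    AbsolutelyContinuousOnInterval f c d := by
  unfold AbsolutelyContinuousOnInterval at hp hq ⊢
  apply squeeze_zero' ?_ ?_ (by simpa using (hp.const_mul C).add (hq.const_mul D))
  · exact Filter.Eventually.of_forall fun _ => Finset.sum_nonneg fun i _ => dist_nonneg
  rw [eventually_inf_principal]
  filter_upwards with (n, I) hnI
  simp only [Finset.mul_sum, ← Finset.sum_add_distrib]
  gcongr with i hi
  simp only [AbsolutelyContinuousOnInterval.disjWithin, mem_ofPred_eq] at hnI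
  exact h _ (hnI.1 i hi).1 _ (hnI.1 i hi).2

variable {E F G : Type*} [NormedAddCommGroup E] [NormedSpace ℝ E] [NormedAddCommGroup F]
  [NormedSpace ℝ F] [NormedAddCommGroup G] [NormedSpace ℝ G]

theorem absolutelyContinuousOnInterval_primitive {g : ℝ → E} {c d e : ℝ}
    (hg : IntervalIntegrable g volume c d) (he : e ∈ uIcc c d) :
    AbsolutelyContinuousOnInterval (fun x => ∫ t in e..x, g t) c d := by
  have hn := hg.norm.absolutelyContinuousOnInterval_intervalIntegral he
  refine absolutelyContinuousOnInterval_of_dist_le hn hn 1 0 fun s hs t ht => ?_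
  have i : ∀ {s t}, s ∈ uIcc c d → t ∈ uIcc c d → IntervalIntegrable g volume s t :=
    fun hs ht => hg.mono_set (uIcc_subset_uIcc hs ht)
  rw [dist_comm, dist_eq_norm, dist_comm, dist_eq_norm,
    intervalIntegral.integral_interval_sub_left (i he ht) (i he hs),
    intervalIntegral.integral_interval_sub_left (i he ht).norm (i he hs).norm]
  simpa using intervalIntegral.norm_integral_le_abs_integral_norm (f := g) (a := s) (b := t)

/-- Subtracting the primitive of `g` leaves an absolutely continuous function with derivative zero
a.e., which is constant. In a general Banach space absolute continuity does not imply
differentiability a.e., so the latter is a hypothesis. -/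
theorem integral_eq_sub_of_ae_hasDerivAt [CompleteSpace E] {f g : ℝ → E} {c d : ℝ}
    (hf : AbsolutelyContinuousOnInterval f c d) (hg : IntervalIntegrable g volume c d)
    (h : ∀ᵐ x, x ∈ uIcc c d → HasDerivAt f (g x) x) :
    ∫ t in c..d, g t = f d - f c := by
  have hD : AbsolutelyContinuousOnInterval (fun x => f x - ∫ t in c..x, g t) c d :=
    hf.fun_sub (absolutelyContinuousOnInterval_primitive hg left_mem_uIcc)
  obtain ⟨K, hK⟩ := hD.const_of_ae_hasDerivAt_zero <| by
    filter_upwards [h, hg.ae_hasDerivAt_integral] with x h1 h2 hx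
    simpa [Pi.sub_def] using (h1 hx).sub (h2 hx c left_mem_uIcc)
  have h1 := hK c left_mem_uIcc
  have h2 := hK d right_mem_uIcc
  simp only [intervalIntegral.integral_same, sub_zero] at h1
  rw [h1, ← h2]
  abel

/-- Reduces local properties on `S` to compact intervals. When `S` has no point on one side of `x`,
the point `x` itself is the endpoint there; this covers the endpoint `a` of `ico a b`. -/
theorem exists_Icc_mem_nhdsWithin {S : Set ℝ} {x : ℝ} (hx : x ∈ S) :
    ∃ c ∈ S, ∃ d ∈ S, x ∈ Icc c d ∧ Icc c d ∈ 𝓝[S] x := by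
  have hc : ∃ c ∈ S, c ≤ x ∧ ∀ᶠ t in 𝓝[S] x, c ≤ t := by
    by_cases hx' : ∃ c ∈ S, c < x
    · obtain ⟨c, hc, hcx⟩ := hx'
      exact ⟨c, hc, hcx.le, (eventually_ge_nhds hcx).filter_mono nhdsWithin_le_nhds⟩
    · push Not at hx'
      exact ⟨x, hx, le_rfl, eventually_mem_nhdsWithin.mono hx'⟩
  have hd : ∃ d ∈ S, x ≤ d ∧ ∀ᶠ t in 𝓝[S] x, t ≤ d := by
    by_cases hx' : ∃ d ∈ S, x < d
    · obtain ⟨d, hd, hdx⟩ := hx'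
      exact ⟨d, hd, hdx.le, (eventually_le_nhds hdx).filter_mono nhdsWithin_le_nhds⟩
    · push Not at hx'
      exact ⟨x, hx, le_rfl, eventually_mem_nhdsWithin.mono hx'⟩
  obtain ⟨c, hcS, hcx, hc⟩ := hc
  obtain ⟨d, hdS, hxd, hd⟩ := hd
  exact ⟨c, hcS, d, hdS, ⟨hcx, hxd⟩, by filter_upwards [hc, hd] with t h1 h2 using ⟨h1, h2⟩⟩

theorem locallyIntegrableOn_iff_Icc {E : Type*} [NormedAddCommGroup E] {S : Set ℝ}
    (hS : S.OrdConnected) {g : ℝ → E} :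
    LocallyIntegrableOn g S volume ↔ ∀ c ∈ S, ∀ d ∈ S, IntegrableOn g (Icc c d) volume := by
  refine ⟨fun h c hc d hd =>
    h.integrableOn_compact_subset (hS.out hc hd) isCompact_Icc, fun h x hx => ?_⟩
  obtain ⟨c, hc, d, hd, -, hn⟩ := exists_Icc_mem_nhdsWithin hx
  exact ⟨Icc c d, hn, h c hc d hd⟩

theorem continuousOn_of_Icc {E : Type*} [TopologicalSpace E] {S : Set ℝ} {y : ℝ → E}
    (h : ∀ c ∈ S, ∀ d ∈ S, ContinuousOn y (Icc c d)) : ContinuousOn y S := by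
  intro x hx
  obtain ⟨c, hc, d, hd, hxm, hn⟩ := exists_Icc_mem_nhdsWithin hx
  exact (h c hc d hd x hxm).mono_of_mem_nhdsWithin hn

theorem IsPrimitiveOn.intervalIntegrable {S : Set ℝ} (hS : S.OrdConnected) {y g : ℝ → E}
    (h : IsPrimitiveOn S y g) {c d : ℝ} (hc : c ∈ S) (hd : d ∈ S) :
    IntervalIntegrable g volume c d :=
  (h.locInt.integrableOn_compact_subset (hS.uIcc_subset hc hd) isCompact_uIcc).intervalIntegrable

theorem IsPrimitiveOn.absolutelyContinuous {S : Set ℝ} (hS : S.OrdConnected) {y g : ℝ → E}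
    (h : IsPrimitiveOn S y g) {c d : ℝ} (hc : c ∈ S) (hd : d ∈ S) :
    AbsolutelyContinuousOnInterval y c d := by
  have hp := absolutelyContinuousOnInterval_primitive (h.intervalIntegrable hS hc hd) left_mem_uIcc
  refine absolutelyContinuousOnInterval_of_dist_le hp hp 1 0 fun s hs t ht => ?_
  rw [h.eq c hc s (hS.uIcc_subset hc hd hs), h.eq c hc t (hS.uIcc_subset hc hd ht)]
  simp

theorem IsPrimitiveOn.continuousOn' {S : Set ℝ} (hS : S.OrdConnected) {y g : ℝ → E}
    (h : IsPrimitiveOn S y g) : ContinuousOn y S :=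
  continuousOn_of_Icc fun _ hc _ hd =>
    (h.absolutelyContinuous hS hc hd).continuousOn.mono Icc_subset_uIcc

theorem IsPrimitiveOn.ae_hasDerivAt [CompleteSpace E] {S : Set ℝ} (hS : S.OrdConnected)
    {y g : ℝ → E} (h : IsPrimitiveOn S y g) {c d : ℝ} (hc : c ∈ S) (hd : d ∈ S) :
    ∀ᵐ x, x ∈ uIcc c d → HasDerivAt y (g x) x := by
  -- The endpoints are discarded because the integral formula for `y` is known only on `uIcc c d`,
  -- which is not a neighbourhood of them.
  have h1 : ∀ᵐ x, x ≠ c := by simp [ae_iff, measure_singleton]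
  have h2 : ∀ᵐ x, x ≠ d := by simp [ae_iff, measure_singleton]
  filter_upwards [(h.intervalIntegrable hS hc hd).ae_hasDerivAt_integral, h1, h2]
    with x hx hxc hxd hm
  refine ((hx hm c left_mem_uIcc).const_add (y c)).congr_of_eventuallyEq ?_
  have : uIcc c d ∈ 𝓝 x := by
    rw [uIcc, Icc_mem_nhds_iff]
    grind [uIcc]
  filter_upwards [this] with t ht using h.eq c hc t (hS.uIcc_subset hc hd ht)

theorem isPrimitiveOn_of_ae_hasDerivAt [CompleteSpace E] {S : Set ℝ} {y g : ℝ → E}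
    (hg : LocallyIntegrableOn g S volume) (hS : S.OrdConnected)
    (hy : ∀ c ∈ S, ∀ d ∈ S, AbsolutelyContinuousOnInterval y c d)
    (h : ∀ c ∈ S, ∀ d ∈ S, ∀ᵐ x, x ∈ uIcc c d → HasDerivAt y (g x) x) : IsPrimitiveOn S y g := by
  refine ⟨hg, fun c hc d hd => ?_⟩
  rw [integral_eq_sub_of_ae_hasDerivAt (hy c hc d hd) (hg.integrableOn_compact_subset
    (hS.uIcc_subset hc hd) isCompact_uIcc).intervalIntegrable (h c hc d hd)]
  abel

theorem integrableOn_bilin (B : E →L[ℝ] F →L[ℝ] G) {y : ℝ → E} {g : ℝ → F} {c d : ℝ}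
    (hy : ContinuousOn y (Icc c d)) (hg : IntegrableOn g (Icc c d) volume) :
    IntegrableOn (fun t => B (y t) (g t)) (Icc c d) volume := by
  obtain ⟨K, hK⟩ := isCompact_Icc.exists_bound_of_continuousOn hy
  refine Integrable.mono' (hg.norm.const_mul (‖B‖ * K)) ?_ ?_
  · exact B.aestronglyMeasurable_comp₂ (hy.aestronglyMeasurable measurableSet_Icc) hg.1
  · filter_upwards [ae_restrict_mem measurableSet_Icc] with t ht
    calc _ ≤ ‖B‖ * ‖y t‖ * ‖g t‖ := B.le_opNorm₂ _ _
      _ ≤ _ := by gcongr; exact hK t ht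

/-- The product rule. It is used with the inner product, for Wronskians, and with scalar
multiplication, for cutoffs. -/
theorem IsPrimitiveOn.bilin [CompleteSpace E] [CompleteSpace F] [CompleteSpace G]
    (B : E →L[ℝ] F →L[ℝ] G) {S : Set ℝ} (hS : S.OrdConnected) {y g : ℝ → E} {w k : ℝ → F}
    (hy : IsPrimitiveOn S y g) (hw : IsPrimitiveOn S w k) :
    IsPrimitiveOn S (fun t => B (y t) (w t)) (fun t => B (y t) (k t) + B (g t) (w t)) := by
  refine isPrimitiveOn_of_ae_hasDerivAt ?_ hS (fun c hc d hd => ?_) fun c hc d hd => ?_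
  · rw [locallyIntegrableOn_iff_Icc hS]
    intro c hc d hd
    have hsub : Icc c d ⊆ S := hS.out hc hd
    exact (integrableOn_bilin B ((hy.continuousOn' hS).mono hsub)
      (hw.locInt.integrableOn_compact_subset hsub isCompact_Icc)).add
      (integrableOn_bilin B.flip ((hw.continuousOn' hS).mono hsub)
      (hy.locInt.integrableOn_compact_subset hsub isCompact_Icc))
  · have hya := hy.absolutelyContinuous hS hc hd
    have hwa := hw.absolutelyContinuous hS hc hd
    obtain ⟨K, hK⟩ := hya.exists_bound
    obtain ⟨L, hL⟩ := hwa.exists_bound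
    refine absolutelyContinuousOnInterval_of_dist_le hya hwa (‖B‖ * L) (‖B‖ * K) fun s hs t ht => ?_
    have : B (y s) (w s) - B (y t) (w t) = B (y s - y t) (w s) + B (y t) (w s - w t) := by
      simp
    rw [dist_eq_norm, this, dist_eq_norm, dist_eq_norm]
    refine (norm_add_le _ _).trans (add_le_add ?_ ?_)
    · calc _ ≤ ‖B‖ * ‖y s - y t‖ * ‖w s‖ := B.le_opNorm₂ _ _
        _ ≤ ‖B‖ * ‖y s - y t‖ * L := by gcongr; exact hL s hs
        _ = _ := by ring
    · calc _ ≤ ‖B‖ * ‖y t‖ * ‖w s - w t‖ := B.le_opNorm₂ _ _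
        _ ≤ ‖B‖ * K * ‖w s - w t‖ := by gcongr; exact hK t ht
  · filter_upwards [hy.ae_hasDerivAt hS hc hd, hw.ae_hasDerivAt hS hc hd] with x h1 h2 hx
    exact B.hasDerivAt_of_bilinear (fun _ => h1 hx) (fun _ => h2 hx)

theorem IsPrimitiveOn.clm [CompleteSpace E] [CompleteSpace F] (L : E →L[ℝ] F) {S : Set ℝ}
    (hS : S.OrdConnected) {y g : ℝ → E}
    (hy : IsPrimitiveOn S y g) : IsPrimitiveOn S (fun t => L (y t)) (fun t => L (g t)) := by
  refine ⟨(locallyIntegrableOn_iff_Icc hS).2 fun c hc d hd =>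
    L.integrable_comp ((locallyIntegrableOn_iff_Icc hS).1 hy.locInt c hc d hd), fun c hc d hd => ?_⟩
  rw [hy.eq c hc d hd, map_add, L.intervalIntegral_comp_comm (hy.intervalIntegrable hS hc hd)]

theorem IsPrimitiveOn.mono {S S' : Set ℝ} {y g : ℝ → E} (hy : IsPrimitiveOn S y g) (h : S' ⊆ S) :
    IsPrimitiveOn S' y g :=
  ⟨hy.locInt.mono_set h, fun c hc d hd => hy.eq c (h hc) d (h hd)⟩

theorem IsPrimitiveOn.congr_ae {S : Set ℝ} (hS : S.OrdConnected) {y g g' : ℝ → E}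
    (hy : IsPrimitiveOn S y g) (h : g =ᵐ[volume.restrict S] g') : IsPrimitiveOn S y g' := by
  have hm : MeasurableSet S := hS.measurableSet
  rw [EventuallyEq, ae_restrict_iff' hm] at h
  refine ⟨(locallyIntegrableOn_iff_Icc hS).2 fun c hc d hd => ?_, fun c hc d hd => ?_⟩
  · refine ((locallyIntegrableOn_iff_Icc hS).1 hy.locInt c hc d hd).congr_fun_ae ?_
    rw [EventuallyEq, ae_restrict_iff' measurableSet_Icc]
    filter_upwards [h] with x hx hm using hx (hS.out hc hd hm)
  · rw [hy.eq c hc d hd, intervalIntegral.integral_congr_ae]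
    filter_upwards [h] with x hx hm using hx (hS.uIcc_subset hc hd (uIoc_subset_uIcc hm))

theorem IsPrimitiveOn.congr {S : Set ℝ} (hS : S.OrdConnected) {y y' g g' : ℝ → E}
    (hy : IsPrimitiveOn S y g) (h : EqOn y y' S) (h' : EqOn g g' S) : IsPrimitiveOn S y' g' := by
  have := hy.congr_ae hS (g' := g') ((ae_restrict_mem hS.measurableSet).mono h')
  exact ⟨this.locInt, fun c hc d hd => by rw [← h hc, ← h hd, this.eq c hc d hd]⟩

theorem IsPrimitiveOn.prodMk [CompleteSpace E] [CompleteSpace F] {S : Set ℝ}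
    (hS : S.OrdConnected) {y g : ℝ → E} {w k : ℝ → F}
    (hy : IsPrimitiveOn S y g) (hw : IsPrimitiveOn S w k) :
    IsPrimitiveOn S (fun t => (y t, w t)) (fun t => (g t, k t)) := by
  have := (hy.clm (ContinuousLinearMap.inl ℝ E F) hS).add hS
    (hw.clm (ContinuousLinearMap.inr ℝ E F) hS)
  refine this.congr hS (fun t _ => ?_) (fun t _ => ?_) <;> simp

theorem isPrimitiveOn_of_continuous {S : Set ℝ} [CompleteSpace E]
    {y g : ℝ → E} (hg : Continuous g)
    (h : ∀ x, HasDerivAt y (g x) x) : IsPrimitiveOn S y g := by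
  refine ⟨hg.locallyIntegrable.locallyIntegrableOn _, fun c hc d hd => ?_⟩
  rw [intervalIntegral.integral_eq_sub_of_hasDerivAt (fun x _ => h x) (hg.intervalIntegrable _ _)]
  abel

end AbsolutelyContinuous

/-! ### Carathéodory existence and uniqueness for `y' = f(t, y)`. -/

section Ode

variable {E : Type*} [NormedAddCommGroup E] [NormedSpace ℝ E]

/-- Carathéodory conditions on `S` for the right-hand side of `y' = f(t, y)`, with a locally
integrable Lipschitz constant `m`. -/
structure IsLipschitzField (S : Set ℝ) (f : ℝ → E → E) (m : ℝ → ℝ) : Prop where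
  meas : ∀ e, AEStronglyMeasurable (fun t => f t e) (volume.restrict S)
  locInt : LocallyIntegrableOn m S volume
  lip : ∀ t e e', ‖f t e - f t e'‖ ≤ m t * ‖e - e'‖
  zero : ∀ t, ‖f t 0‖ ≤ m t

/-- The weight `exp (2 |∫_{x₀}^x m|)`. -/
def expWeight (m : ℝ → ℝ) (x₀ x : ℝ) : ℝ := Real.exp (2 * |∫ t in x₀..x, m t|)

theorem expWeight_pos (m : ℝ → ℝ) (x₀ x : ℝ) : 0 < expWeight m x₀ x := Real.exp_pos _

theorem one_le_expWeight (m : ℝ → ℝ) (x₀ x : ℝ) : 1 ≤ expWeight m x₀ x :=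
  Real.one_le_exp (by positivity)

theorem isPrimitiveOn_integral {S : Set ℝ} (hS : S.OrdConnected) {g : ℝ → E}
    (hg : LocallyIntegrableOn g S volume) {x₀ : ℝ} (h₀ : x₀ ∈ S) :
    IsPrimitiveOn S (fun x => ∫ t in x₀..x, g t) g := by
  refine ⟨hg, fun c hc d hd => ?_⟩
  have i : ∀ {c d}, c ∈ S → d ∈ S → IntervalIntegrable g volume c d := fun hc hd =>
    (hg.integrableOn_compact_subset (hS.uIcc_subset hc hd) isCompact_uIcc).intervalIntegrable
  exact (intervalIntegral.integral_add_adjacent_intervals (i h₀ hc) (i hc hd)).symm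

theorem continuousOn_expWeight {S : Set ℝ} (hS : S.OrdConnected) {m : ℝ → ℝ}
    (hm : LocallyIntegrableOn m S volume) {x₀ : ℝ} (h₀ : x₀ ∈ S) :
    ContinuousOn (expWeight m x₀) S := by
  have := (isPrimitiveOn_integral hS hm h₀).continuousOn' hS
  unfold expWeight
  fun_prop

/-- The integrand is the a.e. derivative of `exp (κ ∫ m)`, which is absolutely continuous because
`exp (κ ·)` is Lipschitz on the bounded range of the primitive. -/
theorem integral_mul_exp {S : Set ℝ} (hS : S.OrdConnected) {m : ℝ → ℝ}
    (hm : LocallyIntegrableOn m S volume) {x₀ x : ℝ} (h₀ : x₀ ∈ S) (hx : x ∈ S) (κ : ℝ) :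
    ∫ t in x₀..x, Real.exp (κ * ∫ s in x₀..t, m s) * (κ * m t) =
      Real.exp (κ * ∫ s in x₀..x, m s) - 1 := by
  have hp := isPrimitiveOn_integral hS hm h₀
  have hac := hp.absolutelyContinuous hS h₀ hx
  have hc : ContinuousOn (fun x => ∫ t in x₀..x, m t) (uIcc x₀ x) := hac.continuousOn
  obtain ⟨K, hK⟩ := hac.exists_bound
  have hl : ContDiffOn ℝ 1 (fun r : ℝ => Real.exp (κ * r)) (Icc (-K) K) := by fun_prop
  obtain ⟨L, hL⟩ := hl.exists_lipschitzOnWith (by decide) (convex_Icc _ _) isCompact_Icc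
  have hac' : AbsolutelyContinuousOnInterval
      (fun x => Real.exp (κ * ∫ t in x₀..x, m t)) x₀ x := by
    refine absolutelyContinuousOnInterval_of_dist_le hac hac L 0 fun s hs t ht => ?_
    have := hL.dist_le_mul _ (abs_le.1 (hK s hs)) _ (abs_le.1 (hK t ht))
    simpa using this
  rw [integral_eq_sub_of_ae_hasDerivAt hac']
  · simp
  · refine IntervalIntegrable.continuousOn_mul ?_ (by fun_prop)
    exact ((hp.intervalIntegrable hS h₀ hx).const_mul κ)
  · filter_upwards [hp.ae_hasDerivAt hS h₀ hx] with t ht hm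
    exact ((ht hm).const_mul κ).exp

/-- The absolute value in the weight makes it grow in both directions from `x₀`; it is resolved by
`κ = 2` to the right and `κ = -2` to the left. The factor `1 / 2` is what later gives contraction
and absorption. -/
theorem abs_integral_mul_expWeight {S : Set ℝ} (hS : S.OrdConnected) {m : ℝ → ℝ}
    (hm : LocallyIntegrableOn m S volume) (hm0 : ∀ t, 0 ≤ m t) {x₀ x : ℝ} (h₀ : x₀ ∈ S)
    (hx : x ∈ S) :
    |∫ t in x₀..x, m t * expWeight m x₀ t| = (expWeight m x₀ x - 1) / 2 := by
  rcases le_total x₀ x with h | h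
  · have hw : ∀ t, x₀ ≤ t → expWeight m x₀ t = Real.exp (2 * ∫ s in x₀..t, m s) := fun t ht => by
      rw [expWeight, abs_of_nonneg (intervalIntegral.integral_nonneg ht fun s _ => hm0 s)]
    have := integral_mul_exp hS hm h₀ hx 2
    rw [← hw x h] at this
    rw [← this, abs_of_nonneg, eq_div_iff two_ne_zero, ← intervalIntegral.integral_mul_const]
    · refine intervalIntegral.integral_congr fun t ht => ?_
      rw [uIcc_of_le h] at ht
      simp only [hw t ht.1]
      ring
    · exact intervalIntegral.integral_nonneg h fun s _ =>
        mul_nonneg (hm0 s) (expWeight_pos _ _ _).le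
  · have hw : ∀ t, t ≤ x₀ → expWeight m x₀ t = Real.exp (-2 * ∫ s in x₀..t, m s) :=
      fun t ht => by
        rw [expWeight, abs_of_nonpos, mul_neg, neg_mul]
        rw [intervalIntegral.integral_symm, neg_nonpos]
        exact intervalIntegral.integral_nonneg ht fun s _ => hm0 s
    have := integral_mul_exp hS hm h₀ hx (-2)
    rw [← hw x h] at this
    rw [← this, abs_of_nonpos, eq_div_iff two_ne_zero, neg_mul,
      ← intervalIntegral.integral_mul_const, ← intervalIntegral.integral_neg]
    · refine intervalIntegral.integral_congr fun t ht => ?_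
      rw [uIcc_of_ge h] at ht
      simp only [hw t ht.2]
      ring
    · rw [intervalIntegral.integral_symm, neg_nonpos]
      exact intervalIntegral.integral_nonneg h fun s _ =>
        mul_nonneg (hm0 s) (expWeight_pos _ _ _).le

theorem norm_integral_le_expWeight {S : Set ℝ} (hS : S.OrdConnected) {m : ℝ → ℝ}
    (hm : LocallyIntegrableOn m S volume) (hm0 : ∀ t, 0 ≤ m t) {x₀ x : ℝ} (h₀ : x₀ ∈ S)
    (hx : x ∈ S) {g : ℝ → E} {K : ℝ} (hK : 0 ≤ K)
    (hg : ∀ t ∈ uIcc x₀ x, ‖g t‖ ≤ K * (m t * expWeight m x₀ t)) :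
    ‖∫ t in x₀..x, g t‖ ≤ K / 2 * expWeight m x₀ x := by
  have hi : IntervalIntegrable (fun t => K * (m t * expWeight m x₀ t)) volume x₀ x := by
    refine IntervalIntegrable.const_mul (IntervalIntegrable.mul_continuousOn ?_ ?_) K
    · exact (isPrimitiveOn_integral hS hm h₀).intervalIntegrable hS h₀ hx
    · exact (continuousOn_expWeight hS hm h₀).mono (hS.uIcc_subset h₀ hx)
  have := intervalIntegral.norm_integral_le_abs_of_norm_le (f := g) (μ := volume)
    (a := x₀) (b := x)
    (g := fun t => K * (m t * expWeight m x₀ t)) (by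
      rw [ae_restrict_iff' measurableSet_uIoc]
      exact Eventually.of_forall fun t ht => hg t (uIoc_subset_uIcc ht)) hi
  rw [intervalIntegral.integral_const_mul, abs_mul, abs_of_nonneg hK,
    abs_integral_mul_expWeight hS hm hm0 h₀ hx] at this
  nlinarith [expWeight_pos m x₀ x]

namespace IsLipschitzField

variable {S : Set ℝ} {f : ℝ → E → E} {m : ℝ → ℝ}

theorem nonneg (hf : IsLipschitzField S f m) (t : ℝ) : 0 ≤ m t := (norm_nonneg _).trans (hf.zero t)

theorem norm_le (hf : IsLipschitzField S f m) (t : ℝ) (e : E) : ‖f t e‖ ≤ m t * (1 + ‖e‖) := by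
  have h1 := hf.lip t e 0
  have h2 := hf.zero t
  have h3 : ‖f t e‖ ≤ ‖f t e - f t 0‖ + ‖f t 0‖ := by
    simpa using norm_add_le (f t e - f t 0) (f t 0)
  rw [sub_zero] at h1
  linarith

/-- For simple `Z` the domain splits into countably many pieces on which `Z` is constant. The
general case follows by approximation, as `f t` is continuous for each `t`. -/
theorem aestronglyMeasurable_comp (hf : IsLipschitzField S f m) {Z : ℝ → E}
    (hZ : AEStronglyMeasurable Z (volume.restrict S)) :
    AEStronglyMeasurable (fun t => f t (Z t)) (volume.restrict S) := by
  have hs : ∀ s : SimpleFunc ℝ E,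
      AEStronglyMeasurable (fun t => f t (s t)) (volume.restrict S) := by
    intro s
    have hu : (⋃ v : s.range, s ⁻¹' {(v : E)}) = univ := by
      ext t
      simp
    rw [← Measure.restrict_univ (μ := volume.restrict S), ← hu, aestronglyMeasurable_iUnion_iff]
    intro v
    refine ((hf.meas v).mono_measure Measure.restrict_le_self).congr ?_
    filter_upwards [ae_restrict_mem (s.measurableSet_fiber v)] with t ht
    rw [show s t = v from ht]
  refine (aestronglyMeasurable_of_tendsto_ae atTop (fun n => hs
    (hZ.stronglyMeasurable_mk.approx n)) (Eventually.of_forall fun t => ?_) :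
    AEStronglyMeasurable (fun t => f t (hZ.mk Z t)) _).congr ?_
  · have hc : Continuous (f t) := (LipschitzWith.of_dist_le_mul (K := ⟨m t, hf.nonneg t⟩)
      fun e e' => by rw [dist_eq_norm, dist_eq_norm]; exact hf.lip t e e').continuous
    exact (hc.tendsto _).comp (hZ.stronglyMeasurable_mk.tendsto_approx t)
  · filter_upwards [hZ.ae_eq_mk] with t ht
    rw [ht]

theorem locallyIntegrableOn_comp (hf : IsLipschitzField S f m) (hS : S.OrdConnected) {Z : ℝ → E}
    (hZ : ContinuousOn Z S) : LocallyIntegrableOn (fun t => f t (Z t)) S volume := by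
  rw [locallyIntegrableOn_iff_Icc hS]
  intro c hc d hd
  have hsub : Icc c d ⊆ S := hS.out hc hd
  obtain ⟨K, hK⟩ := isCompact_Icc.exists_bound_of_continuousOn (hZ.mono hsub)
  refine Integrable.mono' (g := fun t => m t * (1 + K))
    (((locallyIntegrableOn_iff_Icc hS).1 hf.locInt c hc d hd).mul_const _) ?_ ?_
  · exact (hf.aestronglyMeasurable_comp (hZ.aestronglyMeasurable hS.measurableSet)).mono_set hsub
  · filter_upwards [ae_restrict_mem measurableSet_Icc] with t ht
    refine (hf.norm_le t _).trans ?_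
    gcongr
    · exact hf.nonneg t
    · exact hK t ht

/-- A Grönwall bound without iteration. At a maximum point `r` of the ratio `‖Y - Z‖ / w`, with
value `K`, the integral equation gives `K w(r) ≤ ‖Y x₀ - Z x₀‖ + (K / 2) w(r)`. Absorbing the last
term and using `1 ≤ w` bounds `K`. -/
theorem norm_sub_le (hf : IsLipschitzField S f m) (hS : S.OrdConnected) [CompleteSpace E]
    {Y Z : ℝ → E}
    (hY : IsPrimitiveOn S Y fun t => f t (Y t)) (hZ : IsPrimitiveOn S Z fun t => f t (Z t))
    {x₀ x : ℝ} (h₀ : x₀ ∈ S) (hx : x ∈ S) :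
    ‖Y x - Z x‖ ≤ 2 * ‖Y x₀ - Z x₀‖ * expWeight m x₀ x := by
  have hsub := hS.uIcc_subset h₀ hx
  have hc : ContinuousOn (fun t => ‖Y t - Z t‖ / expWeight m x₀ t) (uIcc x₀ x) :=
    ((hY.continuousOn' hS).sub (hZ.continuousOn' hS)).norm.div
      (continuousOn_expWeight hS hf.locInt h₀) (fun t _ => (expWeight_pos _ _ t).ne') |>.mono hsub
  obtain ⟨r, hr, hmax⟩ := isCompact_uIcc.exists_isMaxOn nonempty_uIcc hc
  set K := ‖Y r - Z r‖ / expWeight m x₀ r with hK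
  have hK0 : 0 ≤ K := div_nonneg (norm_nonneg _) (expWeight_pos _ _ _).le
  have hle : ∀ t ∈ uIcc x₀ x, ‖Y t - Z t‖ ≤ K * expWeight m x₀ t := fun t ht =>
    (div_le_iff₀ (expWeight_pos _ _ _)).1 (hmax ht)
  have hi := norm_integral_le_expWeight hS hf.locInt hf.nonneg h₀ (hsub hr) hK0
    (g := fun t => f t (Y t) - f t (Z t)) fun t ht => by
      have h1 := hf.lip t (Y t) (Z t)
      have h2 := hle t (uIcc_subset_uIcc left_mem_uIcc hr ht)
      have h3 := mul_le_mul_of_nonneg_left h2 (hf.nonneg t)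
      linarith
  have hsol : Y r - Z r = (Y x₀ - Z x₀) + ∫ t in x₀..r, (f t (Y t) - f t (Z t)) := by
    rw [intervalIntegral.integral_sub (hY.intervalIntegrable hS h₀ (hsub hr))
      (hZ.intervalIntegrable hS h₀ (hsub hr)), hY.eq x₀ h₀ r (hsub hr), hZ.eq x₀ h₀ r (hsub hr)]
    abel
  have h1 : K * expWeight m x₀ r ≤ ‖Y x₀ - Z x₀‖ + K / 2 * expWeight m x₀ r := by
    rw [hK, div_mul_cancel₀ _ (expWeight_pos _ _ _).ne', ← hK]
    conv_lhs => rw [hsol]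
    exact (norm_add_le _ _).trans (add_le_add le_rfl hi)
  have h2 : K ≤ 2 * ‖Y x₀ - Z x₀‖ := by
    have := one_le_expWeight m x₀ r
    nlinarith [norm_nonneg (Y x₀ - Z x₀)]
  exact (hle x right_mem_uIcc).trans
    (mul_le_mul_of_nonneg_right h2 (expWeight_pos _ _ _).le)

/-- Picard iteration in the weighted sup norm `sup ‖Y‖ / w`. The weight makes the iteration a
contraction with constant `1 / 2` on all of `S` at once, so no gluing of local solutions is needed.
-/
theorem exists_isPrimitiveOn [CompleteSpace E] (hf : IsLipschitzField S f m)
    (hS : S.OrdConnected) {x₀ : ℝ} (h₀ : x₀ ∈ S) (Y₀ : E) :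
    ∃ Y : ℝ → E, Y x₀ = Y₀ ∧ IsPrimitiveOn S Y fun t => f t (Y t) := by
  classical
  set w := expWeight m x₀ with hw
  have hwc : ContinuousOn w S := continuousOn_expWeight hS hf.locInt h₀
  have hw1 : ∀ x, 1 ≤ w x := one_le_expWeight m x₀
  have hw0 : ∀ x, 0 < w x := expWeight_pos m x₀
  -- The unknown is `Z = Y / w`, a bounded continuous function on `S`; `ext Z` recovers `Y` on `S`,
  -- with value zero elsewhere.
  let ext : BoundedContinuousFunction S E → ℝ → E := fun Z t =>
    if h : t ∈ S then w t • Z ⟨t, h⟩ else 0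
  have hext : ∀ Z, ContinuousOn (ext Z) S := fun Z => by
    rw [continuousOn_iff_continuous_domRestrict] at hwc ⊢
    have : S.domRestrict (ext Z) = fun t => S.domRestrict w t • Z t := by
      ext t
      simp [ext]
    rw [this]
    exact hwc.smul Z.continuous
  have hext' : ∀ Z, ∀ t, ‖ext Z t‖ ≤ ‖Z‖ * w t := fun Z t => by
    by_cases h : t ∈ S
    · simp only [ext, h, dif_pos, norm_smul, Real.norm_eq_abs, abs_of_pos (hw0 t)]
      rw [mul_comm]
      exact mul_le_mul_of_nonneg_right (Z.norm_coe_le_norm _) (hw0 t).le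
    · simp only [ext, h, dif_neg, not_false_eq_true, norm_zero]
      exact mul_nonneg (norm_nonneg _) (hw0 t).le
  have hsub : ∀ Z Z', ∀ t, ext Z t - ext Z' t = ext (Z - Z') t := fun Z Z' t => by
    by_cases h : t ∈ S <;> simp [ext, h, smul_sub]
  let P : BoundedContinuousFunction S E → ℝ → E := fun Z x =>
    Y₀ + ∫ t in x₀..x, f t (ext Z t)
  have hP : ∀ Z, IsPrimitiveOn S (P Z) fun t => f t (ext Z t) := fun Z => by
    have h1 := isPrimitiveOn_integral hS (hf.locallyIntegrableOn_comp hS (hext Z)) h₀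
    refine ⟨h1.locInt, fun c hc d hd => ?_⟩
    simp only [P]
    rw [h1.eq c hc d hd, add_assoc]
  have hPb : ∀ Z, ∀ x ∈ S, ‖(w x)⁻¹ • P Z x‖ ≤ ‖Y₀‖ + (1 + ‖Z‖) / 2 := fun Z x hx => by
    have hi := norm_integral_le_expWeight hS hf.locInt hf.nonneg h₀ hx (K := 1 + ‖Z‖)
      (g := fun t => f t (ext Z t)) (by positivity) fun t _ => by
        have h1 := hf.norm_le t (ext Z t)
        have h2 := hext' Z t
        have h3 : 1 + ‖ext Z t‖ ≤ (1 + ‖Z‖) * w t := by nlinarith [hw1 t]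
        have h4 := mul_le_mul_of_nonneg_left h3 (hf.nonneg t)
        rw [← hw]
        linarith
    rw [norm_smul, norm_inv, Real.norm_eq_abs, abs_of_pos (hw0 x), inv_mul_le_iff₀ (hw0 x)]
    refine (norm_add_le _ _).trans ?_
    rw [← hw] at hi
    nlinarith [norm_nonneg Y₀, hw1 x]
  let T : BoundedContinuousFunction S E → BoundedContinuousFunction S E := fun Z =>
    BoundedContinuousFunction.ofNormedAddCommGroup (fun x : S => (w x)⁻¹ • P Z x)
      (continuousOn_iff_continuous_domRestrict.1
        ((hwc.inv₀ fun x _ => (hw0 x).ne').smul ((hP Z).continuousOn' hS)))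
      (‖Y₀‖ + (1 + ‖Z‖) / 2) (fun x => hPb Z x x.2)
  have hT : ContractingWith (1 / 2) T := by
    refine ⟨by norm_num, LipschitzWith.of_dist_le_mul fun Z Z' => ?_⟩
    rw [BoundedContinuousFunction.dist_le (by positivity)]
    intro x
    have hd : P Z x - P Z' x = ∫ t in x₀..x, (f t (ext Z t) - f t (ext Z' t)) := by
      rw [intervalIntegral.integral_sub ((hP Z).intervalIntegrable hS h₀ x.2)
        ((hP Z').intervalIntegrable hS h₀ x.2)]
      simp [P]
    have hi := norm_integral_le_expWeight hS hf.locInt hf.nonneg h₀ x.2 (K := ‖Z - Z'‖)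
      (g := fun t => f t (ext Z t) - f t (ext Z' t)) (norm_nonneg _) fun t _ => by
        have h1 := hf.lip t (ext Z t) (ext Z' t)
        rw [hsub] at h1
        have h4 := mul_le_mul_of_nonneg_left (hext' (Z - Z') t) (hf.nonneg t)
        rw [← hw]
        linarith
    have : T Z x - T Z' x = (w x)⁻¹ • (P Z x - P Z' x) := by
      rw [smul_sub]; rfl
    rw [dist_eq_norm, this, hd, norm_smul, norm_inv, Real.norm_eq_abs, abs_of_pos (hw0 x),
      inv_mul_le_iff₀ (hw0 x), dist_eq_norm]
    rw [← hw] at hi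
    push_cast
    linarith
  have : Nonempty (BoundedContinuousFunction S E) := ⟨0⟩
  set Z := ContractingWith.fixedPoint T hT with hZ
  have hfix : T Z = Z := hT.fixedPoint_isFixedPt
  have heq : EqOn (ext Z) (P Z) S := fun x hx => by
    have h1 : T Z ⟨x, hx⟩ = Z ⟨x, hx⟩ := by rw [hfix]
    have h2 : T Z ⟨x, hx⟩ = (w x)⁻¹ • P Z x := rfl
    simp only [ext, hx, dif_pos]
    rw [← h1, h2, smul_inv_smul₀ (hw0 x).ne']
  refine ⟨P Z, by simp [P], (hP Z).congr hS (fun _ _ => rfl) fun t ht => ?_⟩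
  simp only [heq ht]

end IsLipschitzField

end Ode

/-! ### Pettis measurability, and the inhomogeneous equation `-y'' + V y = z y + k`. -/

section

/-- Pettis' theorem for functions with values in a separable Hilbert space. -/
theorem aestronglyMeasurable_of_inner {H : Type*} [NormedAddCommGroup H] [InnerProductSpace ℂ H]
    [CompleteSpace H] [TopologicalSpace.SeparableSpace H] {X : Type*} [MeasurableSpace X]
    {μ : Measure X} {f : X → H} (hf : ∀ h : H, AEMeasurable (fun x => inner ℂ h (f x)) μ) :
    AEStronglyMeasurable f μ := by
  -- The projections onto the spans of the first `n` terms of a dense sequence converge strongly to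
  -- the identity, and a finite-rank projection of `f` is measurable coordinate by coordinate.
  let U : ℕ → Submodule ℂ H := fun n =>
    Submodule.span ℂ (TopologicalSpace.denseSeq H '' Set.Iio n)
  have hfin : ∀ n, FiniteDimensional ℂ (U n) := fun n =>
    FiniteDimensional.span_of_finite ℂ ((Set.finite_Iio n).image _)
  have hU : Monotone U := fun n m h =>
    Submodule.span_mono (image_mono (Iio_subset_Iio h))
  have hd : ⊤ ≤ (⨆ n, U n).topologicalClosure := by
    intro x _
    refine closure_mono ?_ (TopologicalSpace.denseRange_denseSeq H x)
    rintro _ ⟨n, rfl⟩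
    exact (le_iSup U (n + 1)) (Submodule.subset_span ⟨n, by simp, rfl⟩)
  refine aestronglyMeasurable_of_tendsto_ae atTop (f := fun n x => (U n).starProjection (f x))
    (fun n => ?_) (Eventually.of_forall fun x =>
      Submodule.starProjection_tendsto_self U hU (f x) hd)
  rw [(stdOrthonormalBasis ℂ (U n)).starProjection_eq_sum_rankOne]
  simp only [sum_apply, InnerProductSpace.rankOne_apply]
  refine Finset.aestronglyMeasurable_fun_sum _ fun i _ => ?_
  exact (hf _).aestronglyMeasurable.smul_const _

section SecondOrder

variable {H : Type*} [NormedAddCommGroup H] [InnerProductSpace ℂ H]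

/-- `V` is strongly measurable on `S` with locally integrable norm. -/
structure IsLocPotential (S : Set ℝ) (V : ℝ → H →L[ℂ] H) : Prop where
  meas : ∀ h, AEStronglyMeasurable (fun t => V t h) (volume.restrict S)
  locInt : LocallyIntegrableOn (fun t => ‖V t‖) S volume

/-- `y`, with derivative `y₁`, solves `-y'' + V y = z y + k` on `S`. -/
def IsSol (S : Set ℝ) (V : ℝ → H →L[ℂ] H) (z : ℂ) (k y y₁ : ℝ → H) : Prop :=
  IsW21Loc S y y₁ fun t => V t (y t) - z • y t - k t

theorem IsLocPotential.mono {S S' : Set ℝ} {V : ℝ → H →L[ℂ] H} (hV : IsLocPotential S V)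
    (h : S' ⊆ S) : IsLocPotential S' V :=
  ⟨fun e => (hV.meas e).mono_set h, hV.locInt.mono_set h⟩

/-- The field of the first-order system for `(y, y')`. The summand `‖k t‖` is not needed for the
Lipschitz bound; it dominates the field at the origin. -/
theorem IsLocPotential.isLipschitzField {S : Set ℝ} {V : ℝ → H →L[ℂ] H} (hV : IsLocPotential S V) (z : ℂ) {k : ℝ → H}
    (hk : LocallyIntegrableOn k S volume) :
    IsLipschitzField S (fun t (p : H × H) => (p.2, V t p.1 - z • p.1 - k t))
      (fun t => 1 + ‖z‖ + ‖V t‖ + ‖k t‖) := by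
  refine ⟨fun e => ?_, ?_, fun t e e' => ?_, fun t => ?_⟩
  · exact aestronglyMeasurable_const.prodMk
      (((hV.meas _).sub aestronglyMeasurable_const).sub
        (hk.aestronglyMeasurable))
  · exact ((locallyIntegrable_const (1 + ‖z‖)).locallyIntegrableOn S |>.add hV.locInt).add hk.norm
  · rw [Prod.norm_def]
    have h0 : 0 ≤ ‖e - e'‖ := norm_nonneg _
    refine max_le ?_ ?_
    · calc ‖e.2 - e'.2‖ ≤ ‖e - e'‖ := norm_snd_le (e - e')
        _ ≤ _ := by
          refine le_mul_of_one_le_left h0 ?_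
          linarith [norm_nonneg z, norm_nonneg (V t), norm_nonneg (k t)]
    · have h1 : ‖e.1 - e'.1‖ ≤ ‖e - e'‖ := norm_fst_le (e - e')
      have h2 : (V t e.1 - z • e.1 - k t) - (V t e'.1 - z • e'.1 - k t) =
          V t (e.1 - e'.1) - z • (e.1 - e'.1) := by
        rw [map_sub, smul_sub]
        abel
      change ‖(V t e.1 - z • e.1 - k t) - (V t e'.1 - z • e'.1 - k t)‖ ≤ _
      rw [h2]
      refine (norm_sub_le _ _).trans ?_
      rw [norm_smul]
      have h3 := (V t).le_opNorm (e.1 - e'.1)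
      have h4 := mul_le_mul_of_nonneg_left h1 (norm_nonneg (V t))
      have h5 := mul_le_mul_of_nonneg_left h1 (norm_nonneg z)
      nlinarith [norm_nonneg (k t)]
  · simp only [Prod.fst_zero, map_zero, smul_zero, sub_zero, zero_sub, Prod.snd_zero,
      Prod.norm_mk, norm_zero, norm_neg]
    refine max_le (by positivity) ?_
    linarith [norm_nonneg z, norm_nonneg (V t), norm_nonneg (k t)]

variable [CompleteSpace H] {S : Set ℝ} {V : ℝ → H →L[ℂ] H} {z : ℂ} {k y y₁ w w₁ : ℝ → H}

theorem isSol_iff (hS : S.OrdConnected) :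
    IsSol S V z k y y₁ ↔ IsPrimitiveOn S (fun t => (y t, y₁ t))
      (fun t => (y₁ t, V t (y t) - z • y t - k t)) := by
  refine ⟨fun h => h.1.prodMk hS h.2, fun h => ⟨?_, ?_⟩⟩
  · exact h.clm (ContinuousLinearMap.fst ℝ H H) hS
  · exact h.clm (ContinuousLinearMap.snd ℝ H H) hS

theorem exists_isSol (hS : S.OrdConnected) (hV : IsLocPotential S V) (z : ℂ)
    (hk : LocallyIntegrableOn k S volume) {x₀ : ℝ} (h₀ : x₀ ∈ S) (p q : H) :
    ∃ y y₁, y x₀ = p ∧ y₁ x₀ = q ∧ IsSol S V z k y y₁ := by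
  obtain ⟨Y, hY, hp⟩ := (hV.isLipschitzField z hk).exists_isPrimitiveOn hS h₀ (p, q)
  exact ⟨fun t => (Y t).1, fun t => (Y t).2, by simp [hY], by simp [hY], (isSol_iff hS).2 hp⟩

namespace IsSol

theorem mono {S' : Set ℝ} (h : IsSol S V z k y y₁) (hs : S' ⊆ S) : IsSol S' V z k y y₁ :=
  ⟨h.1.mono hs, h.2.mono hs⟩

theorem of_isW21Loc (hS : S.OrdConnected) {y₂ : ℝ → H} (h : IsW21Loc S y y₁ y₂)
    (hae : ∀ᵐ t ∂(volume.restrict S), -y₂ t + V t (y t) = z • y t + k t) :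
    IsSol S V z k y y₁ := by
  refine ⟨h.1, h.2.congr_ae hS (hae.mono fun t ht => ?_)⟩
  change y₂ t = V t (y t) - z • y t - k t
  rw [sub_sub, ← ht]
  abel

theorem congr_force (hS : S.OrdConnected) (h : IsSol S V z k y y₁) {z' : ℂ} {k' : ℝ → H}
    (hae : ∀ᵐ t ∂(volume.restrict S), z • y t + k t = z' • y t + k' t) :
    IsSol S V z' k' y y₁ :=
  of_isW21Loc hS h (hae.mono fun t ht => by rw [← ht]; abel)

theorem add (hS : S.OrdConnected) {k' : ℝ → H} (h : IsSol S V z k y y₁)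
    (h' : IsSol S V z k' w w₁) :
    IsSol S V z (fun t => k t + k' t) (fun t => y t + w t) (fun t => y₁ t + w₁ t) := by
  refine ⟨h.1.add hS h'.1, (h.2.add hS h'.2).congr hS (fun _ _ => rfl) fun t _ => ?_⟩
  simp only [Pi.add_apply, map_add, smul_add]
  abel

theorem smul (hS : S.OrdConnected) (c : ℂ) (h : IsSol S V z k y y₁) :
    IsSol S V z (fun t => c • k t) (fun t => c • y t) (fun t => c • y₁ t) := by
  refine ⟨h.1.smul c, (h.2.smul c).congr hS (fun _ _ => rfl) fun t _ => ?_⟩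
  simp only [Pi.smul_apply, map_smul, smul_sub, smul_comm c z]

theorem sub (hS : S.OrdConnected) {k' : ℝ → H} (h : IsSol S V z k y y₁)
    (h' : IsSol S V z k' w w₁) :
    IsSol S V z (fun t => k t - k' t) (fun t => y t - w t) (fun t => y₁ t - w₁ t) := by
  simpa [sub_eq_add_neg] using h.add hS (h'.smul hS (-1))

theorem continuousOn (hS : S.OrdConnected) (h : IsSol S V z k y y₁) : ContinuousOn y S :=
  h.1.continuousOn' hS

theorem continuousOn_deriv (hS : S.OrdConnected) (h : IsSol S V z k y y₁) : ContinuousOn y₁ S :=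
  h.2.continuousOn' hS

theorem norm_sub_le (hS : S.OrdConnected) (hV : IsLocPotential S V)
    (hk : LocallyIntegrableOn k S volume) (h : IsSol S V z k y y₁) (h' : IsSol S V z k w w₁)
    {x₀ x : ℝ} (h₀ : x₀ ∈ S) (hx : x ∈ S) :
    ‖(y x, y₁ x) - (w x, w₁ x)‖ ≤ 2 * ‖(y x₀, y₁ x₀) - (w x₀, w₁ x₀)‖ *
      expWeight (fun t => 1 + ‖z‖ + ‖V t‖ + ‖k t‖) x₀ x :=
  (hV.isLipschitzField z hk).norm_sub_le hS ((isSol_iff hS).1 h) ((isSol_iff hS).1 h') h₀ hx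

theorem eq_of_eq (hS : S.OrdConnected) (hV : IsLocPotential S V)
    (hk : LocallyIntegrableOn k S volume) (h : IsSol S V z k y y₁) (h' : IsSol S V z k w w₁)
    {x₀ : ℝ} (h₀ : x₀ ∈ S) (e : y x₀ = w x₀) (e₁ : y₁ x₀ = w₁ x₀) {x : ℝ} (hx : x ∈ S) :
    y x = w x ∧ y₁ x = w₁ x := by
  have := norm_sub_le hS hV hk h h' h₀ hx
  rw [e, e₁, sub_self, norm_zero, mul_zero, zero_mul] at this
  have := sub_eq_zero.1 (norm_le_zero_iff.1 this)
  exact Prod.mk_inj.1 this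

theorem zero : IsSol S V z 0 (0 : ℝ → H) 0 :=
  ⟨.zero _, by simpa using! IsPrimitiveOn.zero (E := H) S⟩

theorem norm_le (hS : S.OrdConnected) (hV : IsLocPotential S V)
    (h : IsSol S V z 0 y y₁) {x₀ x : ℝ} (h₀ : x₀ ∈ S) (hx : x ∈ S) :
    ‖(y x, y₁ x)‖ ≤ 2 * ‖(y x₀, y₁ x₀)‖ * expWeight (fun t => 1 + ‖z‖ + ‖V t‖) x₀ x := by
  simpa using! norm_sub_le hS hV locallyIntegrableOn_zero h zero h₀ hx

end IsSol

end SecondOrder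

end

/-! ### The intervals `(a,b)` and `[a,b)`, and limits at a possibly infinite `b`. -/

section Interval

variable {a : ℝ} {b : EReal}

theorem ico_ordConnected (a : ℝ) (b : EReal) : (ico a b).OrdConnected :=
  ⟨fun _ hx _ hy _ hz =>
    ⟨hx.1.trans hz.1, (EReal.coe_le_coe_iff.2 hz.2).trans_lt hy.2⟩⟩

theorem ioo_subset_ico : ioo a b ⊆ ico a b := fun _ hx => ⟨hx.1.le, hx.2⟩

theorem left_mem_ico (hab : (a : EReal) < b) : a ∈ ico a b := ⟨le_rfl, hab⟩

theorem ico_ae_eq_ioo (a : ℝ) (b : EReal) : ico a b =ᵐ[volume] ioo a b := by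
  have h1 : ∀ᵐ x : ℝ, x ≠ a := by simp [ae_iff, measure_singleton]
  filter_upwards [h1] with x hx
  refine propext ⟨fun h => ⟨lt_of_le_of_ne h.1 hx.symm, h.2⟩, fun h => ioo_subset_ico h⟩

theorem restrict_ico (a : ℝ) (b : EReal) : volume.restrict (ico a b) = volume.restrict (ioo a b) :=
  Measure.restrict_congr_set (ico_ae_eq_ioo a b)

theorem measurableSet_ioo (a : ℝ) (b : EReal) : MeasurableSet (ioo a b) :=
  (isOpen_ioo a b).measurableSet

theorem Icc_subset_ico {c : ℝ} (hc : c ∈ ico a b) : Icc a c ⊆ ico a b := fun _ hx =>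
  ⟨hx.1, (EReal.coe_le_coe_iff.2 hx.2).trans_lt hc.2⟩

theorem Ioo_subset_ioo {c : ℝ} (hc : c ∈ ico a b) : Ioo a c ⊆ ioo a b := fun _ hx =>
  ⟨hx.1, (EReal.coe_lt_coe_iff.2 hx.2).trans hc.2⟩

theorem exists_mem_ioo_gt {c : ℝ} (hc : c ∈ ico a b) : ∃ d ∈ ioo a b, c < d := by
  obtain ⟨d, h1, h2⟩ := EReal.exists_rat_btwn_of_lt hc.2
  have h1' : c < d := by exact_mod_cast h1
  exact ⟨d, ⟨hc.1.trans_lt h1', by exact_mod_cast h2⟩, h1'⟩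

theorem ioo_nonempty (hab : (a : EReal) < b) : (ioo a b).Nonempty :=
  let ⟨d, hd, _⟩ := exists_mem_ioo_gt (left_mem_ico hab)
  ⟨d, hd⟩

theorem eventually_toLeft_ge {c : ℝ} (hc : c ∈ ico a b) : ∀ᶠ x in toLeft b, c ≤ x ∧ x ∈ ico a b := by
  have : Ioo (c : EReal) b ∈ 𝓝[<] b := Ioo_mem_nhdsLT hc.2
  refine ⟨_, this, fun x hx => ?_⟩
  have h1 : c < x := EReal.coe_lt_coe_iff.1 hx.1
  exact ⟨h1.le, hc.1.trans h1.le, hx.2⟩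

theorem toLeft_neBot (hab : (a : EReal) < b) : (toLeft b).NeBot := by
  have : (𝓝[<] b).NeBot := nhdsLT_neBot_of_exists_lt ⟨(a : EReal), hab⟩
  refine comap_neBot fun t ht => ?_
  obtain ⟨l, hl, hlt⟩ := (mem_nhdsLT_iff_exists_Ioo_subset' hab).1 ht
  obtain ⟨q, hq1, hq2⟩ := EReal.exists_rat_btwn_of_lt hl
  exact ⟨(q : ℝ), hlt ⟨by exact_mod_cast hq1, by exact_mod_cast hq2⟩⟩

instance : (toLeft b).IsCountablyGenerated := by
  unfold toLeft
  infer_instance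

theorem tendsto_integral_toLeft {E : Type*} [NormedAddCommGroup E] [NormedSpace ℝ E] {f : ℝ → E}
    {x : ℝ} (hx : x ∈ ico a b) (hf : IntegrableOn f (ioo x b) volume) :
    Tendsto (fun c => ∫ t in x..c, f t) (toLeft b) (𝓝 (∫ t in ioo x b, f t)) := by
  have h1 : Tendsto (fun c => ∫ t in ioo x b, (Ioc x c).indicator f t) (toLeft b)
      (𝓝 (∫ t in ioo x b, f t)) := by
    refine tendsto_integral_filter_of_dominated_convergence (fun t => ‖f t‖) ?_ ?_ hf.norm ?_
    · exact Eventually.of_forall fun c => hf.1.indicator measurableSet_Ioc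
    · exact Eventually.of_forall fun c => Eventually.of_forall fun t =>
        norm_indicator_le_norm_self _ _
    · filter_upwards [ae_restrict_mem (measurableSet_ioo x b)] with t ht
      refine tendsto_const_nhds.congr' ?_
      filter_upwards [eventually_toLeft_ge (ioo_subset_ico ht)] with c hc
      rw [indicator_of_mem (show t ∈ Ioc x c from ⟨ht.1, hc.1⟩)]
  refine h1.congr' ?_
  filter_upwards [eventually_toLeft_ge hx] with c hc
  rw [setIntegral_indicator measurableSet_Ioc, intervalIntegral.integral_of_le hc.1]
  congr 2
  ext t
  exact ⟨fun h => h.2, fun h => ⟨⟨h.1, (EReal.coe_le_coe_iff.2 h.2).trans_lt hc.2.2⟩, h⟩⟩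

end Interval

/-! ### Operator-valued solutions of the initial value problem at `a`. -/

section OperatorSolutions

variable {H : Type*} [NormedAddCommGroup H] [InnerProductSpace ℂ H] [CompleteSpace H]
  {a : ℝ} {b : EReal} {V : ℝ → H →L[ℂ] H}

/-- Separability turns weak into strong measurability through Pettis' theorem, and regularity of `a`
extends local integrability to the closed end of the interval. -/
theorem IsPotential.isLocPotential [TopologicalSpace.SeparableSpace H] (hV : IsPotential a b V)
    (ha : RegularLeft a b V) : IsLocPotential (ico a b) V := by
  refine ⟨fun h => ?_, ?_⟩
  · rw [restrict_ico]
    exact aestronglyMeasurable_of_inner fun f => hV.weaklyMeasurable f h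
  · rw [locallyIntegrableOn_iff_Icc (ico_ordConnected a b)]
    intro c hc d hd
    obtain ⟨e, he, hi⟩ := ha
    have hm : max e d ∈ ioo a b := ⟨he.1.trans_le (le_max_left _ _), by
      rcases max_choice e d with h | h <;> rw [h]
      exacts [he.2, hd.2]⟩
    refine (hi.union ((locallyIntegrableOn_iff_Icc (ioo_ordConnected a b)).1 hV.locInt e he _
      hm)).mono_set fun t ht => ?_
    rcases le_total t e with h | h
    · exact Or.inl ⟨hc.1.trans ht.1, h⟩
    · exact Or.inr ⟨h, ht.2.trans (le_max_right _ _)⟩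

/-- The equation is solved for each vector `h` separately. Uniqueness makes the values at `x` linear
in `h`, and the growth bound makes them bounded in `h`. -/
theorem exists_isOpSolution (hab : (a : EReal) < b) (hV : IsLocPotential (ico a b) V) (z : ℂ)
    (A B : H →L[ℂ] H) : ∃ Y Y₁, IsOpSolution a b V z A B Y Y₁ := by
  have hS := ico_ordConnected a b
  have h0 := left_mem_ico hab
  choose y y₁ hy hy₁ hs using fun h : H =>
    exists_isSol hS hV z (k := 0) locallyIntegrableOn_zero h0 (A h) (B h)
  have hadd : ∀ h h', ∀ x ∈ ico a b, y (h + h') x = y h x + y h' x ∧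
      y₁ (h + h') x = y₁ h x + y₁ h' x := fun h h' x hx => by
    refine (hs (h + h')).eq_of_eq hS hV locallyIntegrableOn_zero
      (by simpa using! (hs h).add hS (hs h')) h0 ?_ ?_ hx
    · simp only [hy, map_add]
    · simp only [hy₁, map_add]
  have hsmul : ∀ (c : ℂ) h, ∀ x ∈ ico a b, y (c • h) x = c • y h x ∧
      y₁ (c • h) x = c • y₁ h x := fun c h x hx => by
    refine (hs (c • h)).eq_of_eq hS hV locallyIntegrableOn_zero
      (by simpa using! (hs h).smul hS c) h0 ?_ ?_ hx
    · simp only [hy, map_smul]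
    · simp only [hy₁, map_smul]
  have hb : ∀ x ∈ ico a b, ∃ C : ℝ, ∀ h, ‖y h x‖ ≤ C * ‖h‖ ∧ ‖y₁ h x‖ ≤ C * ‖h‖ :=
    fun x hx => by
      refine ⟨2 * (‖A‖ + ‖B‖) * expWeight (fun t => 1 + ‖z‖ + ‖V t‖) a x, fun h => ?_⟩
      have h1 := (hs h).norm_le hS hV h0 hx
      have h2 : ‖(y h a, y₁ h a)‖ ≤ (‖A‖ + ‖B‖) * ‖h‖ := by
        rw [hy, hy₁]
        refine max_le ((A.le_opNorm h).trans ?_) ((B.le_opNorm h).trans ?_) <;> gcongr <;>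
          linarith [norm_nonneg A, norm_nonneg B]
      have h3 : ‖(y h x, y₁ h x)‖ ≤
          2 * (‖A‖ + ‖B‖) * expWeight (fun t => 1 + ‖z‖ + ‖V t‖) a x * ‖h‖ := by
        nlinarith [expWeight_pos (fun t => 1 + ‖z‖ + ‖V t‖) a x]
      exact ⟨(norm_fst_le (y h x, y₁ h x)).trans h3, (norm_snd_le (y h x, y₁ h x)).trans h3⟩
  have hex : ∀ x ∈ ico a b, ∃ T T₁ : H →L[ℂ] H, ∀ h, T h = y h x ∧ T₁ h = y₁ h x :=
    fun x hx => by
      obtain ⟨C, hC⟩ := hb x hx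
      refine ⟨LinearMap.mkContinuous ⟨⟨fun h => y h x, fun h h' => (hadd h h' x hx).1⟩,
        fun c h => (hsmul c h x hx).1⟩ C fun h => (hC h).1,
        LinearMap.mkContinuous ⟨⟨fun h => y₁ h x, fun h h' => (hadd h h' x hx).2⟩,
        fun c h => (hsmul c h x hx).2⟩ C fun h => (hC h).2, fun h => ⟨rfl, rfl⟩⟩
  choose! Y Y₁ hY using hex
  refine ⟨Y, Y₁, ?_, ?_, fun h => ⟨fun t => V t (y h t) - z • y h t - (0 : ℝ → H) t,
    ⟨(hs h).1.congr hS ?_ ?_, (hs h).2.congr hS ?_ ?_⟩, ?_⟩⟩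
  · ext h
    rw [(hY a h0 h).1, hy]
  · ext h
    rw [(hY a h0 h).2, hy₁]
  · exact fun x hx => (hY x hx h).1.symm
  · exact fun x hx => (hY x hx h).2.symm
  · exact fun x hx => (hY x hx h).2.symm
  · exact fun x _ => rfl
  · filter_upwards [ae_restrict_mem (measurableSet_ioo a b)] with x hx
    rw [(hY x (ioo_subset_ico hx) h).1]
    simp

namespace IsOpSolution

variable {z : ℂ} {A B : H →L[ℂ] H} {Y Y₁ : ℝ → H →L[ℂ] H}

theorem isSol (h : IsOpSolution a b V z A B Y Y₁) (e : H) :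
    IsSol (ico a b) V z 0 (fun x => Y x e) (fun x => Y₁ x e) := by
  obtain ⟨y₂, hy, hae⟩ := h.2.2 e
  exact IsSol.of_isW21Loc (ico_ordConnected a b) hy (by
    rw [restrict_ico]
    simpa using! hae)

theorem norm_le (hab : (a : EReal) < b) (hV : IsLocPotential (ico a b) V)
    (h : IsOpSolution a b V z A B Y Y₁) {x : ℝ} (hx : x ∈ ico a b) :
    ‖Y x‖ ≤ 2 * (‖A‖ + ‖B‖) * expWeight (fun t => 1 + ‖z‖ + ‖V t‖) a x ∧
    ‖Y₁ x‖ ≤ 2 * (‖A‖ + ‖B‖) * expWeight (fun t => 1 + ‖z‖ + ‖V t‖) a x := by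
  have hw := expWeight_pos (fun t => 1 + ‖z‖ + ‖V t‖) a x
  have key : ∀ e, ‖(Y x e, Y₁ x e)‖ ≤
      2 * (‖A‖ + ‖B‖) * expWeight (fun t => 1 + ‖z‖ + ‖V t‖) a x * ‖e‖ := fun e => by
    have h1 := (h.isSol e).norm_le (ico_ordConnected a b) hV (left_mem_ico hab) hx
    have h2 : ‖(Y a e, Y₁ a e)‖ ≤ (‖A‖ + ‖B‖) * ‖e‖ := by
      rw [h.1, h.2.1]
      refine max_le ((A.le_opNorm e).trans ?_) ((B.le_opNorm e).trans ?_) <;> gcongr <;>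
        linarith [norm_nonneg A, norm_nonneg B]
    nlinarith
  exact ⟨ContinuousLinearMap.opNorm_le_bound _ (by positivity) fun e =>
      (norm_fst_le (Y x e, Y₁ x e)).trans (key e),
    ContinuousLinearMap.opNorm_le_bound _ (by positivity) fun e =>
      (norm_snd_le (Y x e, Y₁ x e)).trans (key e)⟩

theorem exists_bound (hab : (a : EReal) < b) (hV : IsLocPotential (ico a b) V)
    (h : IsOpSolution a b V z A B Y Y₁) {c : ℝ} (hc : c ∈ ico a b) :
    ∃ K, 0 ≤ K ∧ ∀ x ∈ Icc a c, ‖Y x‖ ≤ K ∧ ‖Y₁ x‖ ≤ K := by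
  have hm := (hV.isLipschitzField z (k := 0) locallyIntegrableOn_zero).locInt
  have hw := (continuousOn_expWeight (ico_ordConnected a b) hm (left_mem_ico hab)).mono
    (Icc_subset_ico hc)
  simp only [Pi.zero_apply, norm_zero, add_zero] at hw
  obtain ⟨K, hK⟩ := isCompact_Icc.exists_bound_of_continuousOn hw
  have hle : ∀ x ∈ Icc a c, expWeight (fun t => 1 + ‖z‖ + ‖V t‖) a x ≤ K := fun x hx =>
    (le_abs_self _).trans (hK x hx)
  have hK0 : 0 ≤ K := (expWeight_pos _ _ _).le.trans (hle a ⟨le_rfl, hc.1⟩)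
  refine ⟨2 * (‖A‖ + ‖B‖) * K, by positivity, fun x hx => ?_⟩
  have h1 := h.norm_le hab hV (Icc_subset_ico hc hx)
  have h2 := mul_le_mul_of_nonneg_left (hle x hx) (by positivity : 0 ≤ 2 * (‖A‖ + ‖B‖))
  exact ⟨h1.1.trans h2, h1.2.trans h2⟩

end IsOpSolution

theorem opSolution_spec (hab : (a : EReal) < b) (hV : IsLocPotential (ico a b) V) (z : ℂ)
    (A B : H →L[ℂ] H) : ∃ Y₁, IsOpSolution a b V z A B (opSolution a b V z A B) Y₁ :=
  Classical.epsilon_spec (exists_isOpSolution hab hV z A B)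

end OperatorSolutions

/-! ### The boundary rotation by `α`, Green's identity, and symmetry of `H_α`. -/

section

variable {H : Type*} [NormedAddCommGroup H] [InnerProductSpace ℂ H] [CompleteSpace H]
  {a : ℝ} {b : EReal} {V : ℝ → H →L[ℂ] H}

section Trigonometry

variable {α : H →L[ℂ] H}

theorem inner_sinOp (α : H →L[ℂ] H) (x y : H) :
    inner ℂ (sinOp α x) y = inner ℂ x (sinOp α y) := by
  have : IsSelfAdjoint (sinOp α) := cfc_predicate Real.sin α
  exact (ContinuousLinearMap.isSelfAdjoint_iff_isSymmetric.1 this) x y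

theorem inner_cosOp (α : H →L[ℂ] H) (x y : H) :
    inner ℂ (cosOp α x) y = inner ℂ x (cosOp α y) := by
  have : IsSelfAdjoint (cosOp α) := cfc_predicate Real.cos α
  exact (ContinuousLinearMap.isSelfAdjoint_iff_isSymmetric.1 this) x y

theorem sinOp_cosOp (α : H →L[ℂ] H) (x : H) : sinOp α (cosOp α x) = cosOp α (sinOp α x) :=
  DFunLike.congr_fun (cfc_commute_cfc Real.sin Real.cos α).eq x

theorem sinOp_sq_add_cosOp_sq (hα : IsSelfAdjoint α) (x : H) :
    sinOp α (sinOp α x) + cosOp α (cosOp α x) = x := by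
  have h : sinOp α * sinOp α + cosOp α * cosOp α = 1 := by
    have hs : ContinuousOn Real.sin (spectrum ℝ α) := Real.continuous_sin.continuousOn
    have hc : ContinuousOn Real.cos (spectrum ℝ α) := Real.continuous_cos.continuousOn
    rw [sinOp, cosOp, ← cfc_mul _ _ α hs hs, ← cfc_mul _ _ α hc hc,
      ← cfc_add α _ _ (hs.fun_mul hs) (hc.fun_mul hc), ← cfc_const_one ℝ α hα]
    congr 1
    funext r
    nlinarith [Real.sin_sq_add_cos_sq r]
  simpa using DFunLike.congr_fun h x

theorem cosOp_sq_add_sinOp_sq (hα : IsSelfAdjoint α) (x : H) :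
    cosOp α (cosOp α x) + sinOp α (sinOp α x) = x := by
  rw [add_comm, sinOp_sq_add_cosOp_sq hα]

/-- With its companions below, this inverts the rotation between boundary data `(p, q) = (y(a),
y'(a))` and coefficients `(f, g)` with respect to `theta` and `phi`: `p = cos(α) f - sin(α) g` and
`q = sin(α) f + cos(α) g`. -/
theorem eq_cosOp_sub_sinOp (hα : IsSelfAdjoint α) (p q : H) :
    cosOp α (cosOp α p + sinOp α q) - sinOp α (cosOp α q - sinOp α p) = p := by
  have := cosOp_sq_add_sinOp_sq hα p
  refine Eq.trans ?_ this
  simp only [map_add, map_sub, sinOp_cosOp]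
  abel

theorem eq_sinOp_add_cosOp (hα : IsSelfAdjoint α) (p q : H) :
    sinOp α (cosOp α p + sinOp α q) + cosOp α (cosOp α q - sinOp α p) = q := by
  have := cosOp_sq_add_sinOp_sq hα q
  refine Eq.trans ?_ this
  simp only [map_add, map_sub, sinOp_cosOp]
  abel

theorem cosOp_sub_sinOp_eq (hα : IsSelfAdjoint α) (f g : H) :
    cosOp α (sinOp α f + cosOp α g) - sinOp α (cosOp α f - sinOp α g) = g := by
  have := cosOp_sq_add_sinOp_sq hα g
  refine Eq.trans ?_ this
  simp only [map_add, map_sub, sinOp_cosOp]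
  abel

/-- The rotation by `α` is symplectic, so a Wronskian at `a` can be computed from the coefficients
with respect to `theta` and `phi`. -/
theorem inner_boundary (hα : IsSelfAdjoint α) (f g f' g' : H) :
    inner ℂ (cosOp α f' - sinOp α g') (sinOp α f + cosOp α g) -
      inner ℂ (sinOp α f' + cosOp α g') (cosOp α f - sinOp α g) =
    inner ℂ f' g - inner ℂ g' f := by
  have h1 := congrArg (inner ℂ f') (cosOp_sq_add_sinOp_sq hα g)
  have h2 := congrArg (inner ℂ g') (cosOp_sq_add_sinOp_sq hα f)
  rw [inner_add_right] at h1 h2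
  simp only [inner_sub_left, inner_add_left, inner_sub_right, inner_add_right, inner_sinOp,
    inner_cosOp, sinOp_cosOp]
  linear_combination h1 - h2

end Trigonometry

/-- `V` is a potential on `[a, b)`, regular at `a` and of limit-point type at `b`. -/
structure IsWeylPotential (a : ℝ) (b : EReal) (V : ℝ → H →L[ℂ] H) : Prop where
  lt : (a : EReal) < b
  loc : IsLocPotential (ico a b) V
  selfAdjoint : ∀ᵐ x ∂(volume.restrict (ioo a b)), IsSelfAdjoint (V x)
  limitPoint : LimitPointRight a b V

/-- In the product rule the terms `(w', y')` cancel, and the terms with `V` cancel by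
self-adjointness. Without forces and with `z' = conj z` the Wronskian is therefore constant. -/
theorem IsSol.isPrimitiveOn_wronskian {S : Set ℝ} (hS : S.OrdConnected)
    (hV : ∀ᵐ x ∂(volume.restrict S), IsSelfAdjoint (V x)) {z z' : ℂ} {k l y y₁ w w₁ : ℝ → H}
    (h : IsSol S V z k y y₁) (h' : IsSol S V z' l w w₁) :
    IsPrimitiveOn S (fun t => inner ℂ (w t) (y₁ t) - inner ℂ (w₁ t) (y t))
      (fun t => (starRingEnd ℂ z' - z) * inner ℂ (w t) (y t) - inner ℂ (w t) (k t)
        + inner ℂ (l t) (y t)) := by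
  have h1 := (h'.1.bilin (isBoundedBilinearMap_inner (𝕜 := ℂ) (E := H)).toContinuousLinearMap
    hS h.2).add hS
    ((h'.2.bilin (isBoundedBilinearMap_inner (𝕜 := ℂ) (E := H)).toContinuousLinearMap
    hS h.1).smul (-1))
  refine (h1.congr_ae hS ?_).congr hS (fun t _ => ?_) fun t _ => rfl
  · filter_upwards [hV] with t ht
    have := (ContinuousLinearMap.isSelfAdjoint_iff_isSymmetric.1 ht) (w t) (y t)
    simp only [ContinuousLinearMap.coe_coe] at this
    simp only [IsBoundedBilinearMap.toContinuousLinearMap_apply, Pi.add_apply, Pi.smul_apply,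
      inner_sub_left, inner_sub_right, inner_smul_left, inner_smul_right, smul_eq_mul, this]
    ring
  · simp only [IsBoundedBilinearMap.toContinuousLinearMap_apply, Pi.add_apply, Pi.smul_apply,
      smul_eq_mul]
    ring

section LTwo

theorem L2.locallyIntegrableOn (u : L2 H a b) : LocallyIntegrableOn u (ico a b) volume := by
  rw [locallyIntegrableOn_iff_Icc (ico_ordConnected a b)]
  intro c hc d hd
  have h1 : MemLp u 2 (volume.restrict (ico a b)) := by
    rw [restrict_ico]
    exact Lp.memLp u
  have h2 : MemLp u 2 (volume.restrict (Icc c d)) :=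
    h1.mono_measure (Measure.restrict_mono ((ico_ordConnected a b).out hc hd) le_rfl)
  exact h2.integrable (by norm_num)

end LTwo

/-- Moves the spectral parameter into the force, to pass between the resolvent equation and
membership in a graph, where the parameter is `0`. -/
theorem isSol_zero_iff {z : ℂ} {y y₁ : ℝ → H} {f k : L2 H a b}
    (hf : f =ᵐ[volume.restrict (ioo a b)] y) :
    IsSol (ico a b) V z k y y₁ ↔ IsSol (ico a b) V 0 (k + z • f : L2 H a b) y y₁ := by
  have hae : ∀ᵐ t ∂(volume.restrict (ico a b)),
      z • y t + k t = (0 : ℂ) • y t + (k + z • f : L2 H a b) t := by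
    rw [restrict_ico]
    filter_upwards [hf, Lp.coeFn_add k (z • f), Lp.coeFn_smul z f] with t h1 h2 h3
    rw [h2, Pi.add_apply, h3, Pi.smul_apply, h1]
    simp [add_comm]
  exact ⟨fun h => h.congr_force (ico_ordConnected a b) hae,
    fun h => h.congr_force (ico_ordConnected a b) (hae.mono fun t ht => ht.symm)⟩

theorem IsW21Loc.eqOn {y y₁ y₂ w w₁ w₂ : ℝ → H} (hy : IsW21Loc (ioo a b) y y₁ y₂)
    (hw : IsW21Loc (ioo a b) w w₁ w₂) (h : y =ᵐ[volume.restrict (ioo a b)] w) :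
    EqOn y w (ioo a b) ∧ EqOn y₁ w₁ (ioo a b) := by
  have hS := ioo_ordConnected a b
  have h0 : EqOn y w (ioo a b) := Measure.eqOn_open_of_ae_eq h (isOpen_ioo a b)
    hy.1.continuousOn hw.1.continuousOn
  refine ⟨h0, ?_⟩
  have hd := (hy.1.add hS (hw.1.smul (-1))).eq_zero fun x hx => by simp [h0 hx]
  refine Measure.eqOn_open_of_ae_eq (hd.mono fun x hx => ?_) (isOpen_ioo a b)
    hy.2.continuousOn hw.2.continuousOn
  simpa [add_neg_eq_zero] using hx

/-- Regularity of `a` gives elements of the maximal domain boundary values there: the solution on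
`[a,b)` with the same force and the same data at an interior point agrees with the given
representative on `(a,b)`. -/
theorem mem_maxGraph_iff (hab : (a : EReal) < b) (hV : IsLocPotential (ico a b) V)
    {p : L2 H a b × L2 H a b} :
    p ∈ maxGraph a b V ↔ ∃ y y₁, IsSol (ico a b) V 0 p.2 y y₁ ∧
      p.1 =ᵐ[volume.restrict (ioo a b)] y := by
  constructor
  · rintro ⟨y, y₁, y₂, hy, h1, h2⟩
    have hs : IsSol (ioo a b) V 0 p.2 y y₁ := IsSol.of_isW21Loc (ioo_ordConnected a b) hy
      (h2.mono fun t ht => by simp [ht])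
    obtain ⟨x₀, h₀⟩ := ioo_nonempty hab
    obtain ⟨w, w₁, hw, hw₁, hs'⟩ := exists_isSol (ico_ordConnected a b) hV 0
      (L2.locallyIntegrableOn p.2) (ioo_subset_ico h₀) (y x₀) (y₁ x₀)
    refine ⟨w, w₁, hs', h1.trans ?_⟩
    filter_upwards [ae_restrict_mem (measurableSet_ioo a b)] with x hx
    exact (hs.eq_of_eq (ioo_ordConnected a b) (hV.mono ioo_subset_ico)
      ((L2.locallyIntegrableOn p.2).mono_set ioo_subset_ico) (hs'.mono ioo_subset_ico) h₀
      hw.symm hw₁.symm hx).1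
  · rintro ⟨y, y₁, hs, h1⟩
    refine ⟨y, y₁, _, hs.mono ioo_subset_ico, h1, Eventually.of_forall fun t => ?_⟩
    simp

/-- The graph of `H_α`. -/
def alphaGraph (a : ℝ) (b : EReal) (V : ℝ → H →L[ℂ] H) (α : H →L[ℂ] H) :
    Submodule ℂ (L2 H a b × L2 H a b) :=
  (schrodingerOp a b V α).graph

theorem tendsto_left {y : ℝ → H} (hab : (a : EReal) < b) (hy : ContinuousOn y (ico a b)) :
    Tendsto y (𝓝[>] a) (𝓝 (y a)) := by
  have h1 : ico a b ∈ 𝓝[>] a := by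
    obtain ⟨d, hd, had⟩ := exists_mem_ioo_gt (left_mem_ico hab)
    filter_upwards [Ioo_mem_nhdsGT had] with x hx
    exact ioo_subset_ico (Ioo_subset_ioo (ioo_subset_ico hd) hx)
  exact (hy a (left_mem_ico hab)).mono_left (nhdsWithin_le_of_mem h1)

theorem mem_alphaGraph_iff (hab : (a : EReal) < b) (hV : IsLocPotential (ico a b) V)
    {α : H →L[ℂ] H} {p : L2 H a b × L2 H a b} :
    p ∈ alphaGraph a b V α ↔ ∃ y y₁, IsSol (ico a b) V 0 p.2 y y₁ ∧
      p.1 =ᵐ[volume.restrict (ioo a b)] y ∧ sinOp α (y₁ a) + cosOp α (y a) = 0 := by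
  have key : p ∈ alphaGraph a b V α ↔ p.1 ∈ boundaryCondition a b α ∧ p ∈ maxGraph a b V := by
    rw [← maxOp_graph, alphaGraph, LinearPMap.mem_graph_iff, LinearPMap.mem_graph_iff]
    constructor
    · rintro ⟨u, h1, h2⟩
      rw [← h1]
      exact ⟨u.2.1, ⟨⟨u, u.2.2⟩, rfl, h2⟩⟩
    · rintro ⟨h, ⟨u, h1, h2⟩⟩
      exact ⟨⟨u, h1 ▸ h, u.2⟩, h1, h2⟩
  rw [key, mem_maxGraph_iff hab hV]
  constructor
  · rintro ⟨⟨w, w₁, w₂, wa, w₁a, hw, hwf, ht, ht₁, hbc⟩, y, y₁, hs, hf⟩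
    refine ⟨y, y₁, hs, hf, ?_⟩
    have he := hw.eqOn (hs.mono ioo_subset_ico) (hwf.symm.trans hf)
    have hmem : ∀ᶠ x in 𝓝[>] a, x ∈ ioo a b := by
      obtain ⟨d, hd, had⟩ := exists_mem_ioo_gt (left_mem_ico hab)
      filter_upwards [Ioo_mem_nhdsGT had] with x hx using Ioo_subset_ioo (ioo_subset_ico hd) hx
    have e1 : wa = y a := tendsto_nhds_unique (ht.congr' (hmem.mono fun x hx => he.1 hx))
      (tendsto_left hab (hs.continuousOn (ico_ordConnected a b)))
    have e2 : w₁a = y₁ a := tendsto_nhds_unique (ht₁.congr' (hmem.mono fun x hx => he.2 hx))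
      (tendsto_left hab (hs.continuousOn_deriv (ico_ordConnected a b)))
    rw [← e1, ← e2, hbc]
  · rintro ⟨y, y₁, hs, hf, hbc⟩
    exact ⟨⟨y, y₁, _, y a, y₁ a, hs.mono ioo_subset_ico, hf,
      tendsto_left hab (hs.continuousOn (ico_ordConnected a b)),
      tendsto_left hab (hs.continuousOn_deriv (ico_ordConnected a b)), hbc⟩, y, y₁, hs, hf⟩

theorem IsWeylPotential.selfAdjoint_ico (hV : IsWeylPotential a b V) :
    ∀ᵐ x ∂(volume.restrict (ico a b)), IsSelfAdjoint (V x) := by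
  rw [restrict_ico]
  exact hV.selfAdjoint

/-- Green's identity on `[x, b)`; there is no boundary term at the limit-point endpoint `b`. -/
theorem IsWeylPotential.green (hV : IsWeylPotential a b V) {z z' : ℂ} {y y₁ w w₁ : ℝ → H}
    {f g k l : L2 H a b} (h : IsSol (ico a b) V z k y y₁) (h' : IsSol (ico a b) V z' l w w₁)
    (hf : f =ᵐ[volume.restrict (ioo a b)] y) (hg : g =ᵐ[volume.restrict (ioo a b)] w)
    {x : ℝ} (hx : x ∈ ico a b) :
    ∫ t in ioo x b, ((starRingEnd ℂ z' - z) * inner ℂ (g t) (f t) - inner ℂ (g t) (k t)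
      + inner ℂ (l t) (f t)) = -(inner ℂ (w x) (y₁ x) - inner ℂ (w₁ x) (y x)) := by
  have hS := ico_ordConnected a b
  have hp := h.isPrimitiveOn_wronskian hS hV.selfAdjoint_ico h'
  have hsub : ioo x b ⊆ ioo a b := fun t ht => ⟨hx.1.trans_lt ht.1, ht.2⟩
  have hfd : f ∈ (maxOp a b V).domain := by
    rw [LinearPMap.mem_domain_iff]
    exact ⟨_, by
      rw [maxOp_graph, mem_maxGraph_iff hV.lt hV.loc]
      exact ⟨y, y₁, (isSol_zero_iff hf).1 h, hf⟩⟩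
  have hgd : g ∈ (maxOp a b V).domain := by
    rw [LinearPMap.mem_domain_iff]
    exact ⟨_, by
      rw [maxOp_graph, mem_maxGraph_iff hV.lt hV.loc]
      exact ⟨w, w₁, (isSol_zero_iff hg).1 h', hg⟩⟩
  have hlim := hV.limitPoint g hgd f hfd w w₁ _ y y₁ _ (h'.mono ioo_subset_ico) hg
    (h.mono ioo_subset_ico) hf
  have hi : IntegrableOn (fun t => (starRingEnd ℂ z' - z) * inner ℂ (g t) (f t)
      - inner ℂ (g t) (k t) + inner ℂ (l t) (f t)) (ioo a b) volume :=
    (((L2.integrable_inner (𝕜 := ℂ) g f).const_mul _).sub (L2.integrable_inner g k)).add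
      (L2.integrable_inner l f)
  have h1 := tendsto_integral_toLeft hx (hi.mono_set hsub)
  have hne := toLeft_neBot hV.lt
  have h2 : Tendsto (fun c => ∫ t in x..c, ((starRingEnd ℂ z' - z) * inner ℂ (g t) (f t)
      - inner ℂ (g t) (k t) + inner ℂ (l t) (f t))) (toLeft b)
      (𝓝 (0 - (inner ℂ (w x) (y₁ x) - inner ℂ (w₁ x) (y x)))) := by
    refine (hlim.sub_const _).congr' ?_
    filter_upwards [eventually_toLeft_ge hx] with c hc
    rw [hp.eq x hx c hc.2, add_sub_cancel_left]
    refine intervalIntegral.integral_congr_ae ?_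
    have hfg := (hf.and hg)
    rw [ae_restrict_iff' (measurableSet_ioo a b)] at hfg
    filter_upwards [hfg, (by simp [ae_iff, measure_singleton] : ∀ᵐ t : ℝ, t ≠ c)] with t ht htc hm
    rw [uIoc_of_le hc.1] at hm
    have := ht ⟨hx.1.trans_lt hm.1, (EReal.coe_le_coe_iff.2 hm.2).trans_lt hc.2.2⟩
    rw [this.1, this.2]
  rw [tendsto_nhds_unique h1 h2, zero_sub]

theorem setIntegral_ioo_inner (f g : L2 H a b) :
    ∫ t in ioo a b, inner ℂ (f t) (g t) = inner ℂ f g := (L2.inner_def f g).symm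

theorem IsWeylPotential.green_left (hV : IsWeylPotential a b V) {y y₁ w w₁ : ℝ → H}
    {f g k l : L2 H a b} (h : IsSol (ico a b) V 0 k y y₁) (h' : IsSol (ico a b) V 0 l w w₁)
    (hf : f =ᵐ[volume.restrict (ioo a b)] y) (hg : g =ᵐ[volume.restrict (ioo a b)] w) :
    inner ℂ g k - inner ℂ l f = inner ℂ (w a) (y₁ a) - inner ℂ (w₁ a) (y a) := by
  have := hV.green h h' hf hg (left_mem_ico hV.lt)
  simp only [map_zero, sub_zero, zero_mul, zero_sub] at this
  rw [integral_add (L2.integrable_inner (𝕜 := ℂ) g k).fun_neg (L2.integrable_inner l f),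
    integral_neg,
    setIntegral_ioo_inner, setIntegral_ioo_inner] at this
  linear_combination -this

/-- Two functions satisfying the boundary condition at `a` have vanishing Wronskian there. -/
theorem wronskian_eq_zero {α : H →L[ℂ] H} (hα : IsSelfAdjoint α) {p q p' q' : H}
    (h : sinOp α q + cosOp α p = 0) (h' : sinOp α q' + cosOp α p' = 0) :
    inner ℂ p' q - inner ℂ q' p = 0 := by
  rw [add_comm] at h h'
  have := inner_boundary hα (cosOp α p + sinOp α q) (cosOp α q - sinOp α p)
    (cosOp α p' + sinOp α q') (cosOp α q' - sinOp α p')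
  rw [eq_sinOp_add_cosOp hα p q, eq_sinOp_add_cosOp hα p' q', eq_cosOp_sub_sinOp hα p q,
    eq_cosOp_sub_sinOp hα p' q', h, h', inner_zero_left, inner_zero_right, sub_zero] at this
  exact this

theorem alphaGraph_symmetric (hV : IsWeylPotential a b V) {α : H →L[ℂ] H} (hα : IsSelfAdjoint α)
    {p q : L2 H a b × L2 H a b} (hp : p ∈ alphaGraph a b V α) (hq : q ∈ alphaGraph a b V α) :
    inner ℂ q.1 p.2 = inner ℂ q.2 p.1 := by
  obtain ⟨y, y₁, hs, hf, hbc⟩ := (mem_alphaGraph_iff hV.lt hV.loc).1 hp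
  obtain ⟨w, w₁, hs', hg, hbc'⟩ := (mem_alphaGraph_iff hV.lt hV.loc).1 hq
  rw [← sub_eq_zero, hV.green_left hs hs' hf hg]
  exact wronskian_eq_zero hα hbc hbc'

/-- `|Im z| ‖f‖ ≤ ‖(H_α - z) f‖`. -/
theorem abs_im_mul_norm_le (hV : IsWeylPotential a b V) {α : H →L[ℂ] H} (hα : IsSelfAdjoint α)
    {p : L2 H a b × L2 H a b} (hp : p ∈ alphaGraph a b V α) (z : ℂ) :
    |z.im| * ‖p.1‖ ≤ ‖p.2 - z • p.1‖ := by
  -- Symmetry makes the quadratic form real, so the imaginary part of `⟨f, (H_α - z) f⟩` is `-Im z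
  -- ‖f‖²`.
  have h1 : (inner ℂ p.1 p.2).im = 0 := by
    have := alphaGraph_symmetric hV hα hp hp
    rw [← inner_conj_symm p.2 p.1] at this
    have := congrArg Complex.im this
    rw [Complex.conj_im] at this
    linarith
  have h2 : inner ℂ p.1 (p.2 - z • p.1) = inner ℂ p.1 p.2 - z * (‖p.1‖ : ℂ) ^ 2 := by
    rw [inner_sub_right, inner_smul_right, inner_self_eq_norm_sq_to_K]
    rfl
  have h3 : |(inner ℂ p.1 (p.2 - z • p.1)).im| = |z.im| * ‖p.1‖ ^ 2 := by
    rw [h2, Complex.sub_im, h1, ← Complex.ofReal_pow, Complex.im_mul_ofReal, zero_sub, abs_neg,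
      abs_mul, abs_of_nonneg (sq_nonneg ‖p.1‖)]
  have h4 := (Complex.abs_im_le_norm _).trans (norm_inner_le_norm (𝕜 := ℂ) p.1 (p.2 - z • p.1))
  rw [h3] at h4
  rcases (norm_nonneg p.1).eq_or_lt with h0 | h0
  · rw [← h0, mul_zero]
    exact norm_nonneg _
  · refine le_of_mul_le_mul_left ?_ h0
    linarith

end

/-! ### Bounded maps into `L²`, smooth cutoffs, and compactly supported test functions. -/

section

variable {H : Type*} [NormedAddCommGroup H] [InnerProductSpace ℂ H] [CompleteSpace H]
  {a : ℝ} {b : EReal} {V : ℝ → H →L[ℂ] H}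

/-- A family of operators with values in `L²` defines a bounded operator into `L²`, by the closed
graph theorem. -/
theorem exists_clm_of_memLp {X : Type*} [MeasurableSpace X] {μ : Measure X} {Φ : X → H →L[ℂ] H}
    (h : ∀ e, MemLp (fun t => Φ t e) 2 μ) :
    ∃ T : H →L[ℂ] Lp H 2 μ, ∀ e, T e =ᵐ[μ] fun t => Φ t e := by
  let L : H →ₗ[ℂ] Lp H 2 μ :=
    { toFun := fun e => (h e).toLp _
      map_add' := fun e e' => by
        rw [← MemLp.toLp_add]
        refine MemLp.toLp_congr _ _ (Eventually.of_forall fun t => ?_)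
        simp
      map_smul' := fun c e => by
        rw [RingHom.id_apply, ← MemLp.toLp_const_smul]
        refine MemLp.toLp_congr _ _ (Eventually.of_forall fun t => ?_)
        simp }
  have hL : ∀ e, L e =ᵐ[μ] fun t => Φ t e := fun e => MemLp.coeFn_toLp (h e)
  have hc : Continuous L := by
    refine L.continuous_of_seq_closed_graph fun u x y hu hLu => ?_
    -- A subsequence converges a.e., and there the limit is identified by the continuity of each
    -- single `Φ t`.
    obtain ⟨ns, hns, hae⟩ := (tendstoInMeasure_of_tendsto_Lp hLu).exists_seq_tendsto_ae
    refine Lp.ext ?_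
    have hall : ∀ᵐ t ∂μ, ∀ n, L (u n) t = Φ t (u n) := ae_all_iff.2 fun n => hL (u n)
    filter_upwards [hae, hall, hL x] with t h1 h2 h3
    rw [h3]
    refine tendsto_nhds_unique h1 ?_
    simp only [Function.comp_apply, h2]
    exact ((Φ t).continuous.tendsto x).comp (hu.comp hns.tendsto_atTop)
  exact ⟨⟨L, hc⟩, hL⟩

theorem memLp_of_continuousOn {g : ℝ → H} (hg : ContinuousOn g (ico a b)) {c : ℝ}
    (hc : c ∈ ico a b) (h0 : ∀ x ∈ ico a b, c ≤ x → g x = 0) :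
    MemLp g 2 (volume.restrict (ioo a b)) := by
  rw [← restrict_ico]
  have h1 : MemLp ((Icc a c).indicator g) 2 (volume.restrict (ico a b)) := by
    rw [memLp_indicator_iff_restrict measurableSet_Icc,
      Measure.restrict_restrict_of_subset (Icc_subset_ico hc)]
    obtain ⟨K, hK⟩ := isCompact_Icc.exists_bound_of_continuousOn (hg.mono (Icc_subset_ico hc))
    refine MemLp.of_bound ((hg.mono (Icc_subset_ico hc)).aestronglyMeasurable measurableSet_Icc)
      K ?_
    filter_upwards [ae_restrict_mem measurableSet_Icc] with t ht using hK t ht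
  refine h1.ae_eq ?_
  filter_upwards [ae_restrict_mem (ico_ordConnected a b).measurableSet] with t ht
  by_cases h : t ∈ Icc a c
  · rw [indicator_of_mem h]
  · rw [indicator_of_notMem h, h0 t ht]
    by_contra hlt
    exact h ⟨ht.1, (not_le.1 hlt).le⟩

theorem exists_cutoff {a c : ℝ} (hac : a < c) : ∃ χ χ₁ χ₂ : ℝ → ℝ, Continuous χ₁ ∧ Continuous χ₂ ∧
    (∀ x, HasDerivAt χ (χ₁ x) x) ∧ (∀ x, HasDerivAt χ₁ (χ₂ x) x) ∧ χ a = 1 ∧ χ₁ a = 0 ∧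
    ∀ x, c ≤ x → χ x = 0 ∧ χ₁ x = 0 ∧ χ₂ x = 0 := by
  obtain ⟨d, had, hdc⟩ := exists_between hac
  -- The cutoff is `1` to the left of `d` and `0` to the right of `e`. Since `e < c`, it vanishes in
  -- a neighbourhood of `c` as well, so its derivatives are zero already at `c`.
  obtain ⟨e, hde, hec⟩ := exists_between hdc
  let χ : ℝ → ℝ := fun x => Real.smoothTransition ((e - x) / (e - d))
  have hχ : ContDiff ℝ 2 χ :=
    (Real.smoothTransition.contDiff (n := 2)).comp ((contDiff_const.sub contDiff_id).div_const _)
  have hχ₁ : ContDiff ℝ 1 (deriv χ) := (contDiff_succ_iff_deriv.1 (by simpa using! hχ)).2.2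
  have hχ₂ : Continuous (deriv (deriv χ)) := hχ₁.continuous_deriv le_rfl
  have ha : χ =ᶠ[𝓝 a] fun _ => 1 := by
    filter_upwards [eventually_lt_nhds had] with x hx
    refine Real.smoothTransition.one_of_one_le ?_
    rw [le_div_iff₀ (by linarith)]
    linarith
  have hc : ∀ x, e < x → χ =ᶠ[𝓝 x] fun _ => 0 := fun x hx => by
    filter_upwards [eventually_gt_nhds hx] with t ht
    exact Real.smoothTransition.zero_of_nonpos
      (div_nonpos_of_nonpos_of_nonneg (by linarith) (by linarith))
  have hc₁ : ∀ x, e < x → deriv χ =ᶠ[𝓝 x] fun _ => 0 := fun x hx => by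
    filter_upwards [eventually_gt_nhds hx] with t ht
    rw [(hc t ht).deriv_eq, deriv_const]
  refine ⟨χ, deriv χ, deriv (deriv χ), hχ₁.continuous, hχ₂,
    fun x => (hχ.differentiable (by norm_num) x).hasDerivAt,
    fun x => (hχ₁.differentiable (by norm_num) x).hasDerivAt, ha.eq_of_nhds, ?_, fun x hx => ?_⟩
  · rw [ha.deriv_eq, deriv_const]
  · have hx' := hec.trans_le hx
    refine ⟨(hc x hx').eq_of_nhds, (hc₁ x hx').eq_of_nhds, ?_⟩
    rw [(hc₁ x hx').deriv_eq, deriv_const]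

theorem IsPrimitiveOn.smul_real {S : Set ℝ} (hS : S.OrdConnected) {χ χ₁ : ℝ → ℝ} {y g : ℝ → H}
    (hχ₁ : Continuous χ₁) (hχ : ∀ x, HasDerivAt χ (χ₁ x) x) (hy : IsPrimitiveOn S y g) :
    IsPrimitiveOn S (fun t => χ t • y t) (fun t => χ t • g t + χ₁ t • y t) :=
  (isPrimitiveOn_of_continuous hχ₁ hχ).bilin (ContinuousLinearMap.lsmul ℝ ℝ) hS hy

/-- Functions in the domain of the maximal operator that vanish near `b` and have the boundary
values `y(a) = cos(α) h`, `y'(a) = sin(α) h`. -/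
theorem exists_cutoff_solution (hab : (a : EReal) < b) (hV : IsLocPotential (ico a b) V)
    (α : H →L[ℂ] H) : ∃ c ∈ ioo a b, ∃ T : H →L[ℂ] L2 H a b,
      (∀ h, ∀ᵐ t ∂(volume.restrict (ioo a b)), c ≤ t → T h t = 0) ∧
      ∀ h, ∃ y y₁ : ℝ → H, IsSol (ico a b) V 0 (T h) y y₁ ∧ y a = cosOp α h ∧ y₁ a = sinOp α h ∧
        ∀ t ∈ ico a b, c ≤ t → y t = 0 ∧ y₁ t = 0 := by
  have hS := ico_ordConnected a b
  obtain ⟨c, hc⟩ := ioo_nonempty hab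
  obtain ⟨χ, χ₁, χ₂, h1, h2, hd, hd₁, ha, ha₁, h0⟩ := exists_cutoff hc.1
  obtain ⟨Y, Y₁, hY⟩ := exists_isOpSolution hab hV 0 (cosOp α) (sinOp α)
  -- Since `τ Y = 0`, this is `τ (χ Y) = -χ'' Y - 2 χ' Y'`.
  let Φ : ℝ → H →L[ℂ] H := fun t => -((χ₂ t : ℂ) • Y t + ((2 * χ₁ t : ℝ) : ℂ) • Y₁ t)
  have hΦ : ∀ t h, Φ t h = -(χ₂ t • Y t h + (2 * χ₁ t) • Y₁ t h) := fun t h => by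
    rw [← Complex.coe_smul, ← Complex.coe_smul]
    rfl
  have hΦ0 : ∀ h t, c ≤ t → Φ t h = 0 := fun h t ht => by
    rw [hΦ, (h0 t ht).2.1, (h0 t ht).2.2]
    simp
  obtain ⟨T, hT⟩ := exists_clm_of_memLp (Φ := Φ) (μ := volume.restrict (ioo a b)) fun h => by
    refine memLp_of_continuousOn ?_ (ioo_subset_ico hc) fun x _ hx => hΦ0 h x hx
    simp only [hΦ]
    exact ((h2.continuousOn.smul ((hY.isSol h).continuousOn hS)).add
      ((continuous_const.mul h1).continuousOn.smul ((hY.isSol h).continuousOn_deriv hS))).neg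
  refine ⟨c, hc, T, fun h => (hT h).mono fun t ht hct => ht.trans (hΦ0 h t hct), fun h =>
    ⟨fun t => χ t • Y t h, fun t => χ t • Y₁ t h + χ₁ t • Y t h, ?_, ?_, ?_, ?_⟩⟩
  · have hs := hY.isSol h
    refine IsSol.of_isW21Loc hS ⟨hs.1.smul_real hS h1 hd,
      (hs.2.smul_real hS h1 hd).add hS (hs.1.smul_real hS h2 hd₁)⟩ ?_
    rw [restrict_ico]
    filter_upwards [hT h] with t ht
    rw [ht, hΦ, (V t).map_smul_of_tower]
    simp only [Pi.add_apply, Pi.zero_apply, zero_smul, sub_zero, zero_add, two_mul, add_smul]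
    abel
  · simp [ha, hY.1]
  · simp [ha, ha₁, hY.2.1]
  · intro t _ ht
    simp [h0 t ht]

theorem inner_eq_intervalIntegral {u v : L2 H a b} {c : ℝ} (hc : c ∈ ico a b)
    (hv : ∀ᵐ t ∂(volume.restrict (ioo a b)), c ≤ t → v t = 0) :
    inner ℂ u v = ∫ t in a..c, inner ℂ (u t) (v t) := by
  rw [L2.inner_def, intervalIntegral.integral_of_le hc.1, ← integral_Ioc_eq_integral_Ioo.symm,
    setIntegral_eq_of_subset_of_ae_sdiff_eq_zero (measurableSet_ioo a b).nullMeasurableSet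
    (Ioo_subset_ioo hc)]
  rw [ae_restrict_iff' (measurableSet_ioo a b)] at hv
  filter_upwards [hv] with t ht hm
  rw [ht hm.1 (not_lt.1 fun h => hm.2 ⟨hm.1.1, h⟩), inner_zero_right]

theorem L2.intervalIntegrable_inner (u v : L2 H a b) {c : ℝ} (hc : c ∈ ico a b) :
    IntervalIntegrable (fun t => inner ℂ (u t) (v t)) volume a c := by
  rw [intervalIntegrable_iff_integrableOn_Ioo_of_le hc.1]
  exact IntegrableOn.mono_set (L2.integrable_inner (𝕜 := ℂ) u v) (Ioo_subset_ioo hc)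

theorem ae_ioo_of_forall_Ioo {P : ℝ → Prop} {c₀ : ℝ} (hc₀ : c₀ ∈ ico a b)
    (h : ∀ c ∈ ioo a b, c₀ ≤ c → ∀ᵐ t, t ∈ Ioo a c → P t) :
    ∀ᵐ t ∂(volume.restrict (ioo a b)), P t := by
  have hne : (toLeft b).NeBot := toLeft_neBot ((EReal.coe_le_coe_iff.2 hc₀.1).trans_lt hc₀.2)
  obtain ⟨u, hu⟩ := exists_seq_tendsto (toLeft b)
  rw [ae_restrict_iff' (measurableSet_ioo a b)]
  -- Approaching `b` along a sequence keeps the exceptional null sets countable in number.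
  have hall : ∀ᵐ t, ∀ n, u n ∈ ioo a b → c₀ ≤ u n → t ∈ Ioo a (u n) → P t :=
    ae_all_iff.2 fun n => by
      by_cases h1 : u n ∈ ioo a b
      · by_cases h2 : c₀ ≤ u n
        · filter_upwards [h _ h1 h2] with t ht _ _ using ht
        · exact Eventually.of_forall fun t _ h => absurd h h2
      · exact Eventually.of_forall fun t h => absurd h h1
  filter_upwards [hall] with t ht hm
  obtain ⟨d, hd, htd⟩ := exists_mem_ioo_gt (ioo_subset_ico hm)
  obtain ⟨n, h1, h2⟩ := ((hu.eventually (eventually_toLeft_ge (ioo_subset_ico hd))).and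
    (hu.eventually (eventually_toLeft_ge hc₀))).exists
  exact ht n ⟨hd.1.trans_le h1.1, h1.2.2⟩ h2.1 ⟨hm.1, htd.trans_le h1.1⟩

end

/-! ### Self-adjointness of `H_α` and its non-real resolvent points. -/

section

variable {H : Type*} [NormedAddCommGroup H] [InnerProductSpace ℂ H] [CompleteSpace H]
  {a : ℝ} {b : EReal} {V : ℝ → H →L[ℂ] H}

theorem IsSol.eq_zero_of_ge (hV : IsLocPotential (ico a b) V) {z : ℂ} {k f f₁ : ℝ → H}
    (h : IsSol (ico a b) V z k f f₁) {c : ℝ} (hc : c ∈ ico a b) (hf : f c = 0) (hf₁ : f₁ c = 0)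
    (hk : ∀ᵐ t ∂(volume.restrict (ioo a b)), c ≤ t → k t = 0) {x : ℝ} (hx : x ∈ ico a b)
    (hcx : c ≤ x) : f x = 0 ∧ f₁ x = 0 := by
  have hsub : ico c b ⊆ ico a b := fun t ht => ⟨hc.1.trans ht.1, ht.2⟩
  have hS := ico_ordConnected c b
  have h' : IsSol (ico c b) V z 0 f f₁ := (h.mono hsub).congr_force hS (by
    rw [← restrict_ico] at hk
    filter_upwards [ae_restrict_of_ae_restrict_of_subset hsub hk,
      ae_restrict_mem hS.measurableSet] with t ht hm
    rw [ht hm.1, Pi.zero_apply])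
  exact h'.eq_of_eq hS (hV.mono hsub) locallyIntegrableOn_zero IsSol.zero (left_mem_ico hc.2)
    hf hf₁ ⟨hcx, hx.2⟩

/-- The Wronskian identity on `[a, c]` for a function vanishing at `c`. -/
theorem IsWeylPotential.green_of_eq_zero (hV : IsWeylPotential a b V) {k l y y₁ w w₁ : ℝ → H}
    (h : IsSol (ico a b) V 0 k y y₁) (h' : IsSol (ico a b) V 0 l w w₁) {c : ℝ}
    (hc : c ∈ ico a b) (hy : y c = 0) (hy₁ : y₁ c = 0) :
    IntervalIntegrable (fun t => inner ℂ (l t) (y t) - inner ℂ (w t) (k t)) volume a c ∧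
    ∫ t in a..c, (inner ℂ (l t) (y t) - inner ℂ (w t) (k t)) =
      -(inner ℂ (w a) (y₁ a) - inner ℂ (w₁ a) (y a)) := by
  have hS := ico_ordConnected a b
  have hp := (h.isPrimitiveOn_wronskian hS hV.selfAdjoint_ico h').congr hS
    (g' := fun t => inner ℂ (l t) (y t) - inner ℂ (w t) (k t)) (fun _ _ => rfl) fun t _ => by
      simp only [map_zero, sub_zero, zero_mul, zero_sub]
      ring
  have ha := left_mem_ico hV.lt
  have := hp.eq a ha c hc
  simp only [hy, hy₁, inner_zero_right, sub_zero] at this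
  exact ⟨hp.intervalIntegrable hS ha hc, by linear_combination -this⟩

theorem memLp_indicator_Ioo {g : L2 H a b} {y : ℝ → H} (hy : ContinuousOn y (ico a b)) {c : ℝ}
    (hc : c ∈ ico a b) :
    MemLp ((Ioo a c).indicator fun t => g t - y t) 2 (volume.restrict (ioo a b)) := by
  rw [memLp_indicator_iff_restrict measurableSet_Ioo]
  refine ((Lp.memLp g).mono_measure Measure.restrict_le_self).sub ?_
  rw [Measure.restrict_restrict_of_subset (Ioo_subset_ioo hc)]
  obtain ⟨K, hK⟩ := isCompact_Icc.exists_bound_of_continuousOn (hy.mono (Icc_subset_ico hc))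
  refine MemLp.of_bound ((hy.mono (Ioo_subset_Icc_self.trans (Icc_subset_ico hc))).aestronglyMeasurable
    measurableSet_Ioo) K ?_
  filter_upwards [ae_restrict_mem measurableSet_Ioo] with t ht using hK t (Ioo_subset_Icc_self ht)

theorem intervalIntegral_inner_congr {u : L2 H a b} {p : ℝ → H} {c : ℝ} (hc : c ∈ ico a b)
    (hu : u =ᵐ[volume.restrict (ioo a b)] (Ioo a c).indicator p) (v : ℝ → H) :
    ∫ t in a..c, inner ℂ (u t) (v t) = ∫ t in a..c, inner ℂ (p t) (v t) := by
  refine intervalIntegral.integral_congr_ae ?_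
  rw [EventuallyEq, ae_restrict_iff' (measurableSet_ioo a b)] at hu
  filter_upwards [hu, (by simp [ae_iff, measure_singleton] : ∀ᵐ t : ℝ, t ≠ c)] with t ht htc hm
  rw [uIoc_of_le hc.1] at hm
  have hm' : t ∈ Ioo a c := ⟨hm.1, lt_of_le_of_ne hm.2 htc⟩
  rw [ht (Ioo_subset_ioo hc hm'), indicator_of_mem hm']

theorem intervalIntegrable_inner_of_continuousOn {w : ℝ → H} (hw : ContinuousOn w (ico a b))
    (l : L2 H a b) {c : ℝ} (hc : c ∈ ico a b) :
    IntervalIntegrable (fun t => inner ℂ (w t) (l t)) volume a c := by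
  rw [intervalIntegrable_iff_integrableOn_Icc_of_le hc.1]
  have ha : a ∈ ico a b := ⟨le_rfl, (EReal.coe_le_coe_iff.2 hc.1).trans_lt hc.2⟩
  exact integrableOn_bilin (isBoundedBilinearMap_inner (𝕜 := ℂ) (E := H)).toContinuousLinearMap
    (hw.mono (Icc_subset_ico hc))
    ((locallyIntegrableOn_iff_Icc (ico_ordConnected a b)).1 (L2.locallyIntegrableOn l) a ha c hc)

/-- `H_α` contains the adjoint of `H_α`. -/
theorem mem_alphaGraph_of_forall (hV : IsWeylPotential a b V) {α : H →L[ℂ] H}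
    (hα : IsSelfAdjoint α) {g k : L2 H a b}
    (h : ∀ p ∈ alphaGraph a b V α, inner ℂ g p.2 = inner ℂ k p.1) :
    (g, k) ∈ alphaGraph a b V α := by
  have hS := ico_ordConnected a b
  have ha := left_mem_ico hV.lt
  -- The aim is `g = y₀ - Y e`, where `y₀` solves `τ y₀ = k` with zero data at `a` and `Y e` is a
  -- homogeneous solution whose data at `a` satisfy the boundary condition.
  obtain ⟨y₀, y₀', hya, hya', hy⟩ := exists_isSol hS hV.loc 0 (L2.locallyIntegrableOn k) ha 0 0
  obtain ⟨Y, Y₁, hY⟩ := exists_isOpSolution hV.lt hV.loc 0 (-sinOp α) (cosOp α)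
  obtain ⟨c₀, hc₀, T, hT0, hT⟩ := exists_cutoff_solution hV.lt hV.loc α
  have hyc := hy.continuousOn hS
  -- `y₀` is not known to be square integrable up to `b`, so `g - y₀` is truncated at `c₀`. Nothing
  -- is lost in pairings with the range of `T`, whose elements vanish beyond `c₀`.
  have hP := memLp_indicator_Ioo (g := g) hyc (ioo_subset_ico hc₀)
  set P := hP.toLp _ with hPdef
  have hPae := hP.coeFn_toLp
  rw [← hPdef] at hPae
  set e := ContinuousLinearMap.adjoint T P with he
  have hYc := (hY.isSol e).continuousOn hS
  -- `g - y₀ + Y e` is orthogonal to every force `l` that vanishes beyond `c`. The solution `f` of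
  -- `τ f = l` vanishing at `c` is corrected by a cutoff solution to meet the boundary condition;
  -- testing the adjoint relation with the result produces a term `⟨e, η⟩`, which `Y e` compensates.
  have orth : ∀ c ∈ ioo a b, c₀ ≤ c → ∀ l : L2 H a b,
      (∀ᵐ t ∂(volume.restrict (ioo a b)), c ≤ t → l t = 0) →
      ∫ t in a..c, (inner ℂ (g t - y₀ t) (l t) + inner ℂ (Y t e) (l t)) = 0 := by
    intro c hc hcc l hl
    have hc' := ioo_subset_ico hc
    obtain ⟨f, f₁, hfc, hf₁c, hf⟩ := exists_isSol hS hV.loc 0 (L2.locallyIntegrableOn l) hc' 0 0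
    have hf0 := fun x hx => hf.eq_zero_of_ge hV.loc hc' hfc hf₁c hl (x := x) hx
    -- The defect of `f` in the boundary condition. The cutoff solution with boundary values `cos(α)
    -- η`, `sin(α) η` has the same defect, because `sin²(α) + cos²(α) = 1`.
    set η := sinOp α (f₁ a) + cosOp α (f a) with hη
    obtain ⟨u, u₁, hu, hua, hu₁a, hu0⟩ := hT η
    have hT0c : ∀ᵐ t ∂(volume.restrict (ioo a b)), c ≤ t → T η t = 0 :=
      (hT0 η).mono fun t ht h => ht (hcc.trans h)
    have hlT : ∀ᵐ t ∂(volume.restrict (ioo a b)), (l - T η : L2 H a b) t = l t - T η t :=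
      (Lp.coeFn_sub l (T η)).mono fun t ht => ht
    have hfu : IsSol (ico a b) V 0 (l - T η : L2 H a b) (fun t => f t - u t)
        (fun t => f₁ t - u₁ t) := (hf.sub hS hu).congr_force hS (by
      rw [restrict_ico]
      filter_upwards [hlT] with t ht
      rw [ht])
    have hfu0 : ∀ x ∈ ico a b, c ≤ x → f x - u x = 0 ∧ f₁ x - u₁ x = 0 := fun x hx hcx => by
      rw [(hf0 x hx hcx).1, (hf0 x hx hcx).2, (hu0 x hx (hcc.trans hcx)).1,
        (hu0 x hx (hcc.trans hcx)).2]
      simp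
    have hF := memLp_of_continuousOn (hfu.continuousOn hS) hc' fun x hx hcx => (hfu0 x hx hcx).1
    have hFae := hF.coeFn_toLp
    set F := hF.toLp _
    have h1 : inner ℂ g (l - T η) = inner ℂ k F := by
      refine h (F, l - T η) ((mem_alphaGraph_iff hV.lt hV.loc).2 ⟨_, _, hfu, hFae, ?_⟩)
      have h2 := sinOp_sq_add_cosOp_sq hα η
      simp only [hua, hu₁a, map_sub]
      rw [sub_add_sub_comm, h2, hη, sub_self]
    have hlT0 : ∀ᵐ t ∂(volume.restrict (ioo a b)), c ≤ t → (l - T η : L2 H a b) t = 0 := by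
      filter_upwards [hlT, hl, hT0c] with t h1 h2 h3 hct
      rw [h1, h2 hct, h3 hct, sub_zero]
    have hF0 : ∀ᵐ t ∂(volume.restrict (ioo a b)), c ≤ t → F t = 0 := by
      filter_upwards [hFae, ae_restrict_mem (measurableSet_ioo a b)] with t h1 h2 hct
      rw [h1, (hfu0 t (ioo_subset_ico h2) hct).1]
    have hgr := hV.green_of_eq_zero hfu hy hc' (hfu0 c hc' le_rfl).1 (hfu0 c hc' le_rfl).2
    rw [hya, hya', inner_zero_left, inner_zero_left, sub_zero, neg_zero] at hgr
    rw [inner_eq_intervalIntegral hc' hlT0, inner_eq_intervalIntegral hc' hF0, ← sub_eq_zero,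
      ← intervalIntegral.integral_sub (L2.intervalIntegrable_inner _ _ hc')
      (L2.intervalIntegrable_inner _ _ hc')] at h1
    have hi : IntervalIntegrable (fun t => inner ℂ (g t) ((l - T η : L2 H a b) t)
        - inner ℂ (k t) (F t)) volume a c :=
      (L2.intervalIntegrable_inner _ _ hc').sub (L2.intervalIntegrable_inner _ _ hc')
    have haec : ∀ {Q : ℝ → Prop}, (∀ᵐ t ∂(volume.restrict (ioo a b)), Q t) →
        ∀ᵐ t, t ∈ uIoc a c → Q t := fun {Q} hQ => by
      rw [ae_restrict_iff' (measurableSet_ioo a b)] at hQ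
      filter_upwards [hQ] with t ht hm
      rw [uIoc_of_le hc'.1] at hm
      exact ht ⟨hm.1, (EReal.coe_le_coe_iff.2 hm.2).trans_lt hc.2⟩
    have h2 : ∫ t in a..c, (inner ℂ (g t - y₀ t) (l t) - inner ℂ (g t - y₀ t) (T η t)) = 0 := by
      have h0 := congrArg₂ (· + ·) h1 hgr.2
      simp only [add_zero] at h0
      rw [← h0, ← intervalIntegral.integral_add hi hgr.1]
      refine intervalIntegral.integral_congr_ae ?_
      filter_upwards [haec hlT, haec hFae] with t h3 h4 hm
      rw [h3 hm, h4 hm]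
      simp only [inner_sub_left, inner_sub_right]
      ring
    have h3 := hV.green_of_eq_zero hf (hY.isSol e) hc' hfc hf₁c
    simp only [Pi.zero_apply, inner_zero_left, zero_sub, hY.1, hY.2.1] at h3
    have h4 : inner ℂ ((-sinOp α) e) (f₁ a) - inner ℂ (cosOp α e) (f a) = -inner ℂ e η := by
      rw [neg_apply, inner_neg_left, inner_sinOp, inner_cosOp, hη,
        inner_add_right]
      ring
    have h5 : inner ℂ e η = ∫ t in a..c, inner ℂ (g t - y₀ t) (T η t) := by
      rw [he, ContinuousLinearMap.adjoint_inner_left, inner_eq_intervalIntegral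
        (ioo_subset_ico hc₀) (hT0 η), intervalIntegral_inner_congr (ioo_subset_ico hc₀) hPae]
      rw [intervalIntegral.integral_of_le hc₀.1.le, intervalIntegral.integral_of_le hc.1.le]
      refine (setIntegral_eq_of_subset_of_ae_sdiff_eq_zero measurableSet_Ioc.nullMeasurableSet
        (Ioc_subset_Ioc_right hcc) ?_).symm
      have := hT0 η
      rw [ae_restrict_iff' (measurableSet_ioo a b)] at this
      filter_upwards [this] with t ht hm
      rw [ht ⟨hm.1.1, (EReal.coe_le_coe_iff.2 hm.1.2).trans_lt hc.2⟩
        (not_le.1 fun h => hm.2 ⟨hm.1.1, h⟩).le, inner_zero_right]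
    have h6 := intervalIntegrable_inner_of_continuousOn hYc l hc'
    have h7 : ∀ v : L2 H a b, IntervalIntegrable (fun t => inner ℂ (g t - y₀ t) (v t)) volume a c :=
      fun v => by
        simp only [inner_sub_left]
        exact (L2.intervalIntegrable_inner g v hc').sub
          (intervalIntegrable_inner_of_continuousOn hyc v hc')
    rw [intervalIntegral.integral_sub (h7 l) (h7 (T η)), ← h5] at h2
    rw [intervalIntegral.integral_add (h7 l) h6]
    have h8 := h3.2
    rw [intervalIntegral.integral_neg, h4] at h8
    linear_combination h2 - h8
  have hzero : ∀ᵐ t ∂(volume.restrict (ioo a b)), g t - y₀ t + Y t e = 0 := by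
    refine ae_ioo_of_forall_Ioo (ioo_subset_ico hc₀) fun c hc hcc => ?_
    have hc' := ioo_subset_ico hc
    -- The truncation of `g - y₀ + Y e` is itself an admissible force, hence orthogonal to itself.
    have hL := memLp_indicator_Ioo (g := g) (hyc.sub hYc) hc'
    have hLae := hL.coeFn_toLp
    set l := hL.toLp _
    have hl : ∀ᵐ t ∂(volume.restrict (ioo a b)), c ≤ t → l t = 0 := hLae.mono fun t ht hct => by
      rw [ht, indicator_of_notMem fun hm => hm.2.not_ge hct]
    have h1 := orth c hc hcc l hl
    have h2 : inner ℂ l l = (0 : ℂ) := by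
      rw [inner_eq_intervalIntegral hc' hl, intervalIntegral_inner_congr hc' hLae, ← h1]
      refine intervalIntegral.integral_congr fun t _ => ?_
      simp only [Pi.sub_apply, ← inner_add_left]
      congr 1
      abel
    have h3 : l = 0 := inner_self_eq_zero.1 h2
    have h4 := hLae.symm.trans (h3 ▸ Lp.coeFn_zero H 2 _)
    rw [EventuallyEq, ae_restrict_iff' (measurableSet_ioo a b)] at h4
    filter_upwards [h4] with t ht hm
    have := ht (Ioo_subset_ioo hc' hm)
    rw [indicator_of_mem hm, Pi.zero_apply, Pi.sub_apply] at this
    rw [← this]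
    abel
  have hs := (hy.sub hS (hY.isSol e)).congr_force hS (z' := 0) (k' := k)
    (Eventually.of_forall fun t => by simp)
  refine (mem_alphaGraph_iff hV.lt hV.loc).2 ⟨_, _, hs, ?_, ?_⟩
  · filter_upwards [hzero] with t ht
    rw [← sub_eq_zero, ← ht]
    abel
  · simp only [hya, hya', hY.1, hY.2.1, zero_sub, map_neg, neg_apply, neg_neg, sinOp_cosOp]
    abel

/-- `H_α` is its own adjoint, and the graph of an adjoint is an intersection of closed conditions.
-/
theorem isClosed_alphaGraph (hV : IsWeylPotential a b V) {α : H →L[ℂ] H} (hα : IsSelfAdjoint α) :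
    IsClosed (alphaGraph a b V α : Set (L2 H a b × L2 H a b)) := by
  have : (alphaGraph a b V α : Set (L2 H a b × L2 H a b)) =
      ⋂ p ∈ alphaGraph a b V α, {q | inner ℂ q.1 p.2 = inner ℂ q.2 p.1} := by
    ext q
    simp only [mem_iInter, mem_ofPred_eq, SetLike.mem_coe]
    exact ⟨fun hq p hp => alphaGraph_symmetric hV hα hp hq,
      fun h => mem_alphaGraph_of_forall hV hα h⟩
  rw [this]
  exact isClosed_biInter fun p _ => isClosed_eq (by fun_prop) (by fun_prop)

theorem isResolvent_iff {X : Type*} [NormedAddCommGroup X] [NormedSpace ℂ X] {T : X →ₗ.[ℂ] X}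
    {z : ℂ} {R : X →L[ℂ] X} : IsResolvent T z R ↔
      (∀ p ∈ T.graph, R (p.2 - z • p.1) = p.1) ∧ ∀ g, (R g, g + z • R g) ∈ T.graph := by
  refine and_congr ⟨fun h p hp => ?_, fun h f => h _ (T.mem_graph f)⟩ (forall_congr' fun g => ?_)
  · obtain ⟨u, h1, h2⟩ := (LinearPMap.mem_graph_iff T).1 hp
    rw [← h1, ← h2, h u]
  · rw [LinearPMap.mem_graph_iff]
    constructor
    · rintro ⟨h, e⟩
      exact ⟨⟨R g, h⟩, rfl, sub_eq_iff_eq_add.1 e⟩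
    · rintro ⟨u, h1, h2⟩
      have hu : R g ∈ T.domain := by
        have := u.2
        rwa [h1] at this
      have : u = ⟨R g, hu⟩ := Subtype.ext h1
      exact ⟨hu, by rw [← this, h2, add_sub_cancel_right]⟩

/-- Non-real numbers belong to the resolvent set of `H_α`. -/
theorem mem_resolventSetOf (hV : IsWeylPotential a b V) {α : H →L[ℂ] H} (hα : IsSelfAdjoint α)
    {z : ℂ} (hz : z.im ≠ 0) : z ∈ resolventSetOf (schrodingerOp a b V α) := by
  have hcl := isClosed_alphaGraph hV hα
  let Γ := alphaGraph a b V α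
  have : CompleteSpace Γ := hcl.completeSpace_coe
  let Φ : Γ →L[ℂ] L2 H a b := ContinuousLinearMap.comp (ContinuousLinearMap.snd ℂ _ _ -
    z • ContinuousLinearMap.fst ℂ _ _) Γ.subtypeL
  have hΦ : ∀ p : Γ, Φ p = p.1.2 - z • p.1.1 := fun p => rfl
  have hz' : 0 < |z.im| := abs_pos.2 hz
  have hle : ∀ p : Γ, |z.im| * ‖p.1.1‖ ≤ ‖Φ p‖ := fun p => abs_im_mul_norm_le hV hα p.2 z
  have hanti : ∀ p : Γ, ‖p‖ ≤ (|z.im|⁻¹ + (1 + ‖z‖ * |z.im|⁻¹)) * ‖Φ p‖ := fun p => by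
    have h1 : ‖p.1.1‖ ≤ |z.im|⁻¹ * ‖Φ p‖ := by
      rw [← div_eq_inv_mul, le_div_iff₀ hz', mul_comm]
      exact hle p
    have h2 : ‖p.1.2‖ ≤ ‖Φ p‖ + ‖z‖ * ‖p.1.1‖ := by
      rw [← norm_smul]
      simpa [hΦ] using norm_add_le (p.1.2 - z • p.1.1) (z • p.1.1)
    have h3 := mul_le_mul_of_nonneg_left h1 (norm_nonneg z)
    have h4 := norm_nonneg (Φ p)
    have h5 : 0 ≤ |z.im|⁻¹ * ‖Φ p‖ := by positivity
    have h6 := mul_nonneg (norm_nonneg z) h5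
    have h7 : ‖p.1.1‖ ≤ (|z.im|⁻¹ + (1 + ‖z‖ * |z.im|⁻¹)) * ‖Φ p‖ := by linarith
    have h8 : ‖p.1.2‖ ≤ (|z.im|⁻¹ + (1 + ‖z‖ * |z.im|⁻¹)) * ‖Φ p‖ := by linarith
    exact max_le h7 h8
  have hK : 0 ≤ |z.im|⁻¹ + (1 + ‖z‖ * |z.im|⁻¹) := by positivity
  have hanti' : AntilipschitzWith ⟨_, hK⟩ Φ := Φ.antilipschitz_of_bound hanti
  have hinj : Φ.ker = ⊥ := LinearMap.ker_eq_bot.2 hanti'.injective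
  have hrc : IsClosed (Φ.range : Set (L2 H a b)) := hanti'.isClosed_range Φ.uniformContinuous
  have hsurj : Φ.range = ⊤ := by
    have : CompleteSpace Φ.range := hrc.completeSpace_coe
    rw [← Submodule.orthogonal_eq_bot_iff, Submodule.eq_bot_iff]
    intro g hg
    -- A vector orthogonal to the range of `H_α - z` is an eigenvector of the adjoint, that is of
    -- `H_α`, for the non-real eigenvalue `conj z`; the lower bound excludes this unless it is zero.
    have h1 : (g, starRingEnd ℂ z • g) ∈ alphaGraph a b V α := by
      refine mem_alphaGraph_of_forall hV hα fun p hp => ?_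
      have := (Submodule.mem_orthogonal' _ _).1 hg (Φ ⟨p, hp⟩) ⟨⟨p, hp⟩, rfl⟩
      rw [hΦ, inner_sub_right, inner_smul_right, sub_eq_zero] at this
      rw [this, inner_smul_left, Complex.conj_conj]
    have h2 := abs_im_mul_norm_le hV hα h1 (starRingEnd ℂ z)
    rw [sub_self, norm_zero, Complex.conj_im, abs_neg] at h2
    have : ‖g‖ = 0 := by nlinarith [norm_nonneg g]
    exact norm_eq_zero.1 this
  let e := ContinuousLinearEquiv.ofBijective Φ hinj hsurj
  have he : ∀ p, e p = p.1.2 - z • p.1.1 := fun p => rfl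
  refine ⟨((ContinuousLinearMap.fst ℂ _ _).comp Γ.subtypeL).comp (e.symm : L2 H a b →L[ℂ] Γ),
    isResolvent_iff.2 ⟨fun p hp => ?_, fun g => ?_⟩⟩
  · have : p.2 - z • p.1 = e ⟨p, hp⟩ := rfl
    simp [this]
  · have h1 := he (e.symm g)
    rw [e.apply_symm_apply] at h1
    have h2 : g + z • (e.symm g).1.1 = (e.symm g).1.2 :=
      (sub_eq_iff_eq_add.1 h1.symm).symm
    change ((e.symm g).1.1, g + z • (e.symm g).1.1) ∈ _
    rw [h2]
    exact (e.symm g).2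

end

/-! ### Square integrable solutions and the Weyl–Titchmarsh function. -/

section

variable {H : Type*} [NormedAddCommGroup H] [InnerProductSpace ℂ H] [CompleteSpace H]
  {a : ℝ} {b : EReal} {V : ℝ → H →L[ℂ] H} {α : H →L[ℂ] H} {z : ℂ}

theorem theta_spec (hV : IsWeylPotential a b V) (α : H →L[ℂ] H) (z : ℂ) :
    ∃ θ₁, IsOpSolution a b V z (cosOp α) (sinOp α) (theta a b V α z) θ₁ :=
  opSolution_spec hV.lt hV.loc z _ _

theorem phi_spec (hV : IsWeylPotential a b V) (α : H →L[ℂ] H) (z : ℂ) :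
    ∃ φ₁, IsOpSolution a b V z (-sinOp α) (cosOp α) (phi a b V α z) φ₁ :=
  opSolution_spec hV.lt hV.loc z _ _

/-- The solution with coefficients `f`, `g` with respect to `θ_α`, `φ_α`. -/
theorem exists_isSol_theta_phi (hV : IsWeylPotential a b V) (α : H →L[ℂ] H) (z : ℂ) (f g : H) :
    ∃ y₁, IsSol (ico a b) V z 0 (fun t => theta a b V α z t f + phi a b V α z t g) y₁ ∧
      theta a b V α z a f + phi a b V α z a g = cosOp α f - sinOp α g ∧
      y₁ a = sinOp α f + cosOp α g := by
  obtain ⟨θ₁, hθ⟩ := theta_spec hV α z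
  obtain ⟨φ₁, hφ⟩ := phi_spec hV α z
  refine ⟨fun t => θ₁ t f + φ₁ t g, ?_, ?_, ?_⟩
  · simpa using! (hθ.isSol f).add (ico_ordConnected a b) (hφ.isSol g)
  · rw [hθ.1, hφ.1, neg_apply, sub_eq_add_neg]
  · simp only [hθ.2.1, hφ.2.1]

theorem mem_eigenspaceMax_iff {u : L2 H a b} :
    u ∈ eigenspaceMax a b V z ↔ (u, z • u) ∈ maxGraph a b V := by
  rw [← maxOp_graph, LinearPMap.mem_graph_iff]
  constructor
  · rintro ⟨h, e⟩
    exact ⟨⟨u, h⟩, rfl, e⟩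
  · rintro ⟨v, h1, h2⟩
    have hu : u ∈ (maxOp a b V).domain := by
      have := v.2
      rwa [h1] at this
    have : v = ⟨u, hu⟩ := Subtype.ext h1
    exact ⟨hu, by rw [← this, h2]⟩

theorem IsSol.isSol_zero {u : L2 H a b} {y y₁ : ℝ → H} (h : IsSol (ico a b) V z 0 y y₁)
    (hu : u =ᵐ[volume.restrict (ioo a b)] y) :
    IsSol (ico a b) V 0 (z • u : L2 H a b) y y₁ := by
  refine h.congr_force (ico_ordConnected a b) ?_
  rw [restrict_ico]
  filter_upwards [hu, Lp.coeFn_smul z u] with t h1 h2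
  rw [h2, Pi.smul_apply, h1]
  simp

theorem mem_eigenspaceMax_of_ae_eq (hV : IsWeylPotential a b V) {f g : H} {u : L2 H a b}
    (hu : u =ᵐ[volume.restrict (ioo a b)]
      fun x => theta a b V α z x f + phi a b V α z x g) : u ∈ eigenspaceMax a b V z := by
  obtain ⟨y₁, hs, -, -⟩ := exists_isSol_theta_phi hV α z f g
  exact mem_eigenspaceMax_iff.2 ((mem_maxGraph_iff hV.lt hV.loc).2 ⟨_, y₁, hs.isSol_zero hu, hu⟩)

/-- A cutoff solution `w` has the prescribed coefficient `f`. Subtracting `v = (H_α - z)⁻¹ (τ - z)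
w` yields a square integrable homogeneous solution and leaves that coefficient unchanged, as `v`
satisfies the boundary condition. -/
theorem exists_sol_memLp (hV : IsWeylPotential a b V) (hα : IsSelfAdjoint α)
    (hz : z ∈ resolventSetOf (schrodingerOp a b V α)) (f : H) :
    ∃ g, ∃ u : L2 H a b, u =ᵐ[volume.restrict (ioo a b)]
      fun x => theta a b V α z x f + phi a b V α z x g := by
  have hS := ico_ordConnected a b
  obtain ⟨R, hR⟩ := hz
  obtain ⟨c, hc, T, hT0, hT⟩ := exists_cutoff_solution hV.lt hV.loc α
  obtain ⟨w, w₁, hw, hwa, hw₁a, hw0⟩ := hT f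
  have hF := memLp_of_continuousOn (hw.continuousOn hS) (ioo_subset_ico hc)
    fun x hx hcx => (hw0 x hx hcx).1
  have hFae := hF.coeFn_toLp
  set F := hF.toLp _
  set r := R (T f - z • F) with hr
  obtain ⟨v, v₁, hv, hvae, hvbc⟩ := (mem_alphaGraph_iff hV.lt hV.loc).1
    ((isResolvent_iff.1 hR).2 (T f - z • F))
  rw [← hr] at hv hvae
  have hs : IsSol (ico a b) V z 0 (fun t => w t - v t) (fun t => w₁ t - v₁ t) := by
    refine (hw.sub hS hv).congr_force hS ?_
    rw [restrict_ico]
    filter_upwards [hFae, hvae, Lp.coeFn_add (T f - z • F) (z • r), Lp.coeFn_sub (T f) (z • F),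
      Lp.coeFn_smul z F, Lp.coeFn_smul z r] with t h1 h2 h3 h4 h5 h6
    simp only [h3, h4, h5, h6, Pi.add_apply, Pi.sub_apply, Pi.smul_apply, h1, h2, zero_smul,
      Pi.zero_apply, add_zero, smul_sub]
    abel
  set g := cosOp α (w₁ a - v₁ a) - sinOp α (w a - v a)
  obtain ⟨y₁, hy, hya, hy₁a⟩ := exists_isSol_theta_phi hV α z f g
  have hf : cosOp α (w a - v a) + sinOp α (w₁ a - v₁ a) = f := by
    have := cosOp_sq_add_sinOp_sq hα f
    rw [hwa, hw₁a, map_sub, map_sub, sub_add_sub_comm, this, add_comm, hvbc, sub_zero]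
  refine ⟨g, F - r, ?_⟩
  filter_upwards [Lp.coeFn_sub F r, hFae, hvae, ae_restrict_mem (measurableSet_ioo a b)]
    with t h1 h2 h3 h4
  rw [h1, Pi.sub_apply, h2, h3]
  refine (hs.eq_of_eq hS hV.loc locallyIntegrableOn_zero hy (left_mem_ico hV.lt) ?_ ?_
    (ioo_subset_ico h4)).1
  · rw [hya, ← hf, eq_cosOp_sub_sinOp hα]
  · rw [hy₁a, ← hf, eq_sinOp_add_cosOp hα]

/-- The difference `phi (g - g')` is in the kernel of `H_α - z`, hence zero, and a vanishing
solution has zero data at `a`. -/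
theorem coeff_unique (hV : IsWeylPotential a b V) (hα : IsSelfAdjoint α)
    (hz : z ∈ resolventSetOf (schrodingerOp a b V α)) {f g g' : H} {u u' : L2 H a b}
    (hu : u =ᵐ[volume.restrict (ioo a b)]
      fun x => theta a b V α z x f + phi a b V α z x g)
    (hu' : u' =ᵐ[volume.restrict (ioo a b)]
      fun x => theta a b V α z x f + phi a b V α z x g') : g = g' := by
  have hS := ico_ordConnected a b
  obtain ⟨R, hR⟩ := hz
  obtain ⟨y₁, hy, hya, hy₁a⟩ := exists_isSol_theta_phi hV α z 0 (g - g')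
  have hd : (u - u' : L2 H a b) =ᵐ[volume.restrict (ioo a b)]
      fun x => theta a b V α z x 0 + phi a b V α z x (g - g') := by
    filter_upwards [hu, hu', Lp.coeFn_sub u u'] with t h1 h2 h3
    rw [h3, Pi.sub_apply, h1, h2, map_zero, map_sub]
    abel
  have hmem : (u - u', z • (u - u')) ∈ alphaGraph a b V α := by
    refine (mem_alphaGraph_iff hV.lt hV.loc).2 ⟨_, y₁, hy.isSol_zero hd, hd, ?_⟩
    rw [hya, hy₁a]
    simp [sinOp_cosOp]
  have h0 := (isResolvent_iff.1 hR).1 _ hmem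
  simp only [sub_self, map_zero] at h0
  have hae : (fun x => theta a b V α z x 0 + phi a b V α z x (g - g'))
      =ᵐ[volume.restrict (ioo a b)] (0 : ℝ → H) := by
    refine hd.symm.trans ?_
    rw [← h0]
    exact Lp.coeFn_zero _ _ _
  have heq := (hy.mono ioo_subset_ico).eqOn (IsSol.zero (V := V) (z := z)) hae
  obtain ⟨x₀, h₀⟩ := ioo_nonempty hV.lt
  have ha := hy.eq_of_eq hS hV.loc locallyIntegrableOn_zero IsSol.zero (ioo_subset_ico h₀)
    (heq.1 h₀) (heq.2 h₀) (left_mem_ico hV.lt)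
  have h1 := cosOp_sub_sinOp_eq hα 0 (g - g')
  rw [← hya, ← hy₁a, ha.1, ha.2, Pi.zero_apply, map_zero, map_zero, sub_zero] at h1
  exact sub_eq_zero.1 h1.symm

/-- The Wronskian at `a` of square integrable solutions for `z` and its conjugate vanishes. -/
theorem inner_coeff (hV : IsWeylPotential a b V) (hα : IsSelfAdjoint α) {f g f' g' : H}
    {u u' : L2 H a b}
    (hu : u =ᵐ[volume.restrict (ioo a b)]
      fun x => theta a b V α (starRingEnd ℂ z) x f + phi a b V α (starRingEnd ℂ z) x g)
    (hu' : u' =ᵐ[volume.restrict (ioo a b)]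
      fun x => theta a b V α z x f' + phi a b V α z x g') :
    inner ℂ f g' = inner ℂ g f' := by
  obtain ⟨w₁, hw, hwa, hw₁a⟩ := exists_isSol_theta_phi hV α (starRingEnd ℂ z) f g
  obtain ⟨y₁, hy, hya, hy₁a⟩ := exists_isSol_theta_phi hV α z f' g'
  have hz0 : ((0 : L2 H a b) : ℝ → H) =ᵐ[volume.restrict (ico a b)] 0 := by
    rw [restrict_ico]
    exact Lp.coeFn_zero _ _ _
  have hzero : ∀ {ζ : ℂ} {p p₁ : ℝ → H}, IsSol (ico a b) V ζ 0 p p₁ →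
      IsSol (ico a b) V ζ (0 : L2 H a b) p p₁ := fun h =>
    h.congr_force (ico_ordConnected a b) (hz0.mono fun t ht => by rw [ht])
  have := hV.green (hzero hy) (hzero hw) hu' hu (left_mem_ico hV.lt)
  rw [hya, hy₁a, hwa, hw₁a, inner_boundary hα, Complex.conj_conj, sub_self] at this
  have h0 : ∫ t in ioo a b, ((0 : ℂ) * inner ℂ (u t) (u' t) -
      inner ℂ (u t) ((0 : L2 H a b) t) + inner ℂ ((0 : L2 H a b) t) (u' t)) = 0 := by
    rw [integral_congr_ae (g := fun _ => (0 : ℂ)), integral_zero]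
    filter_upwards [Lp.coeFn_zero H 2 (volume.restrict (ioo a b))] with t ht
    rw [ht]
    simp
  rw [h0] at this
  linear_combination this

/-- Uniqueness of the coefficient gives linearity. Boundedness follows as in the Hellinger–Toeplitz
theorem: the map for `z` has a formal adjoint defined everywhere, the one for `conj z`, so its graph
is closed. -/
theorem exists_isWeylM (hV : IsWeylPotential a b V) (hα : IsSelfAdjoint α)
    (hz : z ∈ resolventSetOf (schrodingerOp a b V α))
    (hz' : starRingEnd ℂ z ∈ resolventSetOf (schrodingerOp a b V α)) :
    ∃ M, IsWeylM a b V α z M := by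
  choose g u hu using exists_sol_memLp hV hα hz
  choose g' u' hu' using exists_sol_memLp hV hα hz'
  let L : H →ₗ[ℂ] H :=
    { toFun := g
      map_add' := fun f f' => by
        refine coeff_unique hV hα hz (hu (f + f')) (u' := u f + u f') ?_
        filter_upwards [Lp.coeFn_add (u f) (u f'), hu f, hu f'] with t h1 h2 h3
        rw [h1, Pi.add_apply, h2, h3, map_add, map_add]
        abel
      map_smul' := fun c f => by
        refine coeff_unique hV hα hz (hu (c • f)) (u' := c • u f) ?_
        filter_upwards [Lp.coeFn_smul c (u f), hu f] with t h1 h2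
        rw [h1, Pi.smul_apply, h2, RingHom.id_apply, map_smul, map_smul, smul_add] }
  have hc : Continuous L := by
    refine L.continuous_of_seq_closed_graph fun f x y hf hLf => ext_inner_left ℂ fun h => ?_
    have h1 : ∀ f, inner ℂ h (L f) = inner ℂ (g' h) f := fun f =>
      inner_coeff hV hα (hu' h) (hu f)
    rw [h1]
    refine tendsto_nhds_unique ((tendsto_const_nhds (x := h)).inner hLf) ?_
    simp only [Function.comp_apply, h1]
    exact tendsto_const_nhds.inner hf
  refine ⟨⟨L, hc⟩, fun f e => ⟨fun h => ?_, fun ⟨v, _, hv⟩ => ?_⟩⟩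
  · have : g f = e := h
    have hv := hu f
    rw [this] at hv
    exact ⟨u f, mem_eigenspaceMax_of_ae_eq hV hv, hv⟩
  · exact coeff_unique hV hα hz (hu f) hv

/-- The spectral parameters for which both `m_α(z)` and `m_α(conj z)` are defined. -/
structure IsRegularPair (a : ℝ) (b : EReal) (V : ℝ → H →L[ℂ] H) (α : H →L[ℂ] H) (z : ℂ) :
    Prop where
  mem : z ∈ resolventSetOf (schrodingerOp a b V α)
  mem_conj : starRingEnd ℂ z ∈ resolventSetOf (schrodingerOp a b V α)

theorem IsRegularPair.conj (h : IsRegularPair a b V α z) :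
    IsRegularPair a b V α (starRingEnd ℂ z) :=
  ⟨h.mem_conj, by rw [Complex.conj_conj]; exact h.mem⟩

/-- A real point is its own conjugate, and non-real points are all in the resolvent set. Hence the
kernel formula is available on the whole resolvent set. -/
theorem isRegularPair_of_mem (hV : IsWeylPotential a b V) (hα : IsSelfAdjoint α)
    (hz : z ∈ resolventSetOf (schrodingerOp a b V α)) : IsRegularPair a b V α z := by
  refine ⟨hz, ?_⟩
  by_cases h : z.im = 0
  · rwa [Complex.conj_eq_iff_im.2 h]
  · exact mem_resolventSetOf hV hα (by simpa using h)

theorem exists_psi (hV : IsWeylPotential a b V) (hα : IsSelfAdjoint α)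
    (hz : IsRegularPair a b V α z) (f : H) :
    ∃ u : L2 H a b, u =ᵐ[volume.restrict (ioo a b)] fun x => psi a b V α z x f := by
  have hM : IsWeylM a b V α z (weylM a b V α z) :=
    Classical.epsilon_spec (exists_isWeylM hV hα hz.mem hz.mem_conj)
  obtain ⟨u, -, hu⟩ := (hM f _).1 rfl
  exact ⟨u, hu⟩

theorem adjoint_weylM (hV : IsWeylPotential a b V) (hα : IsSelfAdjoint α)
    (hz : IsRegularPair a b V α z) (f : H) :
    ContinuousLinearMap.adjoint (weylM a b V α z) f = weylM a b V α (starRingEnd ℂ z) f := by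
  refine ext_inner_right ℂ fun g => ?_
  obtain ⟨u, hu⟩ := exists_psi hV hα hz.conj f
  obtain ⟨v, hv⟩ := exists_psi hV hα hz g
  rw [ContinuousLinearMap.adjoint_inner_left]
  exact inner_coeff hV hα hu hv

end

/-! ### The Green's function and the resolvent. -/

section

variable {H : Type*} [NormedAddCommGroup H] [InnerProductSpace ℂ H] [CompleteSpace H]
  {a : ℝ} {b : EReal} {V : ℝ → H →L[ℂ] H} {α : H →L[ℂ] H} {z : ℂ}

open ContinuousLinearMap (adjoint)

/-- Boundedness of the coefficient family on compact subintervals. -/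
def LocallyNormBounded (a : ℝ) (b : EReal) (G : ℝ → H →L[ℂ] H) : Prop :=
  ∀ c ∈ ioo a b, ∃ C, ∀ t ∈ Ioo a c, ‖G t‖ ≤ C

/-- By `⟨h, K* u⟩ = ∫ ⟨K h, u⟩`, the vector `K* u` is the weak integral. Applied to truncations of
`u` this gives the Bochner integrals over `(a,c)`, and boundedness of `K*` gives their norm limit.
Only `G(·)* h` is square integrable, for each `h`; the operator norm need not be. -/
theorem hasIntegral_adjoint [TopologicalSpace.SeparableSpace H] (hab : (a : EReal) < b)
    {G : ℝ → H →L[ℂ] H} {K : H →L[ℂ] L2 H a b}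
    (hK : ∀ h, K h =ᵐ[volume.restrict (ioo a b)] fun t => adjoint (G t) h)
    (hG : LocallyNormBounded a b G) (u : L2 H a b) :
    HasIntegral a b (fun t => G t (u t)) (adjoint K u) := by
  have hw : ∀ h, (fun t => inner ℂ h (G t (u t))) =ᵐ[volume.restrict (ioo a b)]
      fun t => inner ℂ (K h t) (u t) := fun h => (hK h).mono fun t ht => by
    simp only [ht, ContinuousLinearMap.adjoint_inner_left]
  have hwi : ∀ h, IntegrableOn (fun t => inner ℂ h (G t (u t))) (ioo a b) volume := fun h =>
    Integrable.congr (L2.integrable_inner (K h) u) (hw h).symm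
  have hm : AEStronglyMeasurable (fun t => G t (u t)) (volume.restrict (ioo a b)) :=
    aestronglyMeasurable_of_inner fun h => (hwi h).1.aemeasurable
  have hui : ∀ c ∈ ioo a b, IntegrableOn u (Ioo a c) volume := fun c hc =>
    ((locallyIntegrableOn_iff_Icc (ico_ordConnected a b)).1 (L2.locallyIntegrableOn u) a
      (left_mem_ico hab) c (ioo_subset_ico hc)).mono_set Ioo_subset_Icc_self
  have hi : ∀ c ∈ ioo a b, IntegrableOn (fun t => G t (u t)) (Ioo a c) volume := fun c hc => by
    obtain ⟨C, hC⟩ := hG c hc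
    refine Integrable.mono' ((hui c hc).norm.const_mul C)
      (hm.mono_set (Ioo_subset_ioo (ioo_subset_ico hc))) ?_
    filter_upwards [ae_restrict_mem measurableSet_Ioo] with t ht
    exact (G t).le_of_opNorm_le (hC t ht) _
  have hind : ∀ c, MemLp ((Ioo a c).indicator u) 2 (volume.restrict (ioo a b)) := fun c =>
    (Lp.memLp u).indicator measurableSet_Ioo
  have hint : ∀ c ∈ ioo a b, ∫ t in Ioo a c, G t (u t) = adjoint K ((hind c).toLp _) := by
    intro c hc
    refine ext_inner_left ℂ fun h => ?_
    rw [← integral_inner (hi c hc) h, ContinuousLinearMap.adjoint_inner_right, L2.inner_def]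
    have h1 : ∫ t in Ioo a c, inner ℂ h (G t (u t)) = ∫ t in ioo a b,
        (Ioo a c).indicator (fun t => inner ℂ h (G t (u t))) t := by
      rw [setIntegral_indicator measurableSet_Ioo,
        inter_eq_right.2 (Ioo_subset_ioo (ioo_subset_ico hc))]
    rw [h1]
    refine integral_congr_ae ?_
    filter_upwards [hw h, (hind c).coeFn_toLp] with t h2 h3
    rw [h3]
    by_cases ht : t ∈ Ioo a c
    · rw [indicator_of_mem ht, indicator_of_mem ht, h2]
    · rw [indicator_of_notMem ht, indicator_of_notMem ht, inner_zero_right]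
  have hlim : Tendsto (fun c => (hind c).toLp _) (toLeft b) (𝓝 u) := by
    rw [tendsto_iff_norm_sub_tendsto_zero]
    have hae : ∀ c, ∀ᵐ t ∂(volume.restrict (ioo a b)), ((hind c).toLp _ - u : L2 H a b) t =
        (Ioo a c).indicator u t - u t := fun c => by
      filter_upwards [Lp.coeFn_sub ((hind c).toLp _) u, (hind c).coeFn_toLp] with t h1 h2
      rw [h1, Pi.sub_apply, h2]
    have h1 : Tendsto (fun c => ∫ t in ioo a b, ‖(Ioo a c).indicator u t - u t‖ ^ 2) (toLeft b)
        (𝓝 (∫ t in ioo a b, (0 : ℝ))) := by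
      refine tendsto_integral_filter_of_dominated_convergence (fun t => ‖u t‖ ^ 2) ?_ ?_ ?_ ?_
      · exact Eventually.of_forall fun c => ((((Lp.memLp u).1.indicator
          measurableSet_Ioo).sub (Lp.memLp u).1).norm.pow 2)
      · refine Eventually.of_forall fun c => Eventually.of_forall fun t => ?_
        by_cases ht : t ∈ Ioo a c
        · rw [indicator_of_mem ht, sub_self]
          simp
        · rw [indicator_of_notMem ht]
          simp
      · exact (Lp.memLp u).integrable_norm_pow (by norm_num)
      · filter_upwards [ae_restrict_mem (measurableSet_ioo a b)] with t ht
        obtain ⟨d, hd, htd⟩ := exists_mem_ioo_gt (ioo_subset_ico ht)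
        refine tendsto_const_nhds.congr' ?_
        filter_upwards [eventually_toLeft_ge (ioo_subset_ico hd)] with c hc
        rw [indicator_of_mem (show t ∈ Ioo a c from ⟨ht.1, htd.trans_le hc.1⟩), sub_self]
        simp
    rw [integral_zero] at h1
    have h2 : ∀ c, ‖(hind c).toLp _ - u‖ =
        Real.sqrt (∫ t in ioo a b, ‖(Ioo a c).indicator u t - u t‖ ^ 2) := fun c => by
      rw [eq_comm, Real.sqrt_eq_iff_mul_self_eq (integral_nonneg fun t => by positivity)
        (norm_nonneg _), ← sq]
      have h3 : inner ℂ ((hind c).toLp _ - u) ((hind c).toLp _ - u) =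
          ((‖(hind c).toLp _ - u‖ ^ 2 : ℝ) : ℂ) := by
        rw [inner_self_eq_norm_sq_to_K]
        norm_cast
      rw [L2.inner_def, integral_congr_ae (g := fun t =>
        ((‖(Ioo a c).indicator u t - u t‖ ^ 2 : ℝ) : ℂ)), integral_complex_ofReal] at h3
      · exact_mod_cast h3
      · filter_upwards [hae c] with t ht
        rw [ht, inner_self_eq_norm_sq_to_K]
        norm_cast
    simp only [h2]
    simpa using! h1.sqrt
  refine ⟨hi, ?_, fun h => ⟨hwi h, ?_⟩⟩
  · refine (((adjoint K).continuous.tendsto u).comp hlim).congr' ?_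
    obtain ⟨d, hd⟩ := ioo_nonempty hab
    filter_upwards [eventually_toLeft_ge (ioo_subset_ico hd)] with c hc
    exact (hint c ⟨hd.1.trans_le hc.1, hc.2.2⟩).symm
  · rw [integral_congr_ae (hw h), ContinuousLinearMap.adjoint_inner_right, L2.inner_def]

/-- The propagator of `τ - conj z` is symplectically conjugate to the one of `τ - z`. -/
theorem propagator_symplectic (hV : IsWeylPotential a b V) (hα : IsSelfAdjoint α)
    {θ₁ φ₁ : ℝ → H →L[ℂ] H}
    (hθ : IsOpSolution a b V (starRingEnd ℂ z) (cosOp α) (sinOp α)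
      (theta a b V α (starRingEnd ℂ z)) θ₁)
    (hφ : IsOpSolution a b V (starRingEnd ℂ z) (-sinOp α) (cosOp α)
      (phi a b V α (starRingEnd ℂ z)) φ₁)
    {x : ℝ} (hx : x ∈ ico a b) (h : H) :
    theta a b V α (starRingEnd ℂ z) x (adjoint (phi a b V α z x) h) -
      phi a b V α (starRingEnd ℂ z) x (adjoint (theta a b V α z x) h) = 0 ∧
    θ₁ x (adjoint (phi a b V α z x) h) - φ₁ x (adjoint (theta a b V α z x) h) = -h := by
  have hS := ico_ordConnected a b
  have ha := left_mem_ico hV.lt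
  -- The solution with data `(0, -h)` at `x` is expanded in `theta` and `phi`. Constancy of its
  -- Wronskian with each solution for `z` identifies the coefficients as `phi(z,x)* h` and
  -- `-theta(z,x)* h`; evaluation at `x` gives both identities.
  obtain ⟨y, y₁, hyx, hy₁x, hy⟩ := exists_isSol hS hV.loc (starRingEnd ℂ z) (k := 0)
    locallyIntegrableOn_zero hx 0 (-h)
  set f := cosOp α (y a) + sinOp α (y₁ a) with hf
  set g := cosOp α (y₁ a) - sinOp α (y a) with hg
  have hw : IsSol (ico a b) V (starRingEnd ℂ z) 0
      (fun t => theta a b V α (starRingEnd ℂ z) t f + phi a b V α (starRingEnd ℂ z) t g)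
      (fun t => θ₁ t f + φ₁ t g) := by
    simpa using! (hθ.isSol f).add hS (hφ.isSol g)
  have e1 := eq_cosOp_sub_sinOp hα (y a) (y₁ a)
  have e2 := eq_sinOp_add_cosOp hα (y a) (y₁ a)
  have hyw := hy.eq_of_eq hS hV.loc locallyIntegrableOn_zero hw ha
    (by simp only [hθ.1, hφ.1, neg_apply]; rw [← sub_eq_add_neg, hf, hg, e1])
    (by simp only [hθ.2.1, hφ.2.1]; rw [hf, hg, e2]) hx
  have key : ∀ f' g', inner ℂ h (theta a b V α z x f' + phi a b V α z x g') =
      inner ℂ f g' - inner ℂ g f' := fun f' g' => by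
    obtain ⟨v₁, hv, hva, hv₁a⟩ := exists_isSol_theta_phi hV α z f' g'
    have hW := (hv.isPrimitiveOn_wronskian hS hV.selfAdjoint_ico hy).eq a ha x hx
    simp only [Complex.conj_conj, sub_self, zero_mul, Pi.zero_apply, inner_zero_left,
      inner_zero_right, add_zero, intervalIntegral.integral_zero, hyx, hy₁x, inner_neg_left,
      zero_sub, neg_neg, hva, hv₁a] at hW
    rw [hW]
    have := inner_boundary hα f' g' f g
    rw [hf, hg, e1, e2] at this
    exact this
  have hfe : f = adjoint (phi a b V α z x) h := ext_inner_right ℂ fun g' => by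
    have := key 0 g'
    rw [map_zero, zero_add, inner_zero_right, sub_zero] at this
    rw [← this, ContinuousLinearMap.adjoint_inner_left]
  have hge : g = -adjoint (theta a b V α z x) h := ext_inner_right ℂ fun f' => by
    have := key f' 0
    rw [map_zero, add_zero, inner_zero_right, zero_sub] at this
    rw [inner_neg_left, ContinuousLinearMap.adjoint_inner_left, this, neg_neg]
  rw [hyx, hy₁x, hge, hfe] at hyw
  simp only [map_neg, ← sub_eq_add_neg] at hyw
  exact ⟨hyw.1.symm, hyw.2.symm⟩

theorem psi_spec (α : H →L[ℂ] H) (z : ℂ)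
    {θ₁ φ₁ : ℝ → H →L[ℂ] H}
    (hθ : IsOpSolution a b V z (cosOp α) (sinOp α) (theta a b V α z) θ₁)
    (hφ : IsOpSolution a b V z (-sinOp α) (cosOp α) (phi a b V α z) φ₁) (h : H) :
    IsSol (ico a b) V z 0 (fun t => psi a b V α z t h)
      (fun t => θ₁ t h + φ₁ t (weylM a b V α z h)) := by
  simpa using! (hθ.isSol h).add (ico_ordConnected a b) (hφ.isSol (weylM a b V α z h))

/-- Continuity of the adjoint kernel across the diagonal, and its derivative jump. The identities
for `theta` and `phi` carry over because the terms with `m` cancel, by `m(z)* = m(conj z)`. -/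
theorem psi_phi_symplectic (hV : IsWeylPotential a b V) (hα : IsSelfAdjoint α)
    (hz : IsRegularPair a b V α z) {θ₁ φ₁ : ℝ → H →L[ℂ] H}
    (hθ : IsOpSolution a b V (starRingEnd ℂ z) (cosOp α) (sinOp α)
      (theta a b V α (starRingEnd ℂ z)) θ₁)
    (hφ : IsOpSolution a b V (starRingEnd ℂ z) (-sinOp α) (cosOp α)
      (phi a b V α (starRingEnd ℂ z)) φ₁)
    {x : ℝ} (hx : x ∈ ico a b) (h : H) :
    psi a b V α (starRingEnd ℂ z) x (adjoint (phi a b V α z x) h) =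
      phi a b V α (starRingEnd ℂ z) x (adjoint (psi a b V α z x) h) ∧
    (θ₁ x (adjoint (phi a b V α z x) h) +
      φ₁ x (weylM a b V α (starRingEnd ℂ z) (adjoint (phi a b V α z x) h))) -
      φ₁ x (adjoint (psi a b V α z x) h) = -h := by
  obtain ⟨h1, h2⟩ := propagator_symplectic hV hα hθ hφ hx h
  have h3 : adjoint (psi a b V α z x) h = adjoint (theta a b V α z x) h +
      weylM a b V α (starRingEnd ℂ z) (adjoint (phi a b V α z x) h) := by
    rw [← adjoint_weylM hV hα hz, psi, map_add, ContinuousLinearMap.adjoint_comp]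
    rfl
  constructor
  · rw [h3, psi, add_apply, ContinuousLinearMap.comp_apply, map_add, sub_eq_zero.1 h1]
  · rw [h3, map_add, ← h2]
    abel

/-- The Green's function of `H_α`. -/
def greenKernel (a : ℝ) (b : EReal) (V : ℝ → H →L[ℂ] H) (α : H →L[ℂ] H) (z : ℂ) (x x' : ℝ) :
    H →L[ℂ] H :=
  if x ≤ x' then phi a b V α z x ∘L adjoint (psi a b V α (starRingEnd ℂ z) x')
  else psi a b V α z x ∘L adjoint (phi a b V α (starRingEnd ℂ z) x')

theorem greenKernel_of_le {x x' : ℝ} (h : x ≤ x') : greenKernel a b V α z x x' =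
    phi a b V α z x ∘L adjoint (psi a b V α (starRingEnd ℂ z) x') := if_pos h

theorem greenKernel_of_ge (hV : IsWeylPotential a b V) (hα : IsSelfAdjoint α)
    (hz : IsRegularPair a b V α z) {x x' : ℝ} (hx : x ∈ ico a b) (h : x' ≤ x) :
    greenKernel a b V α z x x' =
      psi a b V α z x ∘L adjoint (phi a b V α (starRingEnd ℂ z) x') := by
  rcases h.eq_or_lt with rfl | h
  · rw [greenKernel_of_le le_rfl]
    obtain ⟨θ₁, hθ⟩ := theta_spec hV α (starRingEnd ℂ (starRingEnd ℂ z))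
    obtain ⟨φ₁, hφ⟩ := phi_spec hV α (starRingEnd ℂ (starRingEnd ℂ z))
    ext e
    have := (psi_phi_symplectic hV hα hz.conj hθ hφ hx e).1
    rw [Complex.conj_conj] at this
    exact this.symm
  · exact if_neg h.not_ge

theorem greenKernel_bounded (hV : IsWeylPotential a b V) (α : H →L[ℂ] H) (z : ℂ) (x : ℝ) :
    LocallyNormBounded a b (greenKernel a b V α z x) := by
  intro c hc
  obtain ⟨θ₁, hθ⟩ := theta_spec hV α (starRingEnd ℂ z)
  obtain ⟨φ₁, hφ⟩ := phi_spec hV α (starRingEnd ℂ z)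
  obtain ⟨K, hK0, hK⟩ := hθ.exists_bound hV.lt hV.loc (ioo_subset_ico hc)
  obtain ⟨L, hL0, hL⟩ := hφ.exists_bound hV.lt hV.loc (ioo_subset_ico hc)
  refine ⟨‖phi a b V α z x‖ * (K + L * ‖weylM a b V α (starRingEnd ℂ z)‖) +
    ‖psi a b V α z x‖ * L, fun t ht => ?_⟩
  have ht' := Ioo_subset_Icc_self ht
  rw [greenKernel]
  split_ifs with h
  · refine ((ContinuousLinearMap.opNorm_comp_le _ _).trans ?_).trans
      (le_add_of_nonneg_right (by positivity))
    rw [LinearIsometryEquiv.norm_map]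
    gcongr
    refine (norm_add_le _ _).trans (add_le_add (hK t ht').1
      ((ContinuousLinearMap.opNorm_comp_le _ _).trans ?_))
    gcongr
    exact (hL t ht').1
  · refine ((ContinuousLinearMap.opNorm_comp_le _ _).trans ?_).trans
      (le_add_of_nonneg_left (by positivity))
    rw [LinearIsometryEquiv.norm_map]
    gcongr
    exact (hL t ht').1

theorem adjoint_greenKernel {x : ℝ} (h : H) :
    (fun t => adjoint (greenKernel a b V α z x t) h) = (Ici x).piecewise
      (fun t => psi a b V α (starRingEnd ℂ z) t (adjoint (phi a b V α z x) h))
      (fun t => phi a b V α (starRingEnd ℂ z) t (adjoint (psi a b V α z x) h)) := by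
  funext t
  by_cases ht : x ≤ t
  · rw [piecewise_eq_of_mem _ _ _ (mem_Ici.2 ht), greenKernel, if_pos ht,
      ContinuousLinearMap.adjoint_comp, ContinuousLinearMap.adjoint_adjoint]
    rfl
  · rw [piecewise_eq_of_notMem _ _ _ (by simpa using ht), greenKernel, if_neg ht,
      ContinuousLinearMap.adjoint_comp, ContinuousLinearMap.adjoint_adjoint]
    rfl

/-- Beyond `x` this is a square integrable Weyl solution; before `x` it is continuous on the compact
interval `[a,x]`. -/
theorem memLp_adjoint_greenKernel (hV : IsWeylPotential a b V) (hα : IsSelfAdjoint α)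
    (hz : IsRegularPair a b V α z) {x : ℝ} (hx : x ∈ ico a b) (h : H) :
    MemLp (fun t => adjoint (greenKernel a b V α z x t) h) 2 (volume.restrict (ioo a b)) := by
  rw [adjoint_greenKernel]
  obtain ⟨φ₁, hφ⟩ := phi_spec hV α (starRingEnd ℂ z)
  refine MemLp.piecewise measurableSet_Ici ?_ ?_
  · obtain ⟨u, hu⟩ := exists_psi hV hα hz.conj (adjoint (phi a b V α z x) h)
    exact (((Lp.memLp u).ae_eq hu)).mono_measure Measure.restrict_le_self
  · have hc := ((hφ.isSol (adjoint (psi a b V α z x) h)).continuousOn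
      (ico_ordConnected a b)).mono (Icc_subset_ico hx)
    obtain ⟨K, hK⟩ := isCompact_Icc.exists_bound_of_continuousOn hc
    rw [Measure.restrict_restrict measurableSet_Ici.compl]
    have hsub : (Ici x)ᶜ ∩ ioo a b ⊆ Icc a x := fun t ht =>
      ⟨ht.2.1.le, (not_le.1 (by simpa using ht.1)).le⟩
    have h1 : MemLp (fun t => phi a b V α (starRingEnd ℂ z) t (adjoint (psi a b V α z x) h)) 2
        (volume.restrict (Icc a x)) := by
      refine MemLp.of_bound (hc.aestronglyMeasurable measurableSet_Icc) K ?_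
      filter_upwards [ae_restrict_mem measurableSet_Icc] with t ht using hK t ht
    exact h1.mono_measure (Measure.restrict_mono hsub le_rfl)

/-- The integral splits at `x`, and each half is a Wronskian at `x`: on the right there is no
contribution from `b` by the limit-point property, on the left none from `a` by the boundary
condition. The difference of the two Wronskians is the derivative jump paired with `y(x)`. -/
theorem integral_greenKernel (hV : IsWeylPotential a b V) (hα : IsSelfAdjoint α)
    (hz : IsRegularPair a b V α z) {f u : L2 H a b} {y y₁ : ℝ → H}
    (hy : IsSol (ico a b) V z u y y₁) (hf : f =ᵐ[volume.restrict (ioo a b)] y)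
    (hbc : sinOp α (y₁ a) + cosOp α (y a) = 0) {x : ℝ} (hx : x ∈ ico a b) (h : H)
    (hi : IntegrableOn (fun t => inner ℂ (adjoint (greenKernel a b V α z x t) h) (u t))
      (ioo a b) volume) :
    ∫ t in ioo a b, inner ℂ (adjoint (greenKernel a b V α z x t) h) (u t) = inner ℂ h (y x) := by
  have hS := ico_ordConnected a b
  have ha := left_mem_ico hV.lt
  obtain ⟨θ₁, hθ⟩ := theta_spec hV α (starRingEnd ℂ z)
  obtain ⟨φ₁, hφ⟩ := phi_spec hV α (starRingEnd ℂ z)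
  obtain ⟨s1, s2⟩ := psi_phi_symplectic hV hα hz hθ hφ hx h
  set k := adjoint (phi a b V α z x) h with hk
  set l := adjoint (psi a b V α z x) h with hl
  have hker := adjoint_greenKernel (a := a) (b := b) (V := V) (α := α) (z := z) (x := x) h
  rw [← hk, ← hl] at hker
  obtain ⟨U, hU⟩ := exists_psi hV hα hz.conj k
  have hz0 : IsSol (ico a b) V (starRingEnd ℂ z) (0 : L2 H a b)
      (fun t => psi a b V α (starRingEnd ℂ z) t k)
      (fun t => θ₁ t k + φ₁ t (weylM a b V α (starRingEnd ℂ z) k)) := by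
    refine (psi_spec α _ hθ hφ k).congr_force hS ?_
    rw [restrict_ico]
    filter_upwards [Lp.coeFn_zero H 2 (volume.restrict (ioo a b))] with t ht
    rw [ht]
  have hright := hV.green hy hz0 hf hU hx
  rw [Complex.conj_conj, sub_self] at hright
  have hsub : ioo x b ⊆ ioo a b := fun t ht => ⟨hx.1.trans_lt ht.1, ht.2⟩
  have hR : ∫ t in ioo x b, inner ℂ (adjoint (greenKernel a b V α z x t) h) (u t) =
      inner ℂ (psi a b V α (starRingEnd ℂ z) x k) (y₁ x) -
      inner ℂ (θ₁ x k + φ₁ x (weylM a b V α (starRingEnd ℂ z) k)) (y x) := by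
    rw [← neg_inj, ← hright, ← integral_neg]
    refine integral_congr_ae ?_
    filter_upwards [ae_restrict_of_ae_restrict_of_subset hsub hU,
      ae_restrict_of_ae_restrict_of_subset hsub (Lp.coeFn_zero H 2 (volume.restrict (ioo a b))),
      ae_restrict_mem (measurableSet_ioo x b)] with t h1 h2 h3
    rw [h1, h2, congrFun hker t, piecewise_eq_of_mem _ _ _ (mem_Ici.2 h3.1.le)]
    simp
  have hleft := (hy.isPrimitiveOn_wronskian hS hV.selfAdjoint_ico (hφ.isSol l)).eq a ha x hx
  have hW0 : inner ℂ (phi a b V α (starRingEnd ℂ z) a l) (y₁ a) - inner ℂ (φ₁ a l) (y a) = 0 := by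
    refine wronskian_eq_zero hα hbc ?_
    rw [hφ.1, hφ.2.1, neg_apply, map_neg, sinOp_cosOp, add_neg_cancel]
  rw [hW0, zero_add, Complex.conj_conj, sub_self] at hleft
  have hL : ∫ t in Ioc a x, inner ℂ (adjoint (greenKernel a b V α z x t) h) (u t) =
      -(inner ℂ (phi a b V α (starRingEnd ℂ z) x l) (y₁ x) - inner ℂ (φ₁ x l) (y x)) := by
    rw [hleft, intervalIntegral.integral_of_le hx.1, ← integral_neg, integral_Ioc_eq_integral_Ioo,
      integral_Ioc_eq_integral_Ioo]
    refine setIntegral_congr_fun measurableSet_Ioo fun t ht => ?_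
    simp only [congrFun hker t]
    rw [piecewise_eq_of_notMem _ _ _ (by simpa using ht.2)]
    simp
  have hunion : ioo a b = Ioc a x ∪ ioo x b := by
    ext t
    constructor
    · intro ht
      rcases le_or_gt t x with h | h
      · exact Or.inl ⟨ht.1, h⟩
      · exact Or.inr ⟨h, ht.2⟩
    · rintro (ht | ht)
      · exact ⟨ht.1, (EReal.coe_le_coe_iff.2 ht.2).trans_lt hx.2⟩
      · exact hsub ht
  have hdisj : Disjoint (Ioc a x) (ioo x b) :=
    Set.disjoint_left.2 fun t h1 h2 => h2.1.not_ge h1.2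
  have hI : ∀ F : ℝ → ℂ, IntegrableOn F (ioo a b) volume →
      ∫ t in ioo a b, F t = (∫ t in Ioc a x, F t) + ∫ t in ioo x b, F t := fun F hF => by
    rw [hunion] at hF ⊢
    exact setIntegral_union hdisj (measurableSet_ioo x b) (hF.mono_set subset_union_left)
      (hF.mono_set subset_union_right)
  rw [hI _ hi, hL, hR, s1]
  have s3 : inner ℂ (θ₁ x k + φ₁ x (weylM a b V α (starRingEnd ℂ z) k)) (y x) =
      inner ℂ (φ₁ x l) (y x) - inner ℂ h (y x) := by
    rw [sub_eq_iff_eq_add.1 s2, inner_add_left, inner_neg_left]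
    ring
  rw [s3]
  ring

theorem exists_hasIntegral_greenKernel [TopologicalSpace.SeparableSpace H]
    (hV : IsWeylPotential a b V) (hα : IsSelfAdjoint α) {R : L2 H a b →L[ℂ] L2 H a b}
    (hR : IsResolvent (schrodingerOp a b V α) z R) (u : L2 H a b) :
    ∃ v : ℝ → H, ContinuousOn v (ico a b) ∧ R u =ᵐ[volume.restrict (ioo a b)] v ∧
      ∀ x ∈ ico a b, HasIntegral a b (fun t => greenKernel a b V α z x t (u t)) (v x) := by
  have hz := isRegularPair_of_mem hV hα ⟨R, hR⟩
  obtain ⟨y, y₁, hs, hf, hbc⟩ := (mem_alphaGraph_iff hV.lt hV.loc).1 ((isResolvent_iff.1 hR).2 u)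
  have hy := (isSol_zero_iff hf).2 hs
  refine ⟨y, hy.continuousOn (ico_ordConnected a b), hf, fun x hx => ?_⟩
  obtain ⟨K, hK⟩ := exists_clm_of_memLp (memLp_adjoint_greenKernel hV hα hz hx)
  have hi := hasIntegral_adjoint hV.lt hK (greenKernel_bounded hV α z x) u
  have hKu : adjoint K u = y x := ext_inner_left ℂ fun h => by
    have hae : (fun t => inner ℂ (K h t) (u t)) =ᵐ[volume.restrict (ioo a b)]
        fun t => inner ℂ (adjoint (greenKernel a b V α z x t) h) (u t) :=
      (hK h).mono fun t ht => by simp only [ht]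
    rw [ContinuousLinearMap.adjoint_inner_right, L2.inner_def, integral_congr_ae hae]
    exact integral_greenKernel hV hα hz hy hf hbc hx h
      (Integrable.congr (L2.integrable_inner (K h) u) hae)
  rwa [hKu] at hi

end

end WeylTitchmarsh

end

theorem theorem3p16 {H : Type*} [NormedAddCommGroup H] [InnerProductSpace ℂ H] [CompleteSpace H]
    [TopologicalSpace.SeparableSpace H] (a : ℝ) (b : EReal) (hab : (a : EReal) < b)
    (V : ℝ → H →L[ℂ] H) (hV : WeylTitchmarsh.IsPotential a b V)
    (ha : WeylTitchmarsh.RegularLeft a b V) (hb : WeylTitchmarsh.LimitPointRight a b V)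
    (α : H →L[ℂ] H) (hα : IsSelfAdjoint α) :
    -- non-real numbers belong to the resolvent set
    (∀ z : ℂ, z.im ≠ 0 →
      z ∈ WeylTitchmarsh.resolventSetOf (WeylTitchmarsh.schrodingerOp a b V α)) ∧
    ∃ G : ℂ → ℝ → ℝ → H →L[ℂ] H,
      -- the resolvent is the integral operator with kernel `G z`, pointwise on `[a, b)` for the
      -- continuous representative `v` of `(H_α - z)⁻¹ u`
      (∀ z ∈ WeylTitchmarsh.resolventSetOf (WeylTitchmarsh.schrodingerOp a b V α),
        ∀ R : WeylTitchmarsh.L2 H a b →L[ℂ] WeylTitchmarsh.L2 H a b,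
          WeylTitchmarsh.IsResolvent (WeylTitchmarsh.schrodingerOp a b V α) z R →
        ∀ u : WeylTitchmarsh.L2 H a b, ∃ v : ℝ → H,
          ContinuousOn v (WeylTitchmarsh.ico a b) ∧
          R u =ᵐ[volume.restrict (WeylTitchmarsh.ioo a b)] v ∧
          ∀ x ∈ WeylTitchmarsh.ico a b,
            WeylTitchmarsh.HasIntegral a b (fun x' => G z x x' (u x')) (v x)) ∧
      -- the Green's function for non-real `z`
      ∀ z : ℂ, z.im ≠ 0 → ∀ x ∈ WeylTitchmarsh.ico a b, ∀ x' ∈ WeylTitchmarsh.ico a b,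
        (x ≤ x' → G z x x' = WeylTitchmarsh.phi a b V α z x ∘L
          ContinuousLinearMap.adjoint (WeylTitchmarsh.psi a b V α (starRingEnd ℂ z) x')) ∧
        (x' ≤ x → G z x x' = WeylTitchmarsh.psi a b V α z x ∘L
          ContinuousLinearMap.adjoint (WeylTitchmarsh.phi a b V α (starRingEnd ℂ z) x')) := by
  have hW : WeylTitchmarsh.IsWeylPotential a b V :=
    ⟨hab, hV.isLocPotential ha, hV.selfAdjoint, hb⟩
  refine ⟨fun z hz => WeylTitchmarsh.mem_resolventSetOf hW hα hz,
    WeylTitchmarsh.greenKernel a b V α,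
    fun z _ R hR u => WeylTitchmarsh.exists_hasIntegral_greenKernel hW hα hR u,
    fun z hz x hx x' _ => ⟨fun h => WeylTitchmarsh.greenKernel_of_le h, fun h => ?_⟩⟩
  exact WeylTitchmarsh.greenKernel_of_ge hW hα (WeylTitchmarsh.isRegularPair_of_mem hW hα
    (WeylTitchmarsh.mem_resolventSetOf hW hα hz)) hx h
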